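/- Let $n,k$ be positive integers with $2k<n$. Label the vertices of a convex $n$-gon cyclically by $1,\dots,n$; a diagonal is a segment joining two distinct vertices (sides included), and two diagonals cross if they meet in a point interior to both. A $k$-triangulation is an inclusion-maximal set of diagonals no $k+1$ of which mutually cross. Put $\ell=n-2k$. A $k$-fan of Dyck paths of length $2\ell$ is a collection of $k$ (not necessarily distinct) lattice paths from $(0,0)$ to $(\ell,\ell)$ with unit north and east steps, each staying weakly above the main diagonal, which do not cross but may share edges. For a Ferrers shape $\lambda$ (English notation; box $(i,j)$ is in row $i$ from the north and column $j$ from the west, both starting with $1$), a north-east (south-east) chain of length $m$ is a sequence of $m$ boxes of $\lambda$, each strictly north (south) and strictly east of the preceding one, such that the smallest rectangle containing them is contained in $\lambda$. A $k$-north-east (south-east) filling of $\lambda$ is a set of boxes of $\lambda$ of maximal cardinality among those containing no north-east (south-east) chain of length $k+1$. Denote the sets of these by $\mathcal F_{NE}(\lambda,k)$ and $\mathcal F_{SE}(\lambda,k)$. Define a map $\varphi_\lambda$ on $\mathcal F_{NE}(\lambda,k)$ as follows. Given $S$, read the boxes $(i,j)$ of $\lambda\setminus S$ row by row from north to south, and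 from east to west within each row, writing the column $\binom{i}{i+j-1}$ for each. Insert the bottom letters from left to right by column Edelman–Greene insertion, recording the top letters, to obtain a recording tableau $Q$. (To insert $x$ in a column: if no entry exceeds $x$, append $x$ at the bottom. Otherwise let $y$ be the smallest entry exceeding $x$; leave the column unchanged if $y=x+1$ and $x$ is present, and replace $y$ by $x$ if not; then insert $y$ in the next column.) The shape of $Q$ is the Ferrers shape $\mu$ obtained from $\lambda$ by removing its first $k$ rows and columns. Subtract $i$ from all the entries in row $i$ of $Q$, for all $i$, to obtain a reverse plane partition $R$ with entries in $\{0,\dots,k\}$. Let $h$ and $w$ be the numbers of rows and columns of $\mu$. For $i=1,\dots,k$, let $p_i$ be the north-east path from the south-west to the north-east corner of the $h\times w$ rectangle around $\mu$ that separates the entries of $R$ smaller than $k+1-i$ from the other boxes of the rectangle, so that $p_1,\dots,p_k$ run from bottom to top. Then $\varphi_\lambda(S)$ consists of the boxes of $\lambda$ contained in no south-east chain of length $k+1$ and of the boxes of $\lambda$ in row $h+k+1-i-y$ and column $k+1-i+x$, for $1\le i\le k$ and all vertices $(x,y)$ of $p_i$, where $p_i$ starts in $(0,0)$. Now let $\lambda=(n-1,\dots,2,1)$.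 Let $\alpha$ send a set of diagonals to the set of boxes of $\lambda$ in row $n+1-b$ and column $a$, for all its diagonals joining vertices $a<b$. For a $k$-triangulation $T$, let $\Phi(T)$ consist of the paths $p_1,\dots,p_k$ obtained from $S=\alpha(T)$ as above, each preceded by a north step and followed by an east step. Let $\beta$ send a $k$-fan with paths $q_1,\dots,q_k$, listed from bottom to top, to the set consisting of the boxes of $\lambda$ contained in no south-east chain of length $k+1$ and of the boxes of $\lambda$ in row $\ell+k+1-i-y$ and column $k+1-i+x$, for $1\le i\le k$ and all vertices $(x,y)$ of $q_i$. Then: 1. $\Phi$ is a bijection from the $k$-triangulations of the $n$-gon to the $k$-fans of noncrossing Dyck paths of length $2(n-2k)$. 2. $\Phi$ is the specialization of $\varphi_\lambda$ to the staircase $\lambda=(n-1,\dots,2,1)$: the map $\varphi_\lambda$ is a bijection from $\mathcal F_{NE}(\lambda,k)$ to $\mathcal F_{SE}(\lambda,k)$, $\alpha$ is a bijection from the $k$-triangulations to $\mathcal F_{NE}(\lambda,k)$, $\beta$ is a bijection from the $k$-fans to $\mathcal F_{SE}(\lambda,k)$, and $\beta(\Phi(T))=\varphi_\lambda(\alpha(T))$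 for every $k$-triangulation $T$. -/

import Mathlib

namespace MaximalFillings

open DyckStep

/-! ### `k`-triangulations of a convex `n`-gon

The vertices of the `n`-gon are labelled in cyclic order by `Fin n`, and the diagonal joining the
vertices `a < b` is the pair `(a, b)`. The sides of the polygon count as diagonals. -/

/-- Two diagonals of the convex polygon cross if they meet in a point interior to both, that is,
if their endpoints interlace. -/
def Crosses {n : ℕ} (d e : Fin n × Fin n) : Prop :=
  (d.1 < e.1 ∧ e.1 < d.2 ∧ d.2 < e.2) ∨ (e.1 < d.1 ∧ d.1 < e.2 ∧ e.2 < d.2)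

/-- A set of diagonals of the `n`-gon no `k + 1` of which mutually cross. -/
def IsCrossingFree (n k : ℕ) (T : Finset (Fin n × Fin n)) : Prop :=
  (∀ d ∈ T, d.1 < d.2) ∧
    ¬ ∃ C : Finset (Fin n × Fin n), C ⊆ T ∧ C.card = k + 1 ∧
      ∀ d ∈ C, ∀ e ∈ C, d ≠ e → Crosses d e

/-- The `k`-triangulations of the convex `n`-gon: the inclusion-maximal sets of diagonals no
`k + 1` of which mutually cross. -/
def kTriangulations (n k : ℕ) : Set (Finset (Fin n × Fin n)) :=
  {T | Maximal (IsCrossingFree n k) T}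

/-! ### `k`-fans of Dyck paths

A lattice path is a list of steps, where `U` is a north step `(0, 1)` and `D` is an
east step `(1, 0)`. -/

/-- A Dyck path from `(0, 0)` to `(l, l)`, i.e. of length `2 * l`: it has `l` north steps, `l` east
steps, and stays weakly above the main diagonal. -/
def IsDyckPath (l : ℕ) (p : List DyckStep) : Prop :=
  ∃ w : DyckWord, w.toList = p ∧ w.semilength = l

/-- The lattice path `p` runs weakly below the lattice path `q`. -/
def WeaklyBelow (p q : List DyckStep) : Prop :=
  ∀ m : ℕ, (p.take m).count U ≤ (q.take m).count U

/-- The `k`-fans of Dyck paths from `(0, 0)` to `(l, l)`: collections of `k` Dyck paths that do not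
cross but may share edges. Two such paths do not cross if and only if one of them runs weakly below
the other, so the members of a fan are listed from the bottom to the top (with repetitions). -/
def kFans (k l : ℕ) : Set (Fin k → List DyckStep) :=
  {p | (∀ i, IsDyckPath l (p i)) ∧ ∀ i j, i ≤ j → WeaklyBelow (p i) (p j)}

/-! ### Fillings of Ferrers shapes

A Ferrers shape is a `YoungDiagram` in English notation: the box `(i, j)` lies in row `i` (counted
from north to south) and column `j` (counted from west to east), both starting with `0`.
A `(0,1)`-filling is the set of boxes that are filled with a `1`. -/

/-- The smallest rectangle containing the boxes of the sequence `c` is contained in `lam`. -/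
def RectangleIn (lam : YoungDiagram) {l : ℕ} (c : Fin l → ℕ × ℕ) : Prop :=
  ∀ b : ℕ × ℕ, (∃ s t, (c s).1 ≤ b.1 ∧ b.1 ≤ (c t).1) → (∃ s t, (c s).2 ≤ b.2 ∧ b.2 ≤ (c t).2) →
    b ∈ lam

/-- North-east chains of length `l` in `lam`. -/
def IsNEChain (lam : YoungDiagram) {l : ℕ} (c : Fin l → ℕ × ℕ) : Prop :=
  (∀ s t, s < t → (c t).1 < (c s).1 ∧ (c s).2 < (c t).2) ∧ RectangleIn lam c

/-- South-east chains of length `l` in `lam`. -/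
def IsSEChain (lam : YoungDiagram) {l : ℕ} (c : Fin l → ℕ × ℕ) : Prop :=
  (∀ s t, s < t → (c s).1 < (c t).1 ∧ (c s).2 < (c t).2) ∧ RectangleIn lam c

/-- Fillings of `lam` without a north-east chain of `1`s of length `k + 1`. -/
def AvoidsNE (lam : YoungDiagram) (k : ℕ) (S : Finset (ℕ × ℕ)) : Prop :=
  S ⊆ lam.cells ∧ ¬ ∃ c : Fin (k + 1) → ℕ × ℕ, IsNEChain lam c ∧ ∀ s, c s ∈ S

/-- Fillings of `lam` without a south-east chain of `1`s of length `k + 1`. -/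
def AvoidsSE (lam : YoungDiagram) (k : ℕ) (S : Finset (ℕ × ℕ)) : Prop :=
  S ⊆ lam.cells ∧ ¬ ∃ c : Fin (k + 1) → ℕ × ℕ, IsSEChain lam c ∧ ∀ s, c s ∈ S

/-- The `k`-north-east fillings of `lam`: the number of `1`s is maximal. -/
def neFillings (lam : YoungDiagram) (k : ℕ) : Set (Finset (ℕ × ℕ)) :=
  {S | AvoidsNE lam k S ∧ ∀ S', AvoidsNE lam k S' → S'.card ≤ S.card}

/-- The `k`-south-east fillings of `lam`: the number of `1`s is maximal. -/
def seFillings (lam : YoungDiagram) (k : ℕ) : Set (Finset (ℕ × ℕ)) :=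
  {S | AvoidsSE lam k S ∧ ∀ S', AvoidsSE lam k S' → S'.card ≤ S.card}

/-- The staircase shape `(n - 1, …, 2, 1)`. -/
def staircase (n : ℕ) : YoungDiagram where
  cells := (Finset.range n ×ˢ Finset.range n).filter fun b => b.1 + b.2 + 1 < n
  isLowerSet := by
    rintro ⟨a, b⟩ ⟨c, d⟩ h hab
    have h1 := h.1
    have h2 := h.2
    simp only [Finset.coe_filter, Finset.mem_product, Finset.mem_range, Set.mem_ofPred_eq] at *
    omega

/-- The Ferrers shape obtained from `lam` by removing its first `k` rows and its first `k`
columns. -/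
def innerShape (lam : YoungDiagram) (k : ℕ) : YoungDiagram where
  cells := lam.cells.filter fun b => (b.1 + k, b.2 + k) ∈ lam
  isLowerSet := by
    rintro ⟨a, b⟩ ⟨c, d⟩ h hab
    simp only [Finset.coe_filter, YoungDiagram.mem_cells, Set.mem_ofPred_eq] at *
    exact ⟨lam.isLowerSet h hab.1,
      lam.isLowerSet (show ((c + k, d + k) : ℕ × ℕ) ≤ (a + k, b + k) from
        ⟨Nat.add_le_add_right h.1 k, Nat.add_le_add_right h.2 k⟩) hab.2⟩

/-! ### From fillings to pipe dreams, biwords and tableaux -/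

/-- The reduced pipe dream associated with a filling `S` of `lam`, identified with its set of
crossings: the complement of `S` in `lam`. -/
def pipeDream (lam : YoungDiagram) (S : Finset (ℕ × ℕ)) : Finset (ℕ × ℕ) :=
  lam.cells \ S

/-- The reading biword of a set `P` of boxes of `lam`: the boxes are read row by row from north to
south and, within each row, from east to west. In terms of row and column indices `i, j` that start
with `1`, the box `(i, j)` contributes the column with top entry `i` and bottom entry `i + j - 1`. -/
def readingBiword (lam : YoungDiagram) (P : Finset (ℕ × ℕ)) : List (ℕ × ℕ) :=
  (List.range (lam.colLen 0)).flatMap fun i =>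
    ((List.range (lam.rowLen i)).reverse.filter fun j => decide ((i, j) ∈ P)).map fun j =>
      (i + 1, i + j + 1)

/-- Edelman--Greene insertion of a letter `x` into a single (strictly increasing) column: if no
entry exceeds `x`, then `x` is appended at the bottom. Otherwise let `y` be the smallest entry
exceeding `x`. If `y = x + 1` and `x` itself is present, the column is unchanged, else `x` replaces
`y`; in both cases `y` is passed on to the next column. -/
def insertColumn (x : ℕ) (c : List ℕ) : List ℕ × Option ℕ :=
  match c.find? fun y => decide (x < y) with
  | none => (c ++ [x], none)
  | some y =>
    if y = x + 1 ∧ x ∈ c then (c, some y) else (c.map fun z => if z = y then x else z, some y)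

/-- Column Edelman--Greene insertion of a letter into a tableau, given as the list of its columns.
The second component is the index of the column to which the new box is added. -/
def insertTableau : ℕ → List (List ℕ) → List (List ℕ) × ℕ
  | x, [] => ([[x]], 0)
  | x, c :: cs =>
    match insertColumn x c with
    | (c', none) => (c' :: cs, 0)
    | (c', some y) => (c' :: (insertTableau y cs).1, (insertTableau y cs).2 + 1)

/-- Add a box with entry `a` at the bottom of the `j`-th column of a tableau. -/
def recordAt (a : ℕ) : ℕ → List (List ℕ) → List (List ℕ)
  | 0, [] => [[a]]
  | 0, c :: cs => (c ++ [a]) :: cs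
  | j + 1, [] => [] :: recordAt a j []
  | j + 1, c :: cs => c :: recordAt a j cs

/-- The pair consisting of the insertion tableau and the recording tableau of a biword: the bottom
letters are inserted from left to right, and the top letters are recorded. -/
def edelmanGreene (t : List (ℕ × ℕ)) : List (List ℕ) × List (List ℕ) :=
  t.foldl (fun PQ ab =>
    ((insertTableau ab.2 PQ.1).1, recordAt ab.1 (insertTableau ab.2 PQ.1).2 PQ.2)) ([], [])

/-- The `k`-flagged tableau associated with a filling of `lam`: the recording tableau of the
reading biword of its pipe dream. -/
def flaggedTableau (lam : YoungDiagram) (S : Finset (ℕ × ℕ)) : List (List ℕ) :=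
  (edelmanGreene (readingBiword lam (pipeDream lam S))).2

/-- The reverse plane partition associated with a filling of `lam`: with row indices starting with
`1`, one subtracts `i` from all the entries in row `i` of the flagged tableau. -/
def reversePlanePartition (lam : YoungDiagram) (S : Finset (ℕ × ℕ)) (i j : ℕ) : ℕ :=
  ((flaggedTableau lam S).getD j []).getD i 0 - (i + 1)

/-! ### From reverse plane partitions to fans of paths and south-east fillings -/

/-- The lattice path from the south-west corner to the north-east corner of the rectangle with `h`
rows and `w` columns which has the first `a i` boxes of row `i`, for all `i < h`, on its north-west
side. Here `a` is weakly decreasing with `a i = 0` for `h ≤ i`. -/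
def boundaryPath (h w : ℕ) (a : ℕ → ℕ) : List DyckStep :=
  ((List.range h).reverse.flatMap fun i => List.replicate (a i - a (i + 1)) D ++ [U]) ++
    List.replicate (w - a 0) D

/-- The number of entries smaller than `m` in row `i` of the reverse plane partition, whose shape is
`innerShape lam k`. -/
def rowCount (lam : YoungDiagram) (k : ℕ) (S : Finset (ℕ × ℕ)) (m i : ℕ) : ℕ :=
  ((Finset.range ((innerShape lam k).rowLen i)).filter fun j =>
    reversePlanePartition lam S i j < m).card

/-- The fan of `k` noncrossing north-east paths inside `innerShape lam k` equivalent to the reverse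
plane partition of a filling of `lam`, listed from the bottom to the top: the path with index
`i : Fin k` separates the entries smaller than `k - i` from those that are at least `k - i`. -/
def pathFan (lam : YoungDiagram) (k : ℕ) (S : Finset (ℕ × ℕ)) (i : Fin k) : List DyckStep :=
  boundaryPath ((innerShape lam k).colLen 0) ((innerShape lam k).rowLen 0)
    (rowCount lam k S (k - i))

/-- The boxes of `lam` that are not contained in any south-east chain of length `k + 1` in `lam`;
they belong to every `k`-south-east filling. -/
def IsPassive (lam : YoungDiagram) (k : ℕ) (b : ℕ × ℕ) : Prop :=
  b ∈ lam ∧ ¬ ∃ c : Fin (k + 1) → ℕ × ℕ, IsSEChain lam c ∧ ∃ s, c s = b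

/-- The box `b` lies on the lifted path with index `i`, where `p` starts in `(0, 0)` and has `h`
north steps. With `x` and `y` the coordinates of a vertex of `p`, the vertex `(x, y)` of the bottom
path `i = 0` becomes the box in row `h + k - 1 - y` and column `k - 1 + x`; the path with index `i`
is shifted by further `i` rows to the north and `i` columns to the west. -/
def OnLiftedPath (k h i : ℕ) (p : List DyckStep) (b : ℕ × ℕ) : Prop :=
  ∃ m ≤ p.length, b.1 + i + 1 + (p.take m).count U = h + k ∧
    b.2 + i + 1 = k + (p.take m).count D

open Classical in
/-- The filling of `lam` by the boxes on the lifted paths of a fan, together with the passive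
boxes. -/
noncomputable def liftFan (lam : YoungDiagram) (k h : ℕ) (p : Fin k → List DyckStep) :
    Finset (ℕ × ℕ) :=
  lam.cells.filter fun b => IsPassive lam k b ∨ ∃ i : Fin k, OnLiftedPath k h i (p i) b

/-- The map from `k`-north-east fillings to `k`-south-east fillings of a Ferrers shape `lam`. -/
noncomputable def neToSe (lam : YoungDiagram) (k : ℕ) (S : Finset (ℕ × ℕ)) : Finset (ℕ × ℕ) :=
  liftFan lam k ((innerShape lam k).colLen 0) (pathFan lam k S)

/-! ### The staircase shape -/

/-- The filling of the staircase `(n - 1, …, 2, 1)` associated with a set of diagonals of the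
`n`-gon. With all labels starting with `1`, the diagonal `(a, b)` with `a < b` is the box in row
`n + 1 - b` and column `a`. -/
def diagonalsToFilling (n : ℕ) (T : Finset (Fin n × Fin n)) : Finset (ℕ × ℕ) :=
  T.image fun d => ((d.2.rev : ℕ), (d.1 : ℕ))

/-- The `k` Dyck paths associated with a set of diagonals of the `n`-gon: the paths of the fan of
the associated filling of the staircase, which run inside the triangle `(n - 2k - 1, …, 2, 1)`,
preceded by a north step and followed by an east step. -/
def triangulationToFan (n k : ℕ) (T : Finset (Fin n × Fin n)) (i : Fin k) : List DyckStep :=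
  U :: (pathFan (staircase n) k (diagonalsToFilling n T) i ++ [D])

/-- The filling of the staircase `(n - 1, …, 2, 1)` associated with a `k`-fan of Dyck paths from
`(0, 0)` to `(n - 2k, n - 2k)`. -/
noncomputable def fanToFilling (n k : ℕ) (p : Fin k → List DyckStep) : Finset (ℕ × ℕ) :=
  liftFan (staircase n) k (n - 2 * k) p

end MaximalFillings

/-!
The proof passes from fillings of the staircase `(n - 1, …, 2, 1)` to reduced words, from reduced
words to tableaux by Edelman--Greene insertion, and from tableaux to fans of lattice paths. Put
`l = n - 2 * k`.

*Fillings and reduced words.* Let the letters of the reading word of the complement of a filling `S`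
act on sequences by the operators that sort two neighbouring values into decreasing order, i.e. by
the generators of the 0-Hecke monoid. Row by row, the rank function of the resulting permutation
satisfies the same recursion as the maximal lengths of north-east chains in `S`
(`rankCount_boxWord`). Hence `S` has no chain of length `k + 1` if and only if certain ranks are at
most `k` (`avoidsNE_iff`). If `S` is also maximal under inclusion, then it contains all the boxes
whose letters are not in `[k + 1, n - k - 1]`, and the rank conditions force the permutation to be
the reversal of the positions `k + 1, …, n - k`. A letter that acts trivially could be deleted, so
the word has one letter for each of the `l * (l - 1) / 2` inversions (`reversal_of_maximal`). Thus
maximality under inclusion and maximal cardinality agree, and the maximal fillings are the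
complements of the sets of boxes whose words are reduced words of the reversal. Interlacing diagonals
are the same as north-east chains of boxes, which identifies the `k`-triangulations with the maximal
fillings (`bijOn_diagonalsToFilling`).

*Insertion.* Insertion of a reduced word replaces the word by an equivalent one, namely the reading
word of the insertion tableau (`insertTableau_spec`), and it can be reversed
(`exists_insertTableau`, `insertTableau_injective`). A reduced word of the reversal has
`l * (l - 1) / 2` letters, all in an interval of length `l - 1`, and the only tableau of this size
with such entries is the staircase tableau (`IsTab.eq_stairTableau`). So the words are in bijection
with the recordings of boxes that build up the staircase shape `(l - 1, …, 2, 1)`. The order in which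
boxes are read corresponds to the column-strictness of the recording tableau
(`isChain_recordSeq_iff`), and the condition that the biword comes from boxes, i.e. that a top letter
is at most its bottom letter, corresponds to the flag condition that the entries of row `i` are at
most `k + i` (`isRecording_fillingBiword`, `exists_filling_of_isRecording`). Subtracting `i` from the
entries of row `i` turns flagged tableaux into reverse plane partitions with entries in
`{0, …, k}`.

*Paths.* The level sets of a reverse plane partition are separated by `k` noncrossing paths, and the
number of paths that have a box on their south-east side recovers the entry of this box. This gives
the bijection with fans of Dyck paths (`bijOn_triangulationToFan`).

*South-east fillings.* The boxes of the staircase that lie in no south-east chain of length `k + 1`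
are those on short diagonals (`isPassive_iff`). A filling without south-east chains of length `k + 1`
has at most `k` boxes on each of the other diagonals. In a filling of maximal cardinality there are
exactly `k`, the boxes on neighbouring diagonals interlace, and following the `i`-th box from
diagonal to diagonal yields the paths of a fan (`bijOn_fanToFilling`). Since the additional first and
last steps of the Dyck paths only reach passive boxes or leave the staircase, the map between the
fillings is the composition of the other three bijections (`fanToFilling_triangulationToFan`,
`bijOn_neToSe`).
-/

namespace MaximalFillings

/-! ### Words in the 0-Hecke monoid -/

/-- The 0-Hecke operator with index `b`: it sorts the values at the positions `b` and `b + 1` into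
decreasing order. -/
def heckeOp (b : ℕ) (σ : ℕ → ℕ) (m : ℕ) : ℕ :=
  if m = b then max (σ b) (σ (b + 1)) else if m = b + 1 then min (σ b) (σ (b + 1)) else σ m

/-- The action of a word: its letters act from left to right. -/
def heckeAct (a : List ℕ) (σ : ℕ → ℕ) : ℕ → ℕ :=
  a.foldl (fun τ b => heckeOp b τ) σ

@[simp] theorem heckeAct_nil (σ : ℕ → ℕ) : heckeAct [] σ = σ := rfl

@[simp] theorem heckeAct_cons (b : ℕ) (a : List ℕ) (σ : ℕ → ℕ) :
    heckeAct (b :: a) σ = heckeAct a (heckeOp b σ) := rfl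

theorem heckeAct_append (a a' : List ℕ) (σ : ℕ → ℕ) :
    heckeAct (a ++ a') σ = heckeAct a' (heckeAct a σ) := by
  simp [heckeAct, List.foldl_append]

/-- Two words are equivalent if they act in the same way. -/
def WordEquiv (a a' : List ℕ) : Prop :=
  ∀ σ, heckeAct a σ = heckeAct a' σ

/-- A word is reduced if no equivalent word is shorter. -/
def IsReducedWord (a : List ℕ) : Prop :=
  ∀ a', WordEquiv a a' → a.length ≤ a'.length

namespace WordEquiv

theorem refl (a : List ℕ) : WordEquiv a a := fun _ => rfl

theorem symm {a b : List ℕ} (h : WordEquiv a b) : WordEquiv b a := fun σ => (h σ).symm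

theorem trans {a b c : List ℕ} (h : WordEquiv a b) (h' : WordEquiv b c) : WordEquiv a c :=
  fun σ => (h σ).trans (h' σ)

theorem append {a b c d : List ℕ} (h : WordEquiv a b) (h' : WordEquiv c d) :
    WordEquiv (a ++ c) (b ++ d) := fun σ => by
  rw [heckeAct_append, heckeAct_append, h σ, h' _]

theorem context {a b : List ℕ} (h : WordEquiv a b) (u v : List ℕ) :
    WordEquiv (u ++ a ++ v) (u ++ b ++ v) :=
  ((refl u).append h).append (refl v)

theorem reduced {a b : List ℕ} (h : WordEquiv a b) (hl : a.length = b.length)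
    (ha : IsReducedWord a) : IsReducedWord b := fun c hc => hl ▸ ha c (h.trans hc)

end WordEquiv

theorem wordEquiv_idem (x : ℕ) : WordEquiv [x, x] [x] := fun σ => by
  ext m
  simp only [heckeAct_cons, heckeAct_nil, heckeOp]
  split_ifs <;> omega

theorem wordEquiv_comm {x y : ℕ} (h : x + 2 ≤ y) : WordEquiv [x, y] [y, x] := fun σ => by
  ext m
  simp only [heckeAct_cons, heckeAct_nil, heckeOp]
  split_ifs <;> omega

theorem wordEquiv_braid (x : ℕ) : WordEquiv [x, x + 1, x] [x + 1, x, x + 1] := fun σ => by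
  ext m
  simp only [heckeAct_cons, heckeAct_nil, heckeOp]
  have e1 : x + 1 + 1 ≠ x := by omega
  have e2 : x ≠ x + 1 + 1 := by omega
  by_cases h1 : m = x
  · subst h1; simp [e1, e2]; omega
  by_cases h2 : m = x + 1
  · subst h2; simp [e1, e2]; omega
  by_cases h3 : m = x + 2
  · subst h3; simp [e1, e2]
  simp [h1, h2, h3]

theorem wordEquiv_comm_of_lt (x : ℕ) (B : List ℕ) (h : ∀ z ∈ B, x + 2 ≤ z) :
    WordEquiv (B ++ [x]) (x :: B) := by
  induction B with
  | nil => exact WordEquiv.refl _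
  | cons z B ih =>
    have h1 := (WordEquiv.refl [z]).append (ih fun w hw => h w (List.mem_cons_of_mem _ hw))
    have h2 := (wordEquiv_comm (h z List.mem_cons_self)).symm.append (WordEquiv.refl B)
    exact h1.trans h2

theorem wordEquiv_comm_of_gt (y : ℕ) (A : List ℕ) (h : ∀ z ∈ A, z + 2 ≤ y) :
    WordEquiv (A ++ [y]) (y :: A) := by
  induction A with
  | nil => exact WordEquiv.refl _
  | cons z A ih =>
    have h1 := (WordEquiv.refl [z]).append (ih fun w hw => h w (List.mem_cons_of_mem _ hw))
    have h2 := (wordEquiv_comm (h z List.mem_cons_self)).append (WordEquiv.refl A)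
    exact h1.trans h2

theorem IsReducedWord.of_infix {u a v : List ℕ} (h : IsReducedWord (u ++ a ++ v)) :
    IsReducedWord a := fun b hb => by
  have := h _ (hb.context u v)
  simp only [List.length_append] at this
  omega

theorem IsReducedWord.of_append_left {a v : List ℕ} (h : IsReducedWord (a ++ v)) :
    IsReducedWord a := IsReducedWord.of_infix (u := []) (v := v) (by simpa using h)

theorem IsReducedWord.of_append_right {u a : List ℕ} (h : IsReducedWord (u ++ a)) :
    IsReducedWord a := IsReducedWord.of_infix (u := u) (v := []) (by simpa using h)

/-- A reduced word contains no two equal letters that are separated only by letters that commute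
with them. -/
theorem not_reduced_of_lt {x : ℕ} {A B : List ℕ} (h : ∀ z ∈ B, x + 2 ≤ z) :
    ¬ IsReducedWord (A ++ x :: B ++ [x]) := fun hr => by
  have h1 : WordEquiv (x :: B ++ [x]) (x :: B) := by
    have := (WordEquiv.refl [x]).append (wordEquiv_comm_of_lt x B h)
    exact this.trans ((wordEquiv_idem x).append (WordEquiv.refl B))
  have h2 := hr _ (by simpa using h1.context A [])
  simp at h2

theorem not_reduced_of_gt {y : ℕ} {A B : List ℕ} (h : ∀ z ∈ A, z + 2 ≤ y) :
    ¬ IsReducedWord (y :: (A ++ y :: B)) := fun hr => by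
  have h1 : WordEquiv (y :: (A ++ [y])) (y :: A) := by
    have := (WordEquiv.refl [y]).append (wordEquiv_comm_of_gt y A h)
    exact this.trans ((wordEquiv_idem y).append (WordEquiv.refl A))
  have h2 := hr _ (by simpa using h1.context [] B)
  simp at h2

/-! ### Inversions -/

/-- The number of inversions of `σ` among the positions smaller than `M`. -/
def invCount (M : ℕ) (σ : ℕ → ℕ) : ℕ :=
  ((Finset.range M ×ˢ Finset.range M).filter fun p => p.1 < p.2 ∧ σ p.2 < σ p.1).card

theorem heckeOp_of_le {b : ℕ} {σ : ℕ → ℕ} (h : σ (b + 1) ≤ σ b) : heckeOp b σ = σ := by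
  ext m
  simp only [heckeOp]
  split_ifs with h1 h2
  · subst h1; omega
  · subst h2; omega
  · rfl

theorem heckeOp_of_lt {b : ℕ} {σ : ℕ → ℕ} (h : σ b < σ (b + 1)) :
    heckeOp b σ = σ ∘ Equiv.swap b (b + 1) := by
  ext m
  simp only [heckeOp, Function.comp, Equiv.swap_apply_def]
  split_ifs with h1 h2
  · omega
  · omega
  · rfl

theorem invCount_heckeOp_of_lt {M b : ℕ} {σ : ℕ → ℕ} (hb : b + 1 < M) (h : σ b < σ (b + 1)) :
    invCount M (heckeOp b σ) = invCount M σ + 1 := by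
  classical
  rw [heckeOp_of_lt h]
  set s := Equiv.swap b (b + 1) with hs
  have hsv : ∀ m, s m = if m = b then b + 1 else if m = b + 1 then b else m := fun m => by
    rw [hs, Equiv.swap_apply_def]
  have key : ((Finset.range M ×ˢ Finset.range M).filter fun p => p.1 < p.2 ∧
      (σ ∘ s) p.2 < (σ ∘ s) p.1) = insert (b, b + 1)
      (((Finset.range M ×ˢ Finset.range M).filter fun p => p.1 < p.2 ∧ σ p.2 < σ p.1).image
        fun p => (s p.1, s p.2)) := by
    ext ⟨i, j⟩
    simp only [Finset.mem_filter, Finset.mem_product, Finset.mem_range, Finset.mem_insert,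
      Finset.mem_image, Prod.mk.injEq, Prod.exists, Function.comp]
    have hss : ∀ m, s (s m) = m := fun m => Equiv.swap_apply_self _ _ _
    constructor
    · rintro ⟨⟨h1, h2⟩, h3, h4⟩
      by_cases hij : i = b ∧ j = b + 1
      · exact Or.inl hij
      · refine Or.inr ⟨s i, s j, ⟨⟨?_, ?_⟩, ?_, h4⟩, hss i, hss j⟩
        · rw [hsv]; split_ifs <;> omega
        · rw [hsv]; split_ifs <;> omega
        · rw [hsv, hsv]; split_ifs <;> omega
    · rintro (⟨rfl, rfl⟩ | ⟨i', j', ⟨⟨h1, h2⟩, h3, h4⟩, rfl, rfl⟩)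
      · refine ⟨⟨by omega, by omega⟩, by omega, ?_⟩
        simpa [hsv] using h
      · rw [hss, hss]
        have hij : ¬ (i' = b ∧ j' = b + 1) := by
          rintro ⟨rfl, rfl⟩; omega
        refine ⟨⟨?_, ?_⟩, ?_, h4⟩
        · rw [hsv]; split_ifs <;> omega
        · rw [hsv]; split_ifs <;> omega
        · rw [hsv, hsv]; split_ifs <;> omega
  unfold invCount
  rw [key, Finset.card_insert_of_notMem, Finset.card_image_of_injective]
  · rintro ⟨i, j⟩ ⟨i', j'⟩ h
    simpa using h
  · simp only [Finset.mem_image, Finset.mem_filter, Prod.mk.injEq, Prod.exists, not_exists, not_and]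
    rintro i j ⟨-, h1, -⟩ h2 h3
    rw [hsv] at h2 h3
    split_ifs at h2 h3 <;> omega

/-- Every letter of a word adds an inversion, or else some letter acts trivially and can be
deleted. -/
theorem invCount_heckeAct (M : ℕ) (a : List ℕ) (ha : ∀ b ∈ a, b + 1 < M) (σ : ℕ → ℕ) :
    invCount M (heckeAct a σ) = invCount M σ + a.length ∨
      ∃ u b v, a = u ++ b :: v ∧ heckeAct (u ++ v) σ = heckeAct a σ := by
  induction a generalizing σ with
  | nil => simp
  | cons b a ih =>
    by_cases hb : σ b < σ (b + 1)
    · rcases ih (fun c hc => ha c (List.mem_cons_of_mem _ hc)) (heckeOp b σ) with h | ⟨u, c, v, h, h'⟩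
      · left
        rw [heckeAct_cons, h, invCount_heckeOp_of_lt (ha b List.mem_cons_self) hb, List.length_cons]
        omega
      · exact Or.inr ⟨b :: u, c, v, by simp [h], by simpa using h'⟩
    · exact Or.inr ⟨[], b, a, rfl, by rw [heckeAct_cons, heckeOp_of_le (by omega)]; rfl⟩

theorem invCount_heckeAct_le (M : ℕ) (a : List ℕ) (ha : ∀ b ∈ a, b + 1 < M) (σ : ℕ → ℕ) :
    invCount M (heckeAct a σ) ≤ invCount M σ + a.length := by
  induction a generalizing σ with
  | nil => simp
  | cons b a ih =>
    have h := ih (fun c hc => ha c (List.mem_cons_of_mem _ hc)) (heckeOp b σ)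
    rw [heckeAct_cons, List.length_cons]
    by_cases hb : σ b < σ (b + 1)
    · rw [invCount_heckeOp_of_lt (ha b List.mem_cons_self) hb] at h; omega
    · rw [heckeOp_of_le (by omega)] at h ⊢; omega

/-- The permutation that reverses the positions `k + 1, …, n - k` and fixes all the others. -/
def reversal (n k m : ℕ) : ℕ :=
  if k < m ∧ m + k ≤ n then n + 1 - m else m

theorem card_pairs (s m : ℕ) : (((Finset.Ico s (s + m)) ×ˢ (Finset.Ico s (s + m))).filter
    fun p : ℕ × ℕ => p.1 < p.2).card = m * (m - 1) / 2 := by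
  induction m with
  | zero => simp
  | succ m ih =>
    have : (((Finset.Ico s (s + (m + 1))) ×ˢ (Finset.Ico s (s + (m + 1)))).filter
        fun p : ℕ × ℕ => p.1 < p.2) = (((Finset.Ico s (s + m)) ×ˢ (Finset.Ico s (s + m))).filter
        fun p : ℕ × ℕ => p.1 < p.2) ∪ (Finset.Ico s (s + m)).image fun i => (i, s + m) := by
      ext ⟨i, j⟩
      simp only [Finset.mem_filter, Finset.mem_product, Finset.mem_Ico, Finset.mem_union,
        Finset.mem_image, Prod.mk.injEq]
      constructor
      · rintro ⟨⟨h1, h2⟩, h3⟩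
        by_cases hj : j = s + m
        · exact Or.inr ⟨i, by omega, rfl, hj.symm⟩
        · left; omega
      · rintro (h | ⟨a, h1, rfl, rfl⟩) <;> omega
    rw [this, Finset.card_union_of_disjoint, ih, Finset.card_image_of_injective, Nat.card_Ico]
    · rcases m with _ | m
      · simp
      · simp only [Nat.add_sub_cancel_left, Nat.add_sub_cancel]
        have : (m + 1 + 1) * (m + 1) = (m + 1) * m + (m + 1) * 2 := by ring
        rw [this, Nat.add_mul_div_right _ _ (by norm_num)]
    · intro i j h; simpa using h
    · rw [Finset.disjoint_left]
      rintro ⟨i, j⟩ h h'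
      simp only [Finset.mem_filter, Finset.mem_product, Finset.mem_Ico,
        Finset.mem_image, Prod.mk.injEq] at h h'
      obtain ⟨a, h1, rfl, rfl⟩ := h'
      omega

theorem invCount_reversal {n k M : ℕ} (hkn : 2 * k < n) (hM : n < M) :
    invCount M (reversal n k) = (n - 2 * k) * (n - 2 * k - 1) / 2 := by
  rw [← card_pairs (k + 1) (n - 2 * k)]
  unfold invCount
  congr 1
  ext ⟨i, j⟩
  rw [Finset.mem_filter, Finset.mem_filter]
  simp only [Finset.mem_product, Finset.mem_range, Finset.mem_Ico, reversal]
  split_ifs <;> omega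

theorem invCount_id (M : ℕ) : invCount M id = 0 := by
  simp only [invCount, Finset.card_eq_zero, Finset.filter_eq_empty_iff, id]
  intro p _; omega

/-- Words for the reversal have at least as many letters as the reversal has inversions. -/
theorem length_ge_of_heckeAct {n k : ℕ} (hkn : 2 * k < n) {a : List ℕ}
    (ha : heckeAct a id = reversal n k) : (n - 2 * k) * (n - 2 * k - 1) / 2 ≤ a.length := by
  have h := invCount_heckeAct_le (n + a.sum + 2) a (fun b hb => by
    have := List.single_le_sum (by simp) b hb; omega) id
  rwa [ha, invCount_reversal hkn (by omega), invCount_id, zero_add] at h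

theorem reduced_of_heckeAct {n k : ℕ} (hkn : 2 * k < n) {a : List ℕ}
    (ha : heckeAct a id = reversal n k) (hl : a.length = (n - 2 * k) * (n - 2 * k - 1) / 2) :
    IsReducedWord a := fun b hb => by
  rw [hl]; exact length_ge_of_heckeAct hkn (by rw [← hb, ha])

/-! ### Reading words and north-east chains -/

theorem mem_staircase {n : ℕ} {b : ℕ × ℕ} : b ∈ staircase n ↔ b.1 + b.2 + 1 < n := by
  rw [← YoungDiagram.mem_cells]
  simp only [staircase, Finset.mem_filter, Finset.mem_product, Finset.mem_range]
  omega

theorem rowLen_staircase (n i : ℕ) : (staircase n).rowLen i = n - 1 - i := by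
  apply eq_of_forall_lt_iff
  intro j
  rw [← YoungDiagram.mem_iff_lt_rowLen, mem_staircase]
  omega

theorem colLen_staircase (n j : ℕ) : (staircase n).colLen j = n - 1 - j := by
  apply eq_of_forall_lt_iff
  intro i
  rw [← YoungDiagram.mem_iff_lt_colLen, mem_staircase]
  omega

/-- The letters contributed by the boxes of `D` in the first `c` columns of row `i`. -/
def rowWord (D : Finset (ℕ × ℕ)) (i c : ℕ) : List ℕ :=
  ((List.range c).reverse.filter fun j => decide ((i, j) ∈ D)).map fun j => i + j + 1

/-- The word of a set of boxes of the staircase: the bottom line of its reading biword. -/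
def boxWord (n : ℕ) (D : Finset (ℕ × ℕ)) : List ℕ :=
  (List.range (n - 1)).flatMap fun i => rowWord D i (n - 1 - i)

theorem map_snd_readingBiword (n : ℕ) (D : Finset (ℕ × ℕ)) :
    (readingBiword (staircase n) D).map Prod.snd = boxWord n D := by
  simp only [readingBiword, boxWord, rowWord, colLen_staircase, rowLen_staircase, Nat.sub_zero,
    List.map_flatMap, List.map_map]
  rfl

theorem rowWord_succ (D : Finset (ℕ × ℕ)) (i c : ℕ) :
    rowWord D i (c + 1) = (if (i, c) ∈ D then [i + c + 1] else []) ++ rowWord D i c := by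
  simp only [rowWord, List.range_succ, List.reverse_append, List.reverse_cons, List.reverse_nil,
    List.nil_append, List.singleton_append, List.filter_cons]
  by_cases h : (i, c) ∈ D <;> simp [h]

theorem lt_of_mem_rowWord {D : Finset (ℕ × ℕ)} {i c b : ℕ} (h : b ∈ rowWord D i c) : i < b := by
  simp only [rowWord, List.mem_map] at h
  obtain ⟨j, -, rfl⟩ := h
  omega

/-- The number of positions `1 ≤ m ≤ p` with `σ m ≤ q`. -/
def rankCount (σ : ℕ → ℕ) (p q : ℕ) : ℕ :=
  ((Finset.Icc 1 p).filter fun m => σ m ≤ q).card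

theorem rankCount_zero (σ : ℕ → ℕ) (q : ℕ) : rankCount σ 0 q = 0 := by
  simp [rankCount]

theorem rankCount_succ (σ : ℕ → ℕ) (p q : ℕ) :
    rankCount σ (p + 1) q = rankCount σ p q + if σ (p + 1) ≤ q then 1 else 0 := by
  unfold rankCount
  rw [← Finset.insert_Icc_right_eq_Icc_add_one (by omega), Finset.filter_insert]
  split_ifs with h
  · rw [Finset.card_insert_of_notMem (by simp)]
  · rfl

theorem rankCount_congr {σ τ : ℕ → ℕ} {p q : ℕ} (h : ∀ m, 1 ≤ m → m ≤ p → σ m = τ m) :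
    rankCount σ p q = rankCount τ p q := by
  unfold rankCount
  congr 1
  apply Finset.filter_congr
  intro m hm
  rw [Finset.mem_Icc] at hm
  rw [h m hm.1 hm.2]

theorem heckeOp_of_ne {b m : ℕ} (σ : ℕ → ℕ) (h : m ≠ b) (h' : m ≠ b + 1) : heckeOp b σ m = σ m := by
  simp [heckeOp, h, h']

theorem rankCount_heckeOp_of_ne {b p : ℕ} (σ : ℕ → ℕ) (q : ℕ) (hb : 1 ≤ b) (hp : p ≠ b) :
    rankCount (heckeOp b σ) p q = rankCount σ p q := by
  rcases Nat.lt_or_gt_of_ne hp with h | h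
  · exact rankCount_congr fun m _ h2 => heckeOp_of_ne σ (by omega) (by omega)
  · induction p, h using Nat.le_induction with
    | base =>
      obtain ⟨b, rfl⟩ := Nat.exists_eq_add_of_le' hb
      rw [rankCount_succ, rankCount_succ, rankCount_succ, rankCount_succ σ,
        rankCount_congr (σ := heckeOp (b + 1) σ) (τ := σ)
          fun m _ h2 => heckeOp_of_ne σ (by omega) (by omega)]
      simp only [heckeOp]
      simp
      split_ifs <;> omega
    | succ p h1 ih =>
      rw [rankCount_succ, rankCount_succ, ih (by omega), heckeOp_of_ne σ (by omega) (by omega)]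

/-- The operator with index `b` changes the rank function only at the position `b`, where it acts by
a tropical recursion. -/
theorem rankCount_heckeOp_self {b : ℕ} (σ : ℕ → ℕ) (q : ℕ) (hb : 1 ≤ b) :
    rankCount (heckeOp b σ) b q =
      max (rankCount σ (b - 1) q) (rankCount σ (b + 1) q - 1) := by
  obtain ⟨b, rfl⟩ := Nat.exists_eq_add_of_le' hb
  rw [rankCount_succ, rankCount_succ, rankCount_succ,
    rankCount_congr (σ := heckeOp (b + 1) σ) (τ := σ)
          fun m _ h2 => heckeOp_of_ne σ (by omega) (by omega)]
  simp only [heckeOp, Nat.add_sub_cancel]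
  simp
  split_ifs <;> omega

theorem heckeAct_of_lt {a : List ℕ} {p m : ℕ} (ha : ∀ b ∈ a, p < b) (hm : m ≤ p) (σ : ℕ → ℕ) :
    heckeAct a σ m = σ m := by
  induction a generalizing σ with
  | nil => rfl
  | cons b a ih =>
    have := ha b List.mem_cons_self
    rw [heckeAct_cons, ih (fun c hc => ha c (List.mem_cons_of_mem _ hc)),
      heckeOp_of_ne σ (by omega) (by omega)]

/-- If the rank function at the positions `i + j` is given by `f`, then after the letters of row `i`
the rank function at the positions `i + 1 + j` is given by any solution `g` of the recursion. The
letters act from east to west, so that each of them sees the value of `g` to its east and the value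
of `f` to its west. -/
theorem rankCount_rowWord {D : Finset (ℕ × ℕ)} {i q : ℕ} {f g : ℕ → ℕ}
    (hfg : ∀ c, g c = if (i, c) ∈ D then max (f c) (g (c + 1) - 1) else f (c + 1))
    (c : ℕ) (σ : ℕ → ℕ) (hf : ∀ j ≤ c, rankCount σ (i + j) q = f j)
    (hg : ∀ j, c ≤ j → rankCount σ (i + 1 + j) q = g j) (j : ℕ) :
    rankCount (heckeAct (rowWord D i c) σ) (i + 1 + j) q = g j := by
  induction c generalizing σ with
  | zero => exact hg j (Nat.zero_le j)
  | succ c ih =>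
    rw [rowWord_succ, heckeAct_append]
    have hc := hfg c
    split_ifs at hc ⊢ with h
    · apply ih
      · intro j hj
        rw [heckeAct_cons, heckeAct_nil, rankCount_heckeOp_of_ne σ q (by omega) (by omega),
          hf j (by omega)]
      · intro j hj
        rw [heckeAct_cons, heckeAct_nil]
        by_cases hjc : j = c
        · subst hjc
          rw [hc, show i + 1 + j = i + j + 1 by omega, rankCount_heckeOp_self σ q (by omega),
            Nat.add_sub_cancel, hf j (by omega), show i + j + 1 + 1 = i + 1 + (j + 1) by omega,
            hg _ le_rfl]
        · rw [rankCount_heckeOp_of_ne σ q (by omega) (by omega), hg j (by omega)]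
    · apply ih
      · intro j hj
        exact hf j (by omega)
      · intro j hj
        by_cases hjc : j = c
        · subst hjc
          rw [hc, heckeAct_nil, ← hf _ le_rfl]
          congr 1; omega
        · rw [heckeAct_nil, hg j (by omega)]

/-- The maximal length of a north-east chain outside of `D` in the rows with index less than `i`
and the columns with index in `[j, q)`, by its recursion. -/
def chainLength (D : Finset (ℕ × ℕ)) (q : ℕ) : ℕ → ℕ → ℕ
  | 0, _ => 0
  | i + 1, j =>
    if q ≤ j then 0
    else if (i, j) ∈ D then max (chainLength D q i j) (chainLength D q (i + 1) (j + 1))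
    else 1 + chainLength D q i (j + 1)
termination_by i j => (i, q - j)

theorem chainLength_of_le (D : Finset (ℕ × ℕ)) {q j : ℕ} (i : ℕ) (h : q ≤ j) :
    chainLength D q i j = 0 := by
  cases i <;> rw [chainLength]
  simp [h]

/-- North-east chains, listed from the south-west to the north-east. -/
def IsNEList (l : List (ℕ × ℕ)) : Prop :=
  l.Pairwise fun a b => b.1 < a.1 ∧ a.2 < b.2

theorem length_le_chainLength (D : Finset (ℕ × ℕ)) (q i j : ℕ) (l : List (ℕ × ℕ))
    (hl : IsNEList l) (h : ∀ x ∈ l, x ∉ D ∧ x.1 < i ∧ j ≤ x.2 ∧ x.2 < q) :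
    l.length ≤ chainLength D q i j := by
  unfold IsNEList at hl
  induction i, j using chainLength.induct D q generalizing l with
  | case1 j =>
    rcases l with _ | ⟨x, l⟩
    · simp
    · have := h x List.mem_cons_self; omega
  | case2 i j hq =>
    rcases l with _ | ⟨x, l⟩
    · simp
    · have := h x List.mem_cons_self; omega
  | case3 i j hq hD ih1 ih2 =>
    rw [chainLength]
    simp only [hq, hD, if_true, if_false]
    rcases l with _ | ⟨x, l⟩
    · simp
    have hx := h x List.mem_cons_self
    have hl' := List.pairwise_cons.1 hl
    by_cases hxi : x.1 = i
    · have hxj : x.2 ≠ j := by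
        intro hxj
        exact hx.1 (by rw [show x = (i, j) from Prod.ext hxi hxj]; exact hD)
      refine le_trans (ih2 _ hl ?_) (le_max_right _ _)
      intro y hy
      have hy' := h y hy
      rcases List.mem_cons.1 hy with rfl | hyl
      · exact ⟨hx.1, hx.2.1, by omega, hx.2.2.2⟩
      · have := hl'.1 y hyl
        exact ⟨hy'.1, by omega, by omega, by omega⟩
    · refine le_trans (ih1 _ hl ?_) (le_max_left _ _)
      intro y hy
      have hy' := h y hy
      rcases List.mem_cons.1 hy with rfl | hyl
      · exact ⟨hx.1, by omega, by omega, by omega⟩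
      · have := hl'.1 y hyl
        exact ⟨hy'.1, by omega, by omega, by omega⟩
  | case4 i j hq hD ih =>
    rw [chainLength]
    simp only [hq, hD, if_false]
    rcases l with _ | ⟨x, l⟩
    · simp
    have hx := h x List.mem_cons_self
    have hl' := List.pairwise_cons.1 hl
    rw [List.length_cons, add_comm]
    refine Nat.add_le_add_left (ih l hl'.2 fun y hy => ?_) 1
    have hy' := h y (List.mem_cons_of_mem _ hy)
    have := hl'.1 y hy
    exact ⟨hy'.1, by omega, by omega, by omega⟩

theorem exists_chain (D : Finset (ℕ × ℕ)) (q i j : ℕ) :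
    ∃ l : List (ℕ × ℕ), IsNEList l ∧ (∀ x ∈ l, x ∉ D ∧ x.1 < i ∧ j ≤ x.2 ∧ x.2 < q) ∧
      l.length = chainLength D q i j := by
  unfold IsNEList
  induction i, j using chainLength.induct D q with
  | case1 j => exact ⟨[], by simp, by simp, by rw [chainLength]; rfl⟩
  | case2 i j hq => exact ⟨[], by simp, by simp, by rw [chainLength_of_le D _ hq]; rfl⟩
  | case3 i j hq hD ih1 ih2 =>
    rw [chainLength]
    simp only [hq, hD, if_true, if_false]
    rcases max_cases (chainLength D q i j) (chainLength D q (i + 1) (j + 1)) with h | h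
    · obtain ⟨l, h1, h2, h3⟩ := ih1
      refine ⟨l, h1, fun x hx => ?_, by rw [h3, h.1]⟩
      have := h2 x hx
      exact ⟨this.1, by omega, by omega, by omega⟩
    · obtain ⟨l, h1, h2, h3⟩ := ih2
      refine ⟨l, h1, fun x hx => ?_, by rw [h3, h.1]⟩
      have := h2 x hx
      exact ⟨this.1, by omega, by omega, by omega⟩
  | case4 i j hq hD ih =>
    rw [chainLength]
    simp only [hq, hD, if_false]
    obtain ⟨l, h1, h2, h3⟩ := ih
    refine ⟨(i, j) :: l, List.pairwise_cons.2 ⟨fun y hy => ?_, h1⟩, fun x hx => ?_, ?_⟩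
    · have := h2 y hy
      exact ⟨by simpa using this.2.1, by simpa using this.2.2.1⟩
    · rcases List.mem_cons.1 hx with rfl | hxl
      · exact ⟨hD, by simp, by simp, by simpa using hq⟩
      · have := h2 x hxl
        exact ⟨this.1, by omega, by omega, by omega⟩
    · rw [List.length_cons, h3, add_comm]

theorem rankCount_id (p q : ℕ) : rankCount id p q = min p q := by
  induction p with
  | zero => simp [rankCount_zero]
  | succ p ih => rw [rankCount_succ, ih]; simp only [id]; split_ifs <;> omega

/-- The rank function after the rows with index less than `p` satisfies the same recursion as the
lengths of the longest north-east chains outside of `D`. -/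
theorem rankCount_rows {n q : ℕ} (D : Finset (ℕ × ℕ)) (p : ℕ) (h : p + q ≤ n) (j : ℕ) :
    rankCount (heckeAct ((List.range p).flatMap fun i => rowWord D i (n - 1 - i)) id) (p + j) q =
      min j q + chainLength D q p j := by
  induction p generalizing j with
  | zero => simp [rankCount_id, chainLength]
  | succ p ih =>
    rw [List.range_succ, List.flatMap_append, heckeAct_append]
    simp only [List.flatMap_cons, List.flatMap_nil, List.append_nil]
    refine rankCount_rowWord (f := fun j => min j q + chainLength D q p j)
      (g := fun j => min j q + chainLength D q (p + 1) j) ?_ _ _ ?_ ?_ j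
    · intro c
      by_cases hc : q ≤ c
      · simp only [chainLength_of_le D _ hc, chainLength_of_le D _ (show q ≤ c + 1 by omega)]
        split_ifs <;> omega
      · conv_lhs => rw [chainLength]
        simp only [hc, if_false]
        split_ifs <;> omega
    · intro j _
      exact ih (by omega) j
    · intro j hj
      rw [show p + 1 + j = p + (j + 1) by omega, ih (by omega),
        chainLength_of_le D _ (show q ≤ j by omega),
        chainLength_of_le D _ (show q ≤ j + 1 by omega)]
      omega

/-- The rank function of the Demazure product of the word of `D` counts the longest north-east
chain outside of `D`. -/
theorem rankCount_boxWord {n p q : ℕ} (D : Finset (ℕ × ℕ)) (h : p + q ≤ n) :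
    rankCount (heckeAct (boxWord n D) id) p q = chainLength D q p 0 := by
  by_cases hp : p ≤ n - 1
  · unfold boxWord
    conv_lhs => rw [show n - 1 = p + (n - 1 - p) by omega]
    rw [List.range_add, List.flatMap_append, heckeAct_append]
    have := rankCount_rows D p h 0
    rw [Nat.zero_min, zero_add, add_zero] at this
    rw [← this, show p + (n - 1 - p) = n - 1 by omega]
    refine rankCount_congr fun m _ hm => heckeAct_of_lt (p := p) ?_ hm _
    intro b hb
    simp only [List.mem_flatMap, List.mem_map] at hb
    obtain ⟨i, ⟨r, -, rfl⟩, hb⟩ := hb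
    have := lt_of_mem_rowWord hb
    omega
  · have hq : q = 0 ∨ n = 0 := by omega
    rcases hq with rfl | rfl
    · rw [chainLength_of_le D _ le_rfl]
      have h1 : p = n := by omega
      subst h1
      obtain ⟨p, rfl⟩ : ∃ p', p = p' + 1 := ⟨p - 1, by omega⟩
      have h2 := rankCount_rows (n := p + 1) D p (by omega : p + 0 ≤ _) 1
      rw [chainLength_of_le D _ (by omega)] at h2
      simpa [boxWord] using h2
    · simp at hp
      omega

theorem avoidsNE_iff_chainLength {n k : ℕ} {S : Finset (ℕ × ℕ)} (hS : S ⊆ (staircase n).cells) :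
    AvoidsNE (staircase n) k S ↔
      ∀ p q, p + q ≤ n → chainLength (pipeDream (staircase n) S) q p 0 ≤ k := by
  constructor
  · rintro ⟨-, h⟩ p q hpq
    by_contra hlt
    push Not at hlt
    obtain ⟨l, h1, h2, h3⟩ := exists_chain (pipeDream (staircase n) S) q p 0
    apply h
    have hlen : ∀ s : Fin (k + 1), (s : ℕ) < l.length := fun s => by omega
    refine ⟨fun s => l[(s : ℕ)]'(hlen s), ⟨?_, ?_⟩, ?_⟩
    · intro s t hst
      exact List.pairwise_iff_getElem.1 h1 s t (hlen s) (hlen t) hst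
    · rintro b ⟨s, t, h4, h5⟩ ⟨s', t', h6, h7⟩
      have := h2 _ (List.getElem_mem (hlen t))
      have := h2 _ (List.getElem_mem (hlen t'))
      rw [mem_staircase]
      dsimp only at h5 h7
      omega
    · intro s
      have := h2 _ (List.getElem_mem (hlen s))
      by_contra hs
      apply this.1
      simp only [pipeDream, Finset.mem_sdiff, YoungDiagram.mem_cells, mem_staircase]
      exact ⟨by omega, hs⟩
  · intro h
    refine ⟨hS, ?_⟩
    rintro ⟨c, ⟨hc, hrect⟩, hcS⟩
    have hlast : ((c 0).1, (c (Fin.last k)).2) ∈ staircase n :=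
      hrect _ ⟨0, 0, le_rfl, le_rfl⟩ ⟨Fin.last k, Fin.last k, le_rfl, le_rfl⟩
    rw [mem_staircase] at hlast
    have h1 := h ((c 0).1 + 1) ((c (Fin.last k)).2 + 1) (by simp only at hlast; omega)
    have h2 := length_le_chainLength (pipeDream (staircase n) S) ((c (Fin.last k)).2 + 1)
      ((c 0).1 + 1) 0 (List.ofFn c) ?_ ?_
    · rw [List.length_ofFn] at h2
      omega
    · unfold IsNEList
      rw [List.pairwise_ofFn]
      exact fun s t hst => hc s t hst
    · intro x hx
      rw [List.mem_ofFn] at hx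
      obtain ⟨s, rfl⟩ := hx
      refine ⟨?_, ?_, Nat.zero_le _, ?_⟩
      · simp only [pipeDream, Finset.mem_sdiff, not_and, not_not]
        exact fun _ => hcS s
      · rcases eq_or_ne s 0 with rfl | hs
        · omega
        · have := hc 0 s (Fin.pos_iff_ne_zero.2 hs); omega
      · rcases eq_or_ne s (Fin.last k) with rfl | hs
        · omega
        · have := hc s (Fin.last k) (Fin.lt_last_iff_ne_last.2 hs); omega

/-- A filling has no north-east chain of length `k + 1` if and only if the Demazure product of the
word of its complement has rank at most `k` at all the positions `(p, q)` with `p + q ≤ n`. -/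
theorem avoidsNE_iff {n k : ℕ} {S : Finset (ℕ × ℕ)} (hS : S ⊆ (staircase n).cells) :
    AvoidsNE (staircase n) k S ↔ ∀ p q, p + q ≤ n →
      rankCount (heckeAct (boxWord n (pipeDream (staircase n) S)) id) p q ≤ k := by
  rw [avoidsNE_iff_chainLength hS]
  refine forall_congr' fun p => forall_congr' fun q => forall_congr' fun h => ?_
  rw [rankCount_boxWord _ h]

/-! ### Maximal north-east fillings and reduced words of the reversal -/

theorem add_sub_le_of_strictMono {k : ℕ} {f : Fin (k + 1) → ℕ} (hf : ∀ s t, s < t → f s < f t)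
    (s t : Fin (k + 1)) (hst : s ≤ t) : f s + ((t : ℕ) - s) ≤ f t := by
  induction t using Fin.induction with
  | zero =>
    have : s = 0 := Fin.le_zero_iff.1 hst
    subst this; simp
  | succ t ih =>
    rcases hst.eq_or_lt with rfl | h
    · simp
    · have h1 : s ≤ t.castSucc := Fin.le_castSucc_iff.2 h
      have h2 := ih h1
      have h3 := hf t.castSucc t.succ Fin.castSucc_lt_succ
      have h4 : (s : ℕ) ≤ t := h1
      simp only [Fin.val_castSucc, Fin.val_succ] at *
      omega

/-- The boxes of the staircase near the corner and near the border lie in no north-east chain of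
length `k + 1`. -/
theorem AvoidsNE.insert {n k : ℕ} {S : Finset (ℕ × ℕ)} (hS : AvoidsNE (staircase n) k S)
    {x : ℕ × ℕ} (hx : x ∈ staircase n) (h : x.1 + x.2 + 1 ≤ k ∨ n ≤ x.1 + x.2 + 1 + k) :
    AvoidsNE (staircase n) k (insert x S) := by
  refine ⟨Finset.insert_subset hx hS.1, ?_⟩
  rintro ⟨c, hc, hcS⟩
  by_cases hex : ∃ s, c s = x
  · obtain ⟨s, rfl⟩ := hex
    have h1 := add_sub_le_of_strictMono (f := fun s => (c s).2) (fun s t hst => (hc.1 s t hst).2)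
    have h2 := add_sub_le_of_strictMono (f := fun s => (c s.rev).1)
      (fun s t hst => (hc.1 _ _ (Fin.rev_lt_rev.2 hst)).1)
    have h3 := h1 0 s (Fin.zero_le _)
    have h4 := h1 s (Fin.last k) (Fin.le_last _)
    have h5 := h2 0 s.rev (Fin.zero_le _)
    have h6 := h2 s.rev (Fin.last k) (Fin.le_last _)
    have hlast : ((c 0).1, (c (Fin.last k)).2) ∈ staircase n :=
      hc.2 _ ⟨0, 0, le_rfl, le_rfl⟩ ⟨Fin.last k, Fin.last k, le_rfl, le_rfl⟩
    rw [mem_staircase] at hlast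
    have h7 := s.is_lt
    simp only [Fin.rev_rev, Fin.val_rev, Fin.rev_last, Fin.val_zero, Fin.val_last] at *
    omega
  · push Not at hex
    exact hS.2 ⟨c, hc, fun s => Finset.mem_of_mem_insert_of_ne (hcS s) (hex s)⟩

/-- The boxes of the staircase in reading order: row by row from north to south, and from east to
west within each row. -/
def readingOrder (n : ℕ) : List (ℕ × ℕ) :=
  (List.range (n - 1)).flatMap fun i => (List.range (n - 1 - i)).reverse.map fun j => (i, j)

/-- The strict order in which boxes are read. -/
def ReadBefore (x y : ℕ × ℕ) : Prop :=
  x.1 < y.1 ∨ x.1 = y.1 ∧ y.2 < x.2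

theorem mem_readingOrder {n : ℕ} {x : ℕ × ℕ} : x ∈ readingOrder n ↔ x ∈ staircase n := by
  obtain ⟨i, j⟩ := x
  simp only [readingOrder, List.mem_flatMap, List.mem_range, List.mem_map, List.mem_reverse,
    Prod.mk.injEq, mem_staircase]
  constructor
  · rintro ⟨a, h1, b, h2, rfl, rfl⟩
    omega
  · intro h
    exact ⟨i, by omega, j, by omega, rfl, rfl⟩

theorem pairwise_readingOrder (n : ℕ) : (readingOrder n).Pairwise ReadBefore := by
  rw [readingOrder, List.pairwise_flatMap]
  constructor
  · intro i _
    rw [List.pairwise_map, List.pairwise_reverse]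
    exact List.pairwise_lt_range.imp fun h => Or.inr ⟨rfl, h⟩
  · refine List.pairwise_lt_range.imp fun {i i'} h x hx y hy => ?_
    simp only [List.mem_map] at hx hy
    obtain ⟨_, _, rfl⟩ := hx
    obtain ⟨_, _, rfl⟩ := hy
    exact Or.inl h

theorem ReadBefore.ne {x y : ℕ × ℕ} (h : ReadBefore x y) : x ≠ y := by
  rintro rfl
  rcases h with h | h <;> omega

/-- The boxes of `D` in reading order. -/
def boxList (n : ℕ) (D : Finset (ℕ × ℕ)) : List (ℕ × ℕ) :=
  (readingOrder n).filter fun x => decide (x ∈ D)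

theorem pairwise_boxList (n : ℕ) (D : Finset (ℕ × ℕ)) : (boxList n D).Pairwise ReadBefore :=
  (pairwise_readingOrder n).filter _

theorem nodup_boxList (n : ℕ) (D : Finset (ℕ × ℕ)) : (boxList n D).Nodup :=
  (pairwise_boxList n D).imp ReadBefore.ne

theorem mem_boxList {n : ℕ} {D : Finset (ℕ × ℕ)} (hD : D ⊆ (staircase n).cells) {x : ℕ × ℕ} :
    x ∈ boxList n D ↔ x ∈ D := by
  simp only [boxList, List.mem_filter, mem_readingOrder, decide_eq_true_eq]
  exact ⟨fun h => h.2, fun h => ⟨hD h, h⟩⟩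

theorem readingBiword_eq (n : ℕ) (D : Finset (ℕ × ℕ)) :
    readingBiword (staircase n) D = (boxList n D).map fun x => (x.1 + 1, x.1 + x.2 + 1) := by
  simp only [readingBiword, boxList, readingOrder, colLen_staircase, rowLen_staircase, Nat.sub_zero,
    List.filter_flatMap, List.map_flatMap, List.filter_map, List.map_map]
  rfl

theorem boxWord_eq (n : ℕ) (D : Finset (ℕ × ℕ)) :
    boxWord n D = (boxList n D).map fun x => x.1 + x.2 + 1 := by
  rw [← map_snd_readingBiword, readingBiword_eq, List.map_map]
  rfl

theorem length_boxList {n : ℕ} {D : Finset (ℕ × ℕ)} (hD : D ⊆ (staircase n).cells) :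
    (boxList n D).length = D.card := by
  classical
  rw [← List.toFinset_card_of_nodup (nodup_boxList n D)]
  congr 1
  ext x
  rw [List.mem_toFinset, mem_boxList hD]

theorem length_boxWord {n : ℕ} {D : Finset (ℕ × ℕ)} (hD : D ⊆ (staircase n).cells) :
    (boxWord n D).length = D.card := by
  rw [boxWord_eq, List.length_map, length_boxList hD]

theorem boxList_erase {n : ℕ} {D : Finset (ℕ × ℕ)} {u v : List (ℕ × ℕ)} {x : ℕ × ℕ}
    (h : boxList n D = u ++ x :: v) : boxList n (D.erase x) = u ++ v := by
  have h1 : boxList n (D.erase x) = (boxList n D).filter fun y => decide (y ≠ x) := by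
    simp only [boxList, List.filter_filter, Finset.mem_erase]
    congr 1
    ext y
    simp
  have h2 := nodup_boxList n D
  rw [h] at h2
  rw [h1, h]
  have h3 : x ∉ u ∧ x ∉ v := by
    rw [List.nodup_append] at h2
    obtain ⟨_, h4, h5⟩ := h2
    exact ⟨fun hu => h5 x hu x List.mem_cons_self rfl, (List.nodup_cons.1 h4).1⟩
  rw [List.filter_append, List.filter_cons]
  simp only [ne_eq, not_true_eq_false, decide_false, Bool.false_eq_true, if_false]
  rw [List.filter_eq_self.2, List.filter_eq_self.2]
  · intro y hy
    simpa using fun hyx : y = x => h3.2 (hyx ▸ hy)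
  · intro y hy
    simpa using fun hyx : y = x => h3.1 (hyx ▸ hy)

theorem heckeAct_injective (a : List ℕ) {σ : ℕ → ℕ} (h : Function.Injective σ) :
    Function.Injective (heckeAct a σ) := by
  induction a generalizing σ with
  | nil => exact h
  | cons b a ih =>
    rw [heckeAct_cons]
    apply ih
    by_cases hb : σ b < σ (b + 1)
    · rw [heckeOp_of_lt hb]
      exact h.comp (Equiv.injective _)
    · rw [heckeOp_of_le (by omega)]
      exact h

theorem heckeAct_of_forall_ne (a : List ℕ) (σ : ℕ → ℕ) {m : ℕ} (h : ∀ b ∈ a, m ≠ b ∧ m ≠ b + 1) :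
    heckeAct a σ m = σ m := by
  induction a generalizing σ with
  | nil => rfl
  | cons b a ih =>
    rw [heckeAct_cons, ih _ fun c hc => h c (List.mem_cons_of_mem _ hc),
      heckeOp_of_ne σ (h b List.mem_cons_self).1 (h b List.mem_cons_self).2]

theorem heckeAct_mem_range {n k : ℕ} (a : List ℕ) (ha : ∀ b ∈ a, k < b ∧ b + k < n) (σ : ℕ → ℕ)
    (hσ : ∀ m, k < m → m + k ≤ n → k < σ m ∧ σ m + k ≤ n) :
    ∀ m, k < m → m + k ≤ n → k < heckeAct a σ m ∧ heckeAct a σ m + k ≤ n := by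
  induction a generalizing σ with
  | nil => exact hσ
  | cons b a ih =>
    apply ih fun c hc => ha c (List.mem_cons_of_mem _ hc)
    intro m h1 h2
    have hb := ha b List.mem_cons_self
    have h3 := hσ b hb.1 (by omega)
    have h4 := hσ (b + 1) (by omega) (by omega)
    have h5 := hσ m h1 h2
    simp only [heckeOp]
    split_ifs <;> omega

/-- The rank conditions determine the longest element: a permutation that only moves the positions
`k + 1, …, n - k` and satisfies them is the reversal of these positions. -/
theorem heckeAct_eq_reversal {n k : ℕ} (a : List ℕ)
    (ha : ∀ b ∈ a, k < b ∧ b + k < n)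
    (hr : ∀ p q, p + q ≤ n → rankCount (heckeAct a id) p q ≤ k) :
    heckeAct a id = reversal n k := by
  have hinj := heckeAct_injective a Function.injective_id
  have hrange := heckeAct_mem_range (n := n) (k := k) a ha id fun m h1 h2 => ⟨h1, h2⟩
  have hfix : ∀ m, ¬ (k < m ∧ m + k ≤ n) → heckeAct a id m = m := fun m hm =>
    heckeAct_of_forall_ne a id fun b hb => by have := ha b hb; omega
  ext m
  induction m using Nat.strong_induction_on with
  | _ m ih =>
  by_cases hm : k < m ∧ m + k ≤ n
  · have h1 := hrange m hm.1 hm.2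
    have hge : n < heckeAct a id m + m := by
      by_contra hlt
      have h2 := hr m (n - m) (by omega)
      have h3 : insert m (Finset.Icc 1 k) ⊆
          (Finset.Icc 1 m).filter fun i => heckeAct a id i ≤ n - m := by
        intro i hi
        rw [Finset.mem_insert, Finset.mem_Icc] at hi
        rw [Finset.mem_filter, Finset.mem_Icc]
        rcases hi with rfl | hi
        · omega
        · rw [hfix i (by omega)]; omega
      have h4 := Finset.card_le_card h3
      rw [Finset.card_insert_of_notMem (by rw [Finset.mem_Icc]; omega), Nat.card_Icc] at h4
      unfold rankCount at h2
      omega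
    have hle : heckeAct a id m + m ≤ n + 1 := by
      by_contra hlt
      -- the larger values are already taken by earlier positions
      have h2 := ih (n + 1 - heckeAct a id m) (by omega)
      rw [reversal, if_pos (by omega)] at h2
      have h3 := hinj (show heckeAct a id (n + 1 - heckeAct a id m) = heckeAct a id m by omega)
      omega
    rw [reversal, if_pos hm]
    omega
  · rw [hfix m hm, reversal, if_neg hm]

theorem rankCount_reversal {n k : ℕ} (hkn : 2 * k < n) {p q : ℕ} (h : p + q ≤ n) :
    rankCount (reversal n k) p q ≤ k := by
  have : (Finset.Icc 1 p).filter (fun m => reversal n k m ≤ q) ⊆ Finset.Icc 1 k := by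
    intro m hm
    rw [Finset.mem_filter, Finset.mem_Icc, reversal] at hm
    rw [Finset.mem_Icc]
    split_ifs at hm <;> omega
  simpa [rankCount] using Finset.card_le_card this

theorem pipeDream_subset (lam : YoungDiagram) (S : Finset (ℕ × ℕ)) :
    pipeDream lam S ⊆ lam.cells := Finset.sdiff_subset

theorem letters_of_maximal {n k : ℕ} {S : Finset (ℕ × ℕ)}
    (hS : Maximal (AvoidsNE (staircase n) k) S) :
    ∀ b ∈ boxWord n (pipeDream (staircase n) S), k < b ∧ b + k < n := by
  intro b hb
  rw [boxWord_eq, List.mem_map] at hb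
  obtain ⟨x, hx, rfl⟩ := hb
  rw [mem_boxList (pipeDream_subset _ _), pipeDream, Finset.mem_sdiff] at hx
  by_contra hcon
  exact hx.2 (hS.2 (hS.1.insert hx.1 (by omega)) (Finset.subset_insert _ _)
    (Finset.mem_insert_self _ _))

/-- The complement of a maximal filling without north-east chains of length `k + 1` is a reduced
pipe dream of the reversal. -/
theorem reversal_of_maximal {n k : ℕ} (hkn : 2 * k < n) {S : Finset (ℕ × ℕ)}
    (hS : Maximal (AvoidsNE (staircase n) k) S) :
    heckeAct (boxWord n (pipeDream (staircase n) S)) id = reversal n k ∧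
      (pipeDream (staircase n) S).card = (n - 2 * k) * (n - 2 * k - 1) / 2 := by
  have hletters := letters_of_maximal hS
  have hrev := heckeAct_eq_reversal _ hletters ((avoidsNE_iff hS.1.1).1 hS.1)
  refine ⟨hrev, ?_⟩
  rcases invCount_heckeAct (n + 1) (boxWord n (pipeDream (staircase n) S))
    (fun b hb => by have := hletters b hb; omega) id with h | ⟨u, b, v, h1, h2⟩
  · rw [hrev, invCount_id, invCount_reversal hkn (by omega),
      length_boxWord (pipeDream_subset _ _)] at h
    omega
  · -- a letter that acts trivially could be added to the filling
    exfalso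
    rw [boxWord_eq, List.map_eq_append_iff] at h1
    obtain ⟨u', v', h3, h4, h5⟩ := h1
    rw [List.map_eq_cons_iff] at h5
    obtain ⟨x, v'', rfl, h6, h7⟩ := h5
    have hx : x ∈ pipeDream (staircase n) S := by
      rw [← mem_boxList (pipeDream_subset _ _), h3]
      simp
    rw [pipeDream, Finset.mem_sdiff] at hx
    have h8 : pipeDream (staircase n) (insert x S) = (pipeDream (staircase n) S).erase x := by
      ext y
      simp only [pipeDream, Finset.mem_sdiff, Finset.mem_insert, Finset.mem_erase]
      tauto
    have h9 : AvoidsNE (staircase n) k (insert x S) := by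
      rw [avoidsNE_iff (Finset.insert_subset hx.1 hS.1.1), h8, boxWord_eq, boxList_erase h3,
        List.map_append, h4, h7, h2]
      exact (avoidsNE_iff hS.1.1).1 hS.1
    exact hx.2 (hS.2 h9 (Finset.subset_insert _ _) (Finset.mem_insert_self _ _))

theorem card_add_card_pipeDream {lam : YoungDiagram} {S : Finset (ℕ × ℕ)} (h : S ⊆ lam.cells) :
    S.card + (pipeDream lam S).card = lam.cells.card := by
  rw [pipeDream, add_comm, Finset.card_sdiff_add_card_eq_card h]

theorem exists_maximal_avoidsNE {n k : ℕ} {S : Finset (ℕ × ℕ)} (hS : AvoidsNE (staircase n) k S) :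
    ∃ S', S ⊆ S' ∧ Maximal (AvoidsNE (staircase n) k) S' := by
  have hfin : {S' | AvoidsNE (staircase n) k S'}.Finite :=
    (Finset.finite_toSet (staircase n).cells.powerset).subset fun S' h => by
      simpa using h.1
  obtain ⟨S', h1, h2⟩ := hfin.exists_le_maximal hS
  exact ⟨S', h1, h2⟩

theorem mem_neFillings_of_reversal {n k : ℕ} (hkn : 2 * k < n) {S : Finset (ℕ × ℕ)}
    (hS : S ⊆ (staircase n).cells)
    (h : heckeAct (boxWord n (pipeDream (staircase n) S)) id = reversal n k)
    (hc : (pipeDream (staircase n) S).card = (n - 2 * k) * (n - 2 * k - 1) / 2) :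
    S ∈ neFillings (staircase n) k := by
  refine ⟨(avoidsNE_iff hS).2 fun p q hpq => h ▸ rankCount_reversal hkn hpq, fun S' hS' => ?_⟩
  obtain ⟨S'', h1, h2⟩ := exists_maximal_avoidsNE hS'
  have h3 := (reversal_of_maximal hkn h2).2
  have h4 := card_add_card_pipeDream h2.1.1
  have h5 := card_add_card_pipeDream hS
  have h6 := Finset.card_le_card h1
  omega

theorem maximal_of_mem_neFillings {lam : YoungDiagram} {k : ℕ} {S : Finset (ℕ × ℕ)}
    (hS : S ∈ neFillings lam k) : Maximal (AvoidsNE lam k) S :=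
  ⟨hS.1, fun S' h1 h2 => (Finset.eq_of_subset_of_card_le h2 (hS.2 S' h1)).ge⟩

/-- Fillings of the staircase that are maximal under inclusion have maximal cardinality. -/
theorem mem_neFillings_iff_maximal {n k : ℕ} (hkn : 2 * k < n) {S : Finset (ℕ × ℕ)} :
    S ∈ neFillings (staircase n) k ↔ Maximal (AvoidsNE (staircase n) k) S :=
  ⟨maximal_of_mem_neFillings, fun h => mem_neFillings_of_reversal hkn h.1.1
    (reversal_of_maximal hkn h).1 (reversal_of_maximal hkn h).2⟩

theorem neFillings_nonempty {n k : ℕ} (hkn : 2 * k < n) : (neFillings (staircase n) k).Nonempty := by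
  have h : AvoidsNE (staircase n) k ∅ :=
    ⟨Finset.empty_subset _, fun ⟨c, _, h⟩ => Finset.notMem_empty _ (h 0)⟩
  obtain ⟨S, -, hS⟩ := exists_maximal_avoidsNE h
  exact ⟨S, (mem_neFillings_iff_maximal hkn).2 hS⟩

/-! ### `k`-triangulations as north-east fillings -/

theorem diagonalsToFilling_injective (n : ℕ) : Function.Injective (diagonalsToFilling n) := by
  apply Finset.image_injective
  rintro ⟨a, b⟩ ⟨a', b'⟩ h
  rw [Prod.mk.injEq] at h
  have h1 := Fin.rev_injective (Fin.ext h.1)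
  have h2 := Fin.ext h.2
  simp_all

theorem mem_diagonalsToFilling {n : ℕ} {T : Finset (Fin n × Fin n)} {a b : Fin n} :
    ((b.rev : ℕ), (a : ℕ)) ∈ diagonalsToFilling n T ↔ (a, b) ∈ T := by
  unfold diagonalsToFilling
  rw [Finset.mem_image]
  constructor
  · rintro ⟨⟨a', b'⟩, h, h'⟩
    rw [Prod.mk.injEq] at h'
    have h1 := Fin.rev_injective (Fin.ext h'.1)
    have h2 := Fin.ext h'.2
    simp_all
  · intro h
    exact ⟨(a, b), h, rfl⟩

theorem diagonalsToFilling_subset {n : ℕ} {T : Finset (Fin n × Fin n)} :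
    diagonalsToFilling n T ⊆ (staircase n).cells ↔ ∀ d ∈ T, d.1 < d.2 := by
  unfold diagonalsToFilling
  rw [Finset.image_subset_iff]
  refine forall_congr' fun d => forall_congr' fun _ => ?_
  rw [YoungDiagram.mem_cells, mem_staircase, Fin.val_rev, Fin.lt_def]
  have := d.2.is_lt
  dsimp only
  omega

/-- Mutually crossing diagonals, sorted by their first endpoints, form a north-east chain whose
rectangle lies in the staircase, and conversely. -/
theorem isCrossingFree_iff {n k : ℕ} {T : Finset (Fin n × Fin n)} :
    IsCrossingFree n k T ↔ AvoidsNE (staircase n) k (diagonalsToFilling n T) := by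
  unfold IsCrossingFree AvoidsNE
  rw [diagonalsToFilling_subset]
  refine and_congr_right fun hT => not_congr ?_
  constructor
  · rintro ⟨C, hC, hcard, hcross⟩
    have hinj : Set.InjOn Prod.fst (C : Set (Fin n × Fin n)) := by
      intro d hd e he hde
      by_contra hne
      have := hcross d hd e he hne
      unfold Crosses at this
      omega
    have hcard' : (C.image Prod.fst).card = k + 1 := by
      rw [Finset.card_image_of_injOn hinj, hcard]
    have hex : ∀ s : Fin (k + 1), ∃ d ∈ C, d.1 = (C.image Prod.fst).orderEmbOfFin hcard' s :=
      fun s => by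
        have := Finset.orderEmbOfFin_mem _ hcard' s
        rw [Finset.mem_image] at this
        exact this
    choose f hf hf' using hex
    have hlt : ∀ s t, s < t → (f s).1 < (f t).1 ∧ (f t).1 < (f s).2 ∧ (f s).2 < (f t).2 := by
      intro s t hst
      have h1 : (f s).1 < (f t).1 := by
        rw [hf', hf']
        exact (Finset.orderEmbOfFin _ hcard').lt_iff_lt.2 hst
      have h2 := hcross (f s) (hf s) (f t) (hf t) (fun h => by rw [h] at h1; exact lt_irrefl _ h1)
      unfold Crosses at h2
      omega
    refine ⟨fun s => (((f s).2.rev : ℕ), ((f s).1 : ℕ)), ⟨?_, ?_⟩, ?_⟩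
    · intro s t hst
      have := hlt s t hst
      simp only [Fin.val_rev, Fin.lt_def] at *
      omega
    · rintro b ⟨-, t, -, h1⟩ ⟨-, t', -, h2⟩
      rw [mem_staircase]
      have h3 : (f t').1 < (f t).2 := by
        rcases lt_trichotomy t t' with h | rfl | h
        · exact (hlt t t' h).2.1
        · exact hT _ (hC (hf t))
        · exact ((hlt t' t h).1.trans (hlt t' t h).2.1).trans (hlt t' t h).2.2
      simp only [Fin.val_rev, Fin.lt_def] at *
      omega
    · intro s
      exact mem_diagonalsToFilling.2 (hC (hf s))
  · rintro ⟨c, ⟨hc, hrect⟩, hcT⟩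
    have hex : ∀ s, ∃ d ∈ T, ((d.2.rev : ℕ), (d.1 : ℕ)) = c s := fun s => by
      have := hcT s
      unfold diagonalsToFilling at this
      rwa [Finset.mem_image] at this
    choose f hf hf' using hex
    have hlt : ∀ s t, s < t → (f s).1 < (f t).1 ∧ (f t).1 < (f s).2 ∧ (f s).2 < (f t).2 := by
      intro s t hst
      have h1 := hc s t hst
      have h2 : ((c s).1, (c t).2) ∈ staircase n :=
        hrect _ ⟨s, s, le_rfl, le_rfl⟩ ⟨t, t, le_rfl, le_rfl⟩
      rw [mem_staircase] at h2
      rw [← hf', ← hf'] at h1 h2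
      simp only [Fin.val_rev, Fin.lt_def] at *
      omega
    have hfinj : Function.Injective f := by
      intro s t hst
      rcases lt_trichotomy s t with h | h | h
      · have := hlt s t h; rw [hst] at this; omega
      · exact h
      · have := hlt t s h; rw [hst] at this; omega
    refine ⟨Finset.univ.image f, ?_, ?_, ?_⟩
    · intro d hd
      rw [Finset.mem_image] at hd
      obtain ⟨s, -, rfl⟩ := hd
      exact hf s
    · rw [Finset.card_image_of_injective _ hfinj, Finset.card_univ, Fintype.card_fin]
    · intro d hd e he hne
      rw [Finset.mem_image] at hd he
      obtain ⟨s, -, rfl⟩ := hd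
      obtain ⟨t, -, rfl⟩ := he
      rcases lt_trichotomy s t with h | rfl | h
      · exact Or.inl (hlt s t h)
      · exact absurd rfl hne
      · exact Or.inr (hlt t s h)

theorem exists_diagonalsToFilling_eq {n : ℕ} {S : Finset (ℕ × ℕ)} (hS : S ⊆ (staircase n).cells) :
    ∃ T, diagonalsToFilling n T = S := by
  classical
  refine ⟨Finset.univ.filter fun d => ((d.2.rev : ℕ), (d.1 : ℕ)) ∈ S, ?_⟩
  ext ⟨i, j⟩
  unfold diagonalsToFilling
  simp only [Finset.mem_image, Finset.mem_filter, Finset.mem_univ, true_and]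
  constructor
  · rintro ⟨d, h, h'⟩
    rwa [h'] at h
  · intro h
    have := hS h
    rw [YoungDiagram.mem_cells, mem_staircase] at this
    dsimp only at this
    refine ⟨(⟨j, by omega⟩, Fin.rev ⟨i, by omega⟩), ?_, ?_⟩
    · simpa using h
    · simp

theorem diagonalsToFilling_subset_iff {n : ℕ} {T T' : Finset (Fin n × Fin n)} :
    diagonalsToFilling n T ⊆ diagonalsToFilling n T' ↔ T ⊆ T' := by
  constructor
  · rintro h ⟨a, b⟩ hd
    exact mem_diagonalsToFilling.1 (h (mem_diagonalsToFilling.2 hd))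
  · intro h
    exact Finset.image_subset_image h

theorem mem_kTriangulations_iff {n k : ℕ} (hkn : 2 * k < n) {T : Finset (Fin n × Fin n)} :
    T ∈ kTriangulations n k ↔ diagonalsToFilling n T ∈ neFillings (staircase n) k := by
  rw [mem_neFillings_iff_maximal hkn]
  constructor
  · intro h
    refine ⟨isCrossingFree_iff.1 h.1, fun S hS hTS => ?_⟩
    obtain ⟨T', rfl⟩ := exists_diagonalsToFilling_eq hS.1
    exact diagonalsToFilling_subset_iff.2
      (h.2 (isCrossingFree_iff.2 hS) (diagonalsToFilling_subset_iff.1 hTS))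
  · intro h
    exact ⟨isCrossingFree_iff.2 h.1, fun T' hT' hTT' => diagonalsToFilling_subset_iff.1
      (h.2 (isCrossingFree_iff.1 hT') (diagonalsToFilling_subset_iff.2 hTT'))⟩

theorem bijOn_diagonalsToFilling {n k : ℕ} (hkn : 2 * k < n) :
    Set.BijOn (diagonalsToFilling n) (kTriangulations n k) (neFillings (staircase n) k) := by
  refine ⟨fun T hT => (mem_kTriangulations_iff hkn).1 hT, (diagonalsToFilling_injective n).injOn,
    fun S hS => ?_⟩
  obtain ⟨T, rfl⟩ := exists_diagonalsToFilling_eq hS.1.1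
  exact ⟨T, (mem_kTriangulations_iff hkn).2 hS, rfl⟩

open DyckStep

/-! ### Lattice paths -/

/-- The number of north steps among the first `m` steps of a path. -/
def height (p : List DyckStep) (m : ℕ) : ℕ := (p.take m).count U

theorem count_D_add_height (p : List DyckStep) (m : ℕ) :
    (p.take m).count D + height p m = min m p.length := by
  have h : ∀ l : List DyckStep, l.count D + l.count U = l.length := by
    intro l
    induction l with
    | nil => rfl
    | cons s l ih => cases s <;> simp <;> omega
  rw [height, h, List.length_take]

@[simp] theorem height_zero (p : List DyckStep) : height p 0 = 0 := by simp [height]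

theorem height_cons_succ (s : DyckStep) (p : List DyckStep) (m : ℕ) :
    height (s :: p) (m + 1) = height p m + if s = U then 1 else 0 := by
  cases s <;> simp [height]

theorem height_append_D (p : List DyckStep) (m : ℕ) : height (p ++ [D]) m = height p m := by
  unfold height
  rw [List.take_append, List.count_append]
  have : (List.take (m - p.length) [D]).count U = 0 := by
    rw [List.count_eq_zero]
    intro h
    have := List.mem_of_mem_take h
    simp at this
  omega

theorem height_succ_le (p : List DyckStep) (m : ℕ) :
    height p m ≤ height p (m + 1) ∧ height p (m + 1) ≤ height p m + 1 := by
  induction p generalizing m with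
  | nil => simp [height]
  | cons s p ih =>
    cases m with
    | zero => rw [height_cons_succ]; simp; split_ifs <;> simp
    | succ m =>
      rw [height_cons_succ, height_cons_succ]
      have := ih m
      omega

theorem height_add_le (p : List DyckStep) (m d : ℕ) : height p (m + d) ≤ height p m + d := by
  induction d with
  | zero => rfl
  | succ d ih =>
    have := (height_succ_le p (m + d)).2
    rw [← add_assoc]
    omega

theorem height_mono (p : List DyckStep) : Monotone (height p) :=
  monotone_nat_of_le_succ fun m => (height_succ_le p m).1

theorem height_of_length_le {p : List DyckStep} {m : ℕ} (h : p.length ≤ m) :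
    height p m = p.count U := by
  rw [height, List.take_of_length_le h]

theorem height_le (p : List DyckStep) (m : ℕ) : height p m ≤ m := by
  have := count_D_add_height p m
  omega

/-- A path is determined by its length and its heights. -/
theorem path_ext {p q : List DyckStep} (hl : p.length = q.length)
    (h : ∀ m ≤ p.length, height p m = height q m) : p = q := by
  induction p generalizing q with
  | nil => exact (List.length_eq_zero_iff.1 hl.symm).symm
  | cons s p ih =>
    rcases q with _ | ⟨t, q⟩
    · simp at hl
    have h1 := h 1 (by simp)
    rw [height_cons_succ, height_cons_succ, height_zero, height_zero] at h1
    have hst : s = t := by cases s <;> cases t <;> simp at h1 ⊢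
    subst hst
    congr 1
    refine ih (by simpa using hl) fun m hm => ?_
    have h2 := h (m + 1) (by simpa using hm)
    rw [height_cons_succ, height_cons_succ] at h2
    omega

/-- The path with prescribed heights. -/
def pathOfHeights (y : ℕ → ℕ) (M : ℕ) : List DyckStep :=
  (List.range M).map fun m => if y (m + 1) = y m then D else U

theorem length_pathOfHeights (y : ℕ → ℕ) (M : ℕ) : (pathOfHeights y M).length = M := by
  simp [pathOfHeights]

theorem height_pathOfHeights {y : ℕ → ℕ} {M m : ℕ} (h0 : y 0 = 0)
    (h : ∀ m < M, y m ≤ y (m + 1) ∧ y (m + 1) ≤ y m + 1) (hm : m ≤ M) :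
    height (pathOfHeights y M) m = y m := by
  induction m with
  | zero => rw [height_zero, h0]
  | succ m ih =>
    have h1 := ih (by omega)
    have h2 := h m (by omega)
    have h3 : m < (pathOfHeights y M).length := by rw [length_pathOfHeights]; omega
    rw [height] at h1 ⊢
    rw [List.take_add_one, List.count_append, h1, List.getElem?_eq_getElem h3]
    simp only [pathOfHeights, List.getElem_map, List.getElem_range, Option.toList_some]
    split_ifs with h4
    · simp [h4]
    · simp; omega

theorem isDyckPath_iff {l : ℕ} {p : List DyckStep} :
    IsDyckPath l p ↔ p.length = 2 * l ∧ height p (2 * l) = l ∧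
      ∀ m ≤ 2 * l, m ≤ 2 * height p m := by
  constructor
  · rintro ⟨w, rfl, rfl⟩
    have h0 := w.two_mul_semilength_eq_length
    refine ⟨h0.symm, ?_, fun m hm => ?_⟩
    · rw [height_of_length_le h0.ge]
      rfl
    · have h1 := w.count_D_le_count_U m
      have h2 := count_D_add_height w.toList m
      rw [← h0, min_eq_left hm] at h2
      unfold height at *
      omega
  · rintro ⟨h1, h2, h3⟩
    have h4 := count_D_add_height p (2 * l)
    rw [List.take_of_length_le h1.le, h1, min_self] at h4
    rw [height_of_length_le h1.le] at h2 h4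
    refine ⟨⟨p, by omega, fun m => ?_⟩, rfl, h2⟩
    rcases le_total m (2 * l) with hm | hm
    · have h5 := count_D_add_height p m
      have h6 := h3 m hm
      rw [h1, min_eq_left hm] at h5
      unfold height at *
      omega
    · rw [List.take_of_length_le (by omega)]
      omega

theorem mem_kFans_iff {k l : ℕ} {p : Fin k → List DyckStep} :
    p ∈ kFans k l ↔ (∀ i, (p i).length = 2 * l ∧ height (p i) (2 * l) = l ∧
      ∀ m ≤ 2 * l, m ≤ 2 * height (p i) m) ∧ ∀ i j, i ≤ j → ∀ m, height (p i) m ≤ height (p j) m := by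
  unfold kFans
  rw [Set.mem_ofPred_eq]
  simp only [isDyckPath_iff]
  rfl

theorem onLiftedPath_iff {k h i : ℕ} {p : List DyckStep} {b : ℕ × ℕ} :
    OnLiftedPath k h i p b ↔ ∃ m ≤ p.length, b.1 + i + 1 + height p m = h + k ∧
      b.2 + i + 1 + height p m = k + m := by
  unfold OnLiftedPath
  refine exists_congr fun m => and_congr_right fun hm => ?_
  have := count_D_add_height p m
  rw [min_eq_left hm] at this
  unfold height at *
  omega

/-! ### South-east fillings of the staircase -/

theorem AvoidsSE.not_chain {n k : ℕ} {S : Finset (ℕ × ℕ)} (hS : AvoidsSE (staircase n) k S)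
    (c : Fin (k + 1) → ℕ × ℕ) (hc : ∀ s t, s < t → (c s).1 < (c t).1 ∧ (c s).2 < (c t).2)
    (h : ∀ s, c s ∈ S) : False := by
  refine hS.2 ⟨c, ⟨hc, ?_⟩, h⟩
  -- the south-east corner of the smallest rectangle is the last box of the chain
  have hle : ∀ s, (c s).1 ≤ (c (Fin.last k)).1 ∧ (c s).2 ≤ (c (Fin.last k)).2 := by
    intro s
    rcases (Fin.le_last s).eq_or_lt with rfl | hs
    · exact ⟨le_rfl, le_rfl⟩
    · exact ⟨(hc _ _ hs).1.le, (hc _ _ hs).2.le⟩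
  rintro b ⟨-, t, -, h1⟩ ⟨-, t', -, h2⟩
  have h3 := hS.1 (h (Fin.last k))
  rw [YoungDiagram.mem_cells, mem_staircase] at h3
  rw [mem_staircase]
  have := hle t
  have := hle t'
  omega

theorem isPassive_iff {n k : ℕ} (hkn : 2 * k < n) {b : ℕ × ℕ} :
    IsPassive (staircase n) k b ↔ b ∈ staircase n ∧
      (b.1 + (n - 2 * k) ≤ b.2 + 1 ∨ b.2 + (n - 2 * k) ≤ b.1 + 1) := by
  unfold IsPassive
  refine and_congr_right fun hb => ?_
  rw [mem_staircase] at hb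
  constructor
  · intro h
    by_contra hcon
    apply h
    -- `k + 1` consecutive boxes of the diagonal through `b`
    obtain ⟨e, f, u, he, h1, h2, h3⟩ : ∃ e f u, u ≤ k ∧ b.1 = e + u ∧ b.2 = f + u ∧
        (u = k ∨ e = 0 ∨ f = 0) := by
      rcases le_total b.1 b.2 with h1 | h1
      · rcases le_total b.1 k with h2 | h2
        · exact ⟨0, b.2 - b.1, b.1, by omega, by omega, by omega, by omega⟩
        · exact ⟨b.1 - k, b.2 - k, k, by omega, by omega, by omega, by omega⟩
      · rcases le_total b.2 k with h2 | h2
        · exact ⟨b.1 - b.2, 0, b.2, by omega, by omega, by omega, by omega⟩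
        · exact ⟨b.1 - k, b.2 - k, k, by omega, by omega, by omega, by omega⟩
    refine ⟨fun s => (e + s, f + s), ⟨fun s t hst => ?_, ?_⟩, ⟨u, by omega⟩, ?_⟩
    · have : (s : ℕ) < t := hst
      constructor <;> dsimp only <;> omega
    · rintro x ⟨-, t, -, h4⟩ ⟨-, t', -, h5⟩
      rw [mem_staircase]
      have := t.is_lt
      have := t'.is_lt
      dsimp only at h4 h5
      omega
    · exact Prod.ext h1.symm h2.symm
  · rintro h ⟨c, ⟨hc, hrect⟩, s, rfl⟩
    have h1 := add_sub_le_of_strictMono (f := fun s => (c s).1) (fun s t hst => (hc s t hst).1)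
    have h2 := add_sub_le_of_strictMono (f := fun s => (c s).2) (fun s t hst => (hc s t hst).2)
    have h3 := h1 0 s (Fin.zero_le _)
    have h4 := h1 s (Fin.last k) (Fin.le_last _)
    have h5 := h2 0 s (Fin.zero_le _)
    have h6 := h2 s (Fin.last k) (Fin.le_last _)
    have hlast : ((c (Fin.last k)).1, (c (Fin.last k)).2) ∈ staircase n :=
      hrect _ ⟨Fin.last k, Fin.last k, le_rfl, le_rfl⟩ ⟨Fin.last k, Fin.last k, le_rfl, le_rfl⟩
    rw [mem_staircase] at hlast
    have := s.is_lt
    simp only [Fin.val_zero, Fin.val_last] at *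
    omega

/-- The rows of the boxes of `S` on the diagonal with index `m`, which consists of the boxes `b`
with `b.2 + l = b.1 + m`. -/
def diagRows (l : ℕ) (S : Finset (ℕ × ℕ)) (m : ℕ) : Finset ℕ :=
  (S.filter fun b => b.2 + l = b.1 + m).image Prod.fst

theorem mem_diagRows {l m r : ℕ} {S : Finset (ℕ × ℕ)} :
    r ∈ diagRows l S m ↔ ∃ c, (r, c) ∈ S ∧ c + l = r + m := by
  simp only [diagRows, Finset.mem_image, Finset.mem_filter, Prod.exists]
  constructor
  · rintro ⟨a, c, h, rfl⟩; exact ⟨c, h⟩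
  · rintro ⟨c, h⟩; exact ⟨r, c, h, rfl⟩

theorem card_diagRows (l : ℕ) (S : Finset (ℕ × ℕ)) (m : ℕ) :
    (diagRows l S m).card = (S.filter fun b => b.2 + l = b.1 + m).card := by
  apply Finset.card_image_of_injOn
  rintro ⟨a, b⟩ h ⟨a', b'⟩ h' heq
  simp only [Finset.coe_filter, Set.mem_ofPred_eq] at h h' heq
  ext <;> dsimp only <;> omega

theorem AvoidsSE.card_diagRows_le {n k : ℕ} {S : Finset (ℕ × ℕ)} (hS : AvoidsSE (staircase n) k S)
    (l m : ℕ) : (diagRows l S m).card ≤ k := by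
  by_contra hlt
  obtain ⟨X, hX, hcard⟩ := Finset.exists_subset_card_eq (show k + 1 ≤ (diagRows l S m).card by omega)
  have h1 : ∀ s, ∃ c, (X.orderEmbOfFin hcard s, c) ∈ S ∧ c + l = X.orderEmbOfFin hcard s + m :=
    fun s => mem_diagRows.1 (hX (Finset.orderEmbOfFin_mem X hcard s))
  choose c hc hc' using h1
  refine hS.not_chain (fun s => (X.orderEmbOfFin hcard s, c s)) (fun s t hst => ?_) hc
  have h2 := (X.orderEmbOfFin hcard).lt_iff_lt.2 hst
  have := hc' s
  have := hc' t
  dsimp only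
  omega

/-- The passive boxes are those on the short diagonals; the others lie on the diagonals with index
`m` for `2 ≤ m ≤ 2 * l - 2`. -/
theorem card_eq_sum_diagRows {n k : ℕ} (hkn : 2 * k < n) {S : Finset (ℕ × ℕ)}
    (hS : S ⊆ (staircase n).cells) [DecidablePred (IsPassive (staircase n) k)] :
    S.card = (S.filter (IsPassive (staircase n) k)).card +
      ∑ m ∈ Finset.Icc 2 (2 * (n - 2 * k) - 2), (diagRows (n - 2 * k) S m).card := by
  rw [← Finset.card_filter_add_card_filter_not (IsPassive (staircase n) k)]
  congr 1
  have hmem : ∀ b ∈ S.filter (fun b => ¬ IsPassive (staircase n) k b),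
      b.2 + (n - 2 * k) - b.1 ∈ Finset.Icc 2 (2 * (n - 2 * k) - 2) := by
    intro b hb
    rw [Finset.mem_filter, isPassive_iff hkn] at hb
    have hb' : b ∈ staircase n := hS hb.1
    rw [Finset.mem_Icc]
    have := hb.2
    simp only [hb', true_and] at this
    omega
  rw [Finset.card_eq_sum_card_fiberwise hmem]
  refine Finset.sum_congr rfl fun m hm => ?_
  rw [card_diagRows]
  congr 1
  ext b
  rw [Finset.mem_Icc] at hm
  simp only [Finset.mem_filter]
  constructor
  · rintro ⟨⟨h1, h2⟩, h3⟩
    exact ⟨h1, by omega⟩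
  · rintro ⟨h1, h3⟩
    refine ⟨⟨h1, ?_⟩, by omega⟩
    rw [isPassive_iff hkn]
    omega

section

variable {n k : ℕ} {p : Fin k → List DyckStep}

theorem mem_fanToFilling (hp : p ∈ kFans k (n - 2 * k)) {b : ℕ × ℕ} :
    b ∈ fanToFilling n k p ↔ b ∈ staircase n ∧ (IsPassive (staircase n) k b ∨
      ∃ i : Fin k, ∃ m ≤ 2 * (n - 2 * k), b.1 + i + 1 + height (p i) m = (n - 2 * k) + k ∧
      b.2 + i + 1 + height (p i) m = k + m) := by
  classical
  rw [mem_kFans_iff] at hp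
  unfold fanToFilling liftFan
  rw [Finset.mem_filter, YoungDiagram.mem_cells]
  refine and_congr_right fun _ => or_congr_right (exists_congr fun i => ?_)
  rw [onLiftedPath_iff, (hp.1 i).1]

theorem height_le_of_mem_kFans {l : ℕ} (hp : p ∈ kFans k l) (i : Fin k) (m : ℕ) :
    height (p i) m ≤ l := by
  rw [mem_kFans_iff] at hp
  have h1 := (hp.1 i).2.1
  rcases le_total m (2 * l) with h | h
  · exact h1 ▸ height_mono (p i) h
  · rw [height_of_length_le (by rw [(hp.1 i).1]; exact h)]
    rw [height_of_length_le (by rw [(hp.1 i).1])] at h1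
    exact h1.le

theorem avoidsSE_fanToFilling (hp : p ∈ kFans k (n - 2 * k)) :
    AvoidsSE (staircase n) k (fanToFilling n k p) := by
  refine ⟨fun b hb => ((mem_fanToFilling hp).1 hb).1, ?_⟩
  rintro ⟨c, hc, hcS⟩
  have h1 : ∀ s, ∃ i : Fin k, ∃ m ≤ 2 * (n - 2 * k),
      (c s).1 + i + 1 + height (p i) m = (n - 2 * k) + k ∧
      (c s).2 + i + 1 + height (p i) m = k + m := by
    intro s
    rcases ((mem_fanToFilling hp).1 (hcS s)).2 with h | h
    · exact absurd ⟨c, hc, s, rfl⟩ h.2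
    · exact h
  choose i m hm hi hj using h1
  -- two boxes of the chain lie on the same path
  obtain ⟨s, t, hst, heq⟩ : ∃ s t, s < t ∧ i s = i t := by
    obtain ⟨s, t, hne, heq⟩ := Fintype.exists_ne_map_eq_of_card_lt i (by simp)
    rcases lt_or_gt_of_ne hne with h | h
    · exact ⟨s, t, h, heq⟩
    · exact ⟨t, s, h, heq.symm⟩
  have h2 := hc.1 s t hst
  have h3 := hi s
  have h4 := hi t
  have h5 := hj s
  have h6 := hj t
  rw [heq] at h3 h5
  rcases le_total (m s) (m t) with h | h
  · have := height_mono (p (i t)) h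
    omega
  · have := height_add_le (p (i t)) (m t) (m s - m t)
    rw [Nat.add_sub_cancel' h] at this
    omega

/-- The rows in which the lifted paths of a fan meet a diagonal, from north to south. -/
theorem diagRows_fanToFilling (hkn : 2 * k < n) (hp : p ∈ kFans k (n - 2 * k)) {m : ℕ}
    (hm : m ≤ 2 * (n - 2 * k)) :
    ∃ hcard : (diagRows (n - 2 * k) (fanToFilling n k p) m).card = k, ∀ s : Fin k,
      (diagRows (n - 2 * k) (fanToFilling n k p) m).orderEmbOfFin hcard s + height (p s.rev) m =
        n - 2 * k + s := by
  have hle := fun i => height_le_of_mem_kFans hp i m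
  have hp' := mem_kFans_iff.1 hp
  have hmem : ∀ s : Fin k, n - 2 * k + s - height (p s.rev) m ∈
      diagRows (n - 2 * k) (fanToFilling n k p) m := by
    intro s
    have h1 := (hp'.1 s.rev).2.2 m hm
    have h2 := hle s.rev
    have h3 := height_le (p s.rev) m
    have h4 := s.is_lt
    have h5 := Fin.val_rev s
    rw [mem_diagRows]
    refine ⟨s + m - height (p s.rev) m, ?_, by omega⟩
    rw [mem_fanToFilling hp, mem_staircase]
    refine ⟨by dsimp only; omega, Or.inr ⟨s.rev, m, hm, ?_, ?_⟩⟩ <;> dsimp only <;> omega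
  have hmono : StrictMono fun s : Fin k => n - 2 * k + s - height (p s.rev) m := by
    intro s t hst
    have h1 := hp'.2 t.rev s.rev (Fin.rev_le_rev.2 hst.le) m
    have h2 := hle s.rev
    have h3 := hle t.rev
    have h4 : (s : ℕ) < t := hst
    dsimp only
    omega
  have hcard : (diagRows (n - 2 * k) (fanToFilling n k p) m).card = k := by
    apply le_antisymm ((avoidsSE_fanToFilling hp).card_diagRows_le _ _)
    have h1 : (Finset.univ.image fun s : Fin k => n - 2 * k + s - height (p s.rev) m) ⊆
        diagRows (n - 2 * k) (fanToFilling n k p) m := by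
      intro r hr
      rw [Finset.mem_image] at hr
      obtain ⟨s, -, rfl⟩ := hr
      exact hmem s
    have h2 := Finset.card_le_card h1
    rwa [Finset.card_image_of_injective _ hmono.injective, Finset.card_univ, Fintype.card_fin] at h2
  refine ⟨hcard, fun s => ?_⟩
  rw [← Finset.orderEmbOfFin_unique hcard hmem hmono]
  have := hle s.rev
  dsimp only
  omega

theorem card_le_card_fanToFilling (hkn : 2 * k < n) (hp : p ∈ kFans k (n - 2 * k))
    {S : Finset (ℕ × ℕ)} (hS : AvoidsSE (staircase n) k S) :
    S.card ≤ (fanToFilling n k p).card ∧ (S.card = (fanToFilling n k p).card →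
      ∀ m ≤ 2 * (n - 2 * k), (diagRows (n - 2 * k) S m).card = k) ∧
      (S.card = (fanToFilling n k p).card → ∀ b, IsPassive (staircase n) k b → b ∈ S) := by
  classical
  have hF := avoidsSE_fanToFilling hp
  have h1 := card_eq_sum_diagRows hkn hS.1
  have h2 := card_eq_sum_diagRows hkn hF.1
  have hpass : (fanToFilling n k p).filter (IsPassive (staircase n) k) =
      (staircase n).cells.filter (IsPassive (staircase n) k) := by
    ext b
    simp only [Finset.mem_filter, mem_fanToFilling hp, YoungDiagram.mem_cells]
    tauto
  have hsub : S.filter (IsPassive (staircase n) k) ⊆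
      (staircase n).cells.filter (IsPassive (staircase n) k) := Finset.filter_subset_filter _ hS.1
  have h3 := Finset.card_le_card hsub
  have hdiag : ∀ m ∈ Finset.Icc 2 (2 * (n - 2 * k) - 2), (diagRows (n - 2 * k) S m).card ≤
      (diagRows (n - 2 * k) (fanToFilling n k p) m).card := by
    intro m hm
    rw [Finset.mem_Icc] at hm
    rw [(diagRows_fanToFilling hkn hp (by omega)).1]
    exact hS.card_diagRows_le _ _
  have h4 := Finset.sum_le_sum hdiag
  rw [hpass] at h2
  have hpassS : S.card = (fanToFilling n k p).card → ∀ b, IsPassive (staircase n) k b → b ∈ S := by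
    intro heq b hb
    have h5 := Finset.eq_of_subset_of_card_le hsub (by omega)
    have h6 : b ∈ (staircase n).cells.filter (IsPassive (staircase n) k) :=
      Finset.mem_filter.2 ⟨hb.1, hb⟩
    rw [← h5] at h6
    exact (Finset.mem_filter.1 h6).1
  refine ⟨by omega, fun heq m hm => ?_, hpassS⟩
  refine Eq.trans ?_ (diagRows_fanToFilling hkn hp hm).1
  by_cases hm' : m ∈ Finset.Icc 2 (2 * (n - 2 * k) - 2)
  · exact (Finset.sum_eq_sum_iff_of_le hdiag).1 (by omega) m hm'
  · rw [Finset.mem_Icc] at hm'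
    congr 1
    ext r
    rw [mem_diagRows, mem_diagRows]
    refine exists_congr fun c => and_congr_left fun hc => ?_
    have key : (r, c) ∈ staircase n → IsPassive (staircase n) k (r, c) := fun h => by
      rw [isPassive_iff hkn]
      refine ⟨h, ?_⟩
      dsimp only
      omega
    exact ⟨fun h => (mem_fanToFilling hp).2 ⟨hS.1 h, Or.inl (key (hS.1 h))⟩,
      fun h => hpassS heq _ (key (hF.1 h))⟩

theorem fanToFilling_mem_seFillings (hkn : 2 * k < n) (hp : p ∈ kFans k (n - 2 * k)) :
    fanToFilling n k p ∈ seFillings (staircase n) k :=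
  ⟨avoidsSE_fanToFilling hp, fun _ hS => (card_le_card_fanToFilling hkn hp hS).1⟩

theorem fanToFilling_injOn (hkn : 2 * k < n) :
    Set.InjOn (fanToFilling n k) (kFans k (n - 2 * k)) := by
  intro p hp q hq heq
  have hp' := mem_kFans_iff.1 hp
  have hq' := mem_kFans_iff.1 hq
  ext1 i
  apply path_ext (by rw [(hp'.1 i).1, (hq'.1 i).1])
  intro m hm
  rw [(hp'.1 i).1] at hm
  obtain ⟨h1, h2⟩ := diagRows_fanToFilling hkn hp hm
  obtain ⟨h3, h4⟩ := diagRows_fanToFilling hkn hq hm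
  have h5 := h2 i.rev
  have h6 := h4 i.rev
  simp only [heq, Fin.rev_rev] at h5 h6
  omega

theorem kFans_nonempty (k l : ℕ) : (kFans k l).Nonempty := by
  have hy : ∀ m ≤ 2 * l, height (pathOfHeights (fun m => min m l) (2 * l)) m = min m l := fun m hm =>
    height_pathOfHeights (y := fun m => min m l) (by simp)
      (fun m _ => by constructor <;> omega) hm
  refine ⟨fun _ => pathOfHeights (fun m => min m l) (2 * l), mem_kFans_iff.2
    ⟨fun i => ⟨length_pathOfHeights _ _, ?_, fun m hm => ?_⟩, fun _ _ _ _ => le_rfl⟩⟩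
  · rw [hy _ le_rfl]; omega
  · rw [hy _ hm]; omega

/-- Two neighbouring diagonals of a filling with `k` boxes on each of them: the boxes interlace,
since otherwise there would be a chain of length `k + 1`. -/
theorem AvoidsSE.interlace {S : Finset (ℕ × ℕ)} (hS : AvoidsSE (staircase n) k S) {l m : ℕ}
    (h1 : (diagRows l S m).card = k) (h2 : (diagRows l S (m + 1)).card = k) (s : Fin k) :
    (diagRows l S (m + 1)).orderEmbOfFin h2 s ≤ (diagRows l S m).orderEmbOfFin h1 s ∧
      (diagRows l S m).orderEmbOfFin h1 s ≤ (diagRows l S (m + 1)).orderEmbOfFin h2 s + 1 := by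
  have hmem : ∀ (m : ℕ) (h : (diagRows l S m).card = k) (s : Fin k),
      ∃ c, ((diagRows l S m).orderEmbOfFin h s, c) ∈ S ∧
        c + l = (diagRows l S m).orderEmbOfFin h s + m :=
    fun m h s => mem_diagRows.1 (Finset.orderEmbOfFin_mem _ h s)
  have hlt : ∀ (m : ℕ) (h : (diagRows l S m).card = k) (s t : Fin k), s < t →
      (diagRows l S m).orderEmbOfFin h s < (diagRows l S m).orderEmbOfFin h t :=
    fun m h s t hst => ((diagRows l S m).orderEmbOfFin h).lt_iff_lt.2 hst
  have key : ∀ (m₁ m₂ : ℕ) (g₁ : (diagRows l S m₁).card = k) (g₂ : (diagRows l S m₂).card = k),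
      (diagRows l S m₁).orderEmbOfFin g₁ s < (diagRows l S m₂).orderEmbOfFin g₂ s →
      (diagRows l S m₁).orderEmbOfFin g₁ s + m₁ < (diagRows l S m₂).orderEmbOfFin g₂ s + m₂ →
      False := by
    intro m₁ m₂ g₁ g₂ hr hc
    choose c₁ hc₁ hc₁' using hmem m₁ g₁
    choose c₂ hc₂ hc₂' using hmem m₂ g₂
    -- the boxes up to index `s` on the first diagonal, those from index `s` on the second one
    have hs : ∀ t : Fin (k + 1), ¬ (t : ℕ) ≤ s → (t : ℕ) - 1 < k := fun t ht => by omega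
    have hs' : ∀ t : Fin (k + 1), (t : ℕ) ≤ s → (t : ℕ) < k := fun t ht => by omega
    refine hS.not_chain (fun t => if ht : (t : ℕ) ≤ s then
        ((diagRows l S m₁).orderEmbOfFin g₁ ⟨t, hs' t ht⟩, c₁ ⟨t, hs' t ht⟩)
      else ((diagRows l S m₂).orderEmbOfFin g₂ ⟨t - 1, hs t ht⟩, c₂ ⟨t - 1, hs t ht⟩)) ?_ ?_
    · intro t t' htt'
      have htt : (t : ℕ) < t' := htt'
      split_ifs with a b b
      · have e1 := hlt m₁ g₁ ⟨t, hs' t a⟩ ⟨t', hs' t' b⟩ htt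
        have e2 := hc₁' ⟨t, hs' t a⟩
        have e3 := hc₁' ⟨t', hs' t' b⟩
        constructor <;> dsimp only <;> omega
      · have e1 : (diagRows l S m₁).orderEmbOfFin g₁ ⟨t, hs' t a⟩ ≤
            (diagRows l S m₁).orderEmbOfFin g₁ s :=
          ((diagRows l S m₁).orderEmbOfFin g₁).le_iff_le.2 a
        have e2 : (diagRows l S m₂).orderEmbOfFin g₂ s ≤
            (diagRows l S m₂).orderEmbOfFin g₂ ⟨t' - 1, hs t' b⟩ :=
          ((diagRows l S m₂).orderEmbOfFin g₂).le_iff_le.2 (show (s : ℕ) ≤ (t' : ℕ) - 1 by omega)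
        have e3 := hc₁' ⟨t, hs' t a⟩
        have e4 := hc₂' ⟨t' - 1, hs t' b⟩
        constructor <;> dsimp only <;> omega
      · omega
      · have e1 := hlt m₂ g₂ ⟨t - 1, hs t a⟩ ⟨t' - 1, hs t' b⟩
          (show (t : ℕ) - 1 < (t' : ℕ) - 1 by omega)
        have e2 := hc₂' ⟨t - 1, hs t a⟩
        have e3 := hc₂' ⟨t' - 1, hs t' b⟩
        constructor <;> dsimp only <;> omega
    · intro t
      split_ifs with a
      · exact hc₁ _
      · exact hc₂ _
  constructor
  · by_contra hcon
    exact key m (m + 1) h1 h2 (by omega) (by omega)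
  · by_contra hcon
    exact key (m + 1) m h2 h1 (by omega) (by omega)

/-- Bounds for the row of a box on a diagonal with `k` boxes. -/
theorem orderEmbOfFin_diagRows_bounds {S : Finset (ℕ × ℕ)} (hS : S ⊆ (staircase n).cells)
    {l m : ℕ} (h : (diagRows l S m).card = k) (s : Fin k) :
    s ≤ (diagRows l S m).orderEmbOfFin h s ∧ l + s ≤ (diagRows l S m).orderEmbOfFin h s + m ∧
      2 * (diagRows l S m).orderEmbOfFin h s + m + 2 * (k - s) ≤ n + l := by
  obtain ⟨k, rfl⟩ : ∃ k', k = k' + 1 := ⟨k - 1, by have := s.is_lt; omega⟩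
  have h1 := add_sub_le_of_strictMono (f := fun s => (diagRows l S m).orderEmbOfFin h s)
    (fun s t hst => ((diagRows l S m).orderEmbOfFin h).lt_iff_lt.2 hst)
  obtain ⟨c, hc, hc'⟩ := mem_diagRows.1 (Finset.orderEmbOfFin_mem _ h 0)
  obtain ⟨d, hd, hd'⟩ := mem_diagRows.1 (Finset.orderEmbOfFin_mem _ h (Fin.last k))
  have h2 := h1 0 s (Fin.zero_le _)
  have h3 := h1 s (Fin.last k) (Fin.le_last _)
  have h4 := hS hd
  rw [YoungDiagram.mem_cells, mem_staircase] at h4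
  have := s.is_lt
  simp only [Fin.val_zero, Fin.val_last] at *
  omega

theorem fanToFilling_surjOn (hkn : 2 * k < n) :
    Set.SurjOn (fanToFilling n k) (kFans k (n - 2 * k)) (seFillings (staircase n) k) := by
  intro S hS
  obtain ⟨p₀, hp₀⟩ := kFans_nonempty k (n - 2 * k)
  have h0 := card_le_card_fanToFilling hkn hp₀ hS.1
  have hcardS : S.card = (fanToFilling n k p₀).card :=
    le_antisymm h0.1 (hS.2 _ (avoidsSE_fanToFilling hp₀))
  have hcard := h0.2.1 hcardS
  have hpass := h0.2.2 hcardS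
  set l := n - 2 * k with hl
  -- the rows on the diagonals, extended by zero to indices that are out of range
  let t : Fin k → ℕ → ℕ := fun s m =>
    if h : m ≤ 2 * l then (diagRows l S m).orderEmbOfFin (hcard m h) s else 0
  have ht : ∀ s m (h : m ≤ 2 * l), t s m = (diagRows l S m).orderEmbOfFin (hcard m h) s :=
    fun s m h => dif_pos h
  have hb : ∀ s m, m ≤ 2 * l → s ≤ t s m ∧ l + s ≤ t s m + m ∧
      2 * t s m + m + 2 * (k - s) ≤ n + l := fun s m h => by
    rw [ht s m h]; exact orderEmbOfFin_diagRows_bounds hS.1.1 (hcard m h) s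
  have hstep : ∀ s m, m + 1 ≤ 2 * l → t s (m + 1) ≤ t s m ∧ t s m ≤ t s (m + 1) + 1 := fun s m h => by
    rw [ht s m (by omega), ht s (m + 1) h]
    exact hS.1.interlace _ _ s
  let y : Fin k → ℕ → ℕ := fun s m => l + s - t s m
  have hy : ∀ s m, m ≤ 2 * l → height (pathOfHeights (y s) (2 * l)) m + t s m = l + s := by
    intro s m hm
    rw [height_pathOfHeights (y := y s) ?_ ?_ hm]
    · have := hb s m hm
      have := s.is_lt
      simp only [y]
      omega
    · have := hb s 0 (by omega)
      have := s.is_lt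
      simp only [y]
      omega
    · intro m' hm'
      have := hb s m' (by omega)
      have := hb s (m' + 1) (by omega)
      have := hstep s m' (by omega)
      have := s.is_lt
      simp only [y]
      omega
  have hfan : (fun i : Fin k => pathOfHeights (y i.rev) (2 * l)) ∈ kFans k l := by
    rw [mem_kFans_iff]
    refine ⟨fun i => ⟨length_pathOfHeights _ _, ?_, fun m hm => ?_⟩, fun i j hij m => ?_⟩
    · have := hy i.rev (2 * l) le_rfl
      have := hb i.rev (2 * l) le_rfl
      have := i.rev.is_lt
      omega
    · have := hy i.rev m hm
      have := hb i.rev m hm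
      have := i.rev.is_lt
      omega
    · have key : ∀ m ≤ 2 * l, height (pathOfHeights (y i.rev) (2 * l)) m ≤
          height (pathOfHeights (y j.rev) (2 * l)) m := by
        intro m hm
        have e1 := hy i.rev m hm
        have e2 := hy j.rev m hm
        have e3 : t j.rev m + ((i.rev : ℕ) - j.rev) ≤ t i.rev m := by
          rw [ht _ _ hm, ht _ _ hm]
          obtain ⟨k, rfl⟩ : ∃ k', k = k' + 1 := ⟨k - 1, by have := i.is_lt; omega⟩
          exact add_sub_le_of_strictMono
            (f := fun s => (diagRows l S m).orderEmbOfFin (hcard m hm) s)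
            (fun s t hst => ((diagRows l S m).orderEmbOfFin _).lt_iff_lt.2 hst) _ _
            (Fin.rev_le_rev.2 hij)
        have e4 : (j.rev : ℕ) ≤ i.rev := Fin.rev_le_rev.2 hij
        omega
      rcases le_total m (2 * l) with hm | hm
      · exact key m hm
      · have := key (2 * l) le_rfl
        rwa [height_of_length_le (by rw [length_pathOfHeights]),
          height_of_length_le (by rw [length_pathOfHeights]),
          ← height_of_length_le (m := m) (by rw [length_pathOfHeights]; exact hm),
          ← height_of_length_le (m := m) (by rw [length_pathOfHeights]; exact hm)] at this
  refine ⟨_, hfan, ?_⟩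
  ext ⟨r, c⟩
  rw [mem_fanToFilling hfan]
  constructor
  · rintro ⟨h1, h2 | ⟨i, m, hm, h2, h3⟩⟩
    · exact hpass _ h2
    · have e1 := hy i.rev m hm
      have e2 := Fin.val_rev i
      have e3 : r = t i.rev m := by dsimp only at h2; omega
      obtain ⟨c', hc', hc''⟩ := mem_diagRows.1 (Finset.orderEmbOfFin_mem _ (hcard m hm) i.rev)
      rw [← ht _ _ hm, ← e3] at hc' hc''
      have : c = c' := by dsimp only at h2 h3; omega
      rwa [this]
  · intro h
    have h1 : (r, c) ∈ staircase n := hS.1.1 h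
    refine ⟨h1, ?_⟩
    by_cases hP : IsPassive (staircase n) k (r, c)
    · exact Or.inl hP
    · right
      rw [isPassive_iff hkn] at hP
      simp only [h1, true_and] at hP
      have hm : c + l - r ≤ 2 * l := by omega
      have h2 : r ∈ diagRows l S (c + l - r) := mem_diagRows.2 ⟨c, h, by omega⟩
      have h3 : r ∈ Set.range ((diagRows l S (c + l - r)).orderEmbOfFin (hcard _ hm)) := by
        rw [Finset.range_orderEmbOfFin]; exact h2
      obtain ⟨s, hs⟩ := h3
      rw [← ht _ _ hm] at hs
      have e1 := hy s _ hm
      have e2 := Fin.val_rev s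
      refine ⟨s.rev, c + l - r, hm, ?_, ?_⟩
      · rw [Fin.rev_rev]; dsimp only; omega
      · rw [Fin.rev_rev]; dsimp only; omega

theorem bijOn_fanToFilling (hkn : 2 * k < n) :
    Set.BijOn (fanToFilling n k) (kFans k (n - 2 * k)) (seFillings (staircase n) k) :=
  ⟨fun _ hp => fanToFilling_mem_seFillings hkn hp, fanToFilling_injOn hkn, fanToFilling_surjOn hkn⟩

end

/-! ### Reverse plane partitions and fans -/

theorem mem_innerShape {n k : ℕ} {b : ℕ × ℕ} :
    b ∈ innerShape (staircase n) k ↔ b.1 + b.2 + 2 * k + 1 < n := by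
  rw [← YoungDiagram.mem_cells]
  simp only [innerShape, Finset.mem_filter, YoungDiagram.mem_cells, mem_staircase]
  omega

theorem rowLen_innerShape (n k i : ℕ) :
    (innerShape (staircase n) k).rowLen i = n - 2 * k - 1 - i := by
  apply eq_of_forall_lt_iff
  intro j
  rw [← YoungDiagram.mem_iff_lt_rowLen, mem_innerShape]
  omega

theorem colLen_innerShape (n k j : ℕ) :
    (innerShape (staircase n) k).colLen j = n - 2 * k - 1 - j := by
  apply eq_of_forall_lt_iff
  intro i
  rw [← YoungDiagram.mem_iff_lt_colLen, mem_innerShape]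
  omega

theorem height_replicate_append (e : ℕ) (p : List DyckStep) (m : ℕ) :
    height (List.replicate e D ++ p) m = height p (m - e) := by
  induction e generalizing m with
  | zero => simp
  | succ e ih =>
    rw [List.replicate_succ, List.cons_append]
    cases m with
    | zero => simp
    | succ m => rw [height_cons_succ, ih]; simp

/-- Description of a boundary path by its heights. The part of the path that belongs to the rows
with index less than `h` starts in column `a h`. -/
theorem height_boundaryPath_aux (w h : ℕ) (a : ℕ → ℕ) (ha : Antitone a) (hw : a 0 ≤ w)
    {p : List DyckStep} (hp : p = ((List.range h).reverse.flatMap fun i =>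
      List.replicate (a i - a (i + 1)) D ++ [U]) ++ List.replicate (w - a 0) D) :
    p.length + a h = h + w ∧ p.count U = h ∧
      ∀ i < h, ∀ j, h - i ≤ height p (h - i + j) ↔ a i ≤ a h + j := by
  induction h generalizing p with
  | zero => subst hp; simp [hw, List.count_replicate]
  | succ h ih =>
    obtain ⟨h1, h2, h3⟩ := ih rfl
    have hp' : p = List.replicate (a h - a (h + 1)) D ++ (U :: (((List.range h).reverse.flatMap
        fun i => List.replicate (a i - a (i + 1)) D ++ [U]) ++ List.replicate (w - a 0) D)) := by
      rw [hp, List.range_succ]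
      simp
    generalize ((List.range h).reverse.flatMap
        fun i => List.replicate (a i - a (i + 1)) D ++ [U]) ++ List.replicate (w - a 0) D = q
      at h1 h2 h3 hp'
    have hah : a (h + 1) ≤ a h := ha (Nat.le_succ h)
    subst hp'
    refine ⟨?_, ?_, fun i hi j => ?_⟩
    · simp only [List.length_append, List.length_replicate, List.length_cons]
      omega
    · simp [List.count_append, List.count_replicate, h2]
    · rw [height_replicate_append]
      rcases Nat.lt_or_ge j (a h - a (h + 1)) with hj | hj
      · have hi' : a h ≤ a i := ha (by omega)
        have : height (U :: q) (h + 1 - i + j - (a h - a (h + 1))) ≤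
          h + 1 - i + j - (a h - a (h + 1)) := height_le _ _
        omega
      · rw [show h + 1 - i + j - (a h - a (h + 1)) = (h - i + (j - (a h - a (h + 1)))) + 1 by omega,
          height_cons_succ, if_pos rfl]
        rcases Nat.lt_or_ge i h with hih | hih
        · have := h3 i hih (j - (a h - a (h + 1)))
          omega
        · have : i = h := by omega
          subst this
          omega

theorem height_boundaryPath {w h : ℕ} {a : ℕ → ℕ} (ha : Antitone a) (hw : a 0 ≤ w) (hh : a h = 0) :
    (boundaryPath h w a).length = h + w ∧ (boundaryPath h w a).count U = h ∧
      ∀ i < h, ∀ j, h - i ≤ height (boundaryPath h w a) (h - i + j) ↔ a i ≤ j := by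
  have := height_boundaryPath_aux w h a ha hw rfl
  simp only [hh, add_zero, zero_add] at this
  exact this

/-- Reverse plane partitions of the staircase shape `(h, …, 2, 1)` with entries at most `k`. -/
structure IsRPP (h k : ℕ) (R : ℕ → ℕ → ℕ) : Prop where
  le : ∀ i j, i + j < h → R i j ≤ k
  row : ∀ i j, i + (j + 1) < h → R i j ≤ R i (j + 1)
  col : ∀ i j, (i + 1) + j < h → R i j ≤ R (i + 1) j

/-- The number of entries smaller than `m` in row `i`. -/
def countLT (h : ℕ) (R : ℕ → ℕ → ℕ) (m i : ℕ) : ℕ :=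
  ((Finset.range (h - i)).filter fun j => R i j < m).card

theorem IsRPP.row_mono {h k : ℕ} {R : ℕ → ℕ → ℕ} (hR : IsRPP h k R) {i j j' : ℕ} (hj : j ≤ j')
    (h' : i + j' < h) : R i j ≤ R i j' := by
  induction j', hj using Nat.le_induction with
  | base => rfl
  | succ j' _ ih => exact (ih (by omega)).trans (hR.row i j' h')

theorem IsRPP.lt_countLT {h k : ℕ} {R : ℕ → ℕ → ℕ} (hR : IsRPP h k R) {m i j : ℕ} :
    j < countLT h R m i ↔ i + j < h ∧ R i j < m := by
  unfold countLT
  constructor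
  · intro hj
    by_contra hcon
    have : (Finset.range (h - i)).filter (fun j => R i j < m) ⊆ Finset.range j := by
      intro j' hj'
      rw [Finset.mem_filter, Finset.mem_range] at hj'
      rw [Finset.mem_range]
      by_contra hlt
      exact hcon ⟨by omega, (hR.row_mono (not_lt.1 hlt) (by omega)).trans_lt hj'.2⟩
    have := Finset.card_le_card this
    rw [Finset.card_range] at this
    omega
  · rintro ⟨h1, h2⟩
    have : Finset.range (j + 1) ⊆ (Finset.range (h - i)).filter (fun j => R i j < m) := by
      intro j' hj'
      rw [Finset.mem_range] at hj'
      rw [Finset.mem_filter, Finset.mem_range]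
      exact ⟨by omega, (hR.row_mono (by omega) h1).trans_lt h2⟩
    have := Finset.card_le_card this
    rw [Finset.card_range] at this
    omega

theorem IsRPP.countLT_antitone {h k : ℕ} {R : ℕ → ℕ → ℕ} (hR : IsRPP h k R) (m : ℕ) :
    Antitone (countLT h R m) := by
  refine antitone_nat_of_succ_le fun i => ?_
  by_contra hlt
  have h1 := hR.lt_countLT.1 (not_le.1 hlt)
  exact lt_irrefl _ (hR.lt_countLT.2 ⟨by omega, (hR.col _ _ h1.1).trans_lt h1.2⟩)

theorem countLT_le (h : ℕ) (R : ℕ → ℕ → ℕ) (m i : ℕ) : countLT h R m i ≤ h - i := by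
  simpa [countLT] using Finset.card_filter_le (Finset.range (h - i)) fun j => R i j < m

theorem IsRPP.height_boundaryPath {h k : ℕ} {R : ℕ → ℕ → ℕ} (hR : IsRPP h k R) (m : ℕ) :
    (boundaryPath h h (countLT h R m)).length = h + h ∧
      (boundaryPath h h (countLT h R m)).count U = h ∧
      ∀ i < h, ∀ j, h - i ≤ height (boundaryPath h h (countLT h R m)) (h - i + j) ↔
        countLT h R m i ≤ j :=
  MaximalFillings.height_boundaryPath (hR.countLT_antitone m)
    ((countLT_le h R m 0).trans (Nat.sub_le _ _)) (by have := countLT_le h R m h; omega)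

/-- The path that separates the entries smaller than `m` from the others, with an additional north
step at the beginning and an additional east step at the end. -/
def extendedPath (h : ℕ) (R : ℕ → ℕ → ℕ) (m : ℕ) : List DyckStep :=
  U :: (boundaryPath h h (countLT h R m) ++ [D])

theorem height_extendedPath_succ (h : ℕ) (R : ℕ → ℕ → ℕ) (m t : ℕ) :
    height (extendedPath h R m) (t + 1) = height (boundaryPath h h (countLT h R m)) t + 1 := by
  rw [extendedPath, height_cons_succ, height_append_D, if_pos rfl]

theorem IsRPP.length_extendedPath {h k : ℕ} {R : ℕ → ℕ → ℕ} (hR : IsRPP h k R) (m : ℕ) :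
    (extendedPath h R m).length = 2 * (h + 1) := by
  have h1 := hR.height_boundaryPath m
  simp only [extendedPath, List.length_cons, List.length_append, h1.1, List.length_nil]
  omega

/-- The heights of the paths of a reverse plane partition: after `u + j + 1` steps, the path is
above height `u` if and only if the entry of column `j` in the `u`-th row from the bottom
is not smaller than `m`. -/
theorem IsRPP.lt_height_extendedPath {h k : ℕ} {R : ℕ → ℕ → ℕ} (hR : IsRPP h k R) {m u j : ℕ}
    (hu : 1 ≤ u) (hu' : u ≤ h) :
    u < height (extendedPath h R m) (u + j + 1) ↔ ¬ (j < u ∧ R (h - u) j < m) := by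
  have h1 := hR.height_boundaryPath m
  have h2 := h1.2.2 (h - u) (by omega) j
  rw [show h - (h - u) = u by omega] at h2
  rw [height_extendedPath_succ, Nat.lt_add_one_iff, h2, ← not_lt, hR.lt_countLT]
  refine not_congr (and_congr_left fun _ => ?_)
  omega

theorem IsRPP.height_extendedPath_le {h k : ℕ} {R : ℕ → ℕ → ℕ} (hR : IsRPP h k R) (m t : ℕ) :
    height (extendedPath h R m) t ≤ h + 1 := by
  have h1 := hR.height_boundaryPath m
  have h2 := height_mono (extendedPath h R m) (show t ≤ t + 2 * h + 1 by omega)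
  rw [height_extendedPath_succ, height_of_length_le (p := boundaryPath _ _ _) (by rw [h1.1]; omega), h1.2.1] at h2
  exact h2

theorem IsRPP.mem_kFans {h k : ℕ} {R : ℕ → ℕ → ℕ} (hR : IsRPP h k R) :
    (fun i : Fin k => extendedPath h R (k - i)) ∈ kFans k (h + 1) := by
  rw [mem_kFans_iff]
  have hbase : ∀ m t, 1 ≤ t → 1 ≤ height (extendedPath h R m) t := by
    intro m t ht
    obtain ⟨t, rfl⟩ := Nat.exists_eq_add_of_le' ht
    rw [height_extendedPath_succ]
    omega
  have hdyck : ∀ m t, t ≤ 2 * (h + 1) → t ≤ 2 * height (extendedPath h R m) t := by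
    intro m t ht
    by_contra hlt
    set u := height (extendedPath h R m) t with hu
    have h1 := hbase m t (by omega)
    have h2 := (hR.lt_height_extendedPath (m := m) (u := u) (j := t - 1 - u) h1 (by omega))
    rw [show u + (t - 1 - u) + 1 = t by omega, ← hu] at h2
    omega
  refine ⟨fun i => ⟨hR.length_extendedPath _, ?_, hdyck _⟩, fun i j hij t => ?_⟩
  · apply le_antisymm (hR.height_extendedPath_le _ _)
    have := hdyck (k - i) _ le_rfl
    omega
  · have hij' : (i : ℕ) ≤ j := hij
    rcases Nat.eq_zero_or_pos t with rfl | ht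
    · simp
    by_contra hlt
    rw [not_le] at hlt
    set u := height (extendedPath h R (k - j)) t with hu
    have h1 := hbase (k - j) t ht
    have h2 := hR.height_extendedPath_le (k - i) t
    have h3 := height_le (extendedPath h R (k - i)) t
    have h4 := hR.lt_height_extendedPath (m := k - i) (u := u) (j := t - 1 - u) (by omega) (by omega)
    have h5 := hR.lt_height_extendedPath (m := k - j) (u := u) (j := t - 1 - u) (by omega) (by omega)
    rw [show u + (t - 1 - u) + 1 = t by omega] at h4 h5
    rw [← hu] at h5
    omega

theorem IsRPP.eq_of_extendedPath_eq {h k : ℕ} {R R' : ℕ → ℕ → ℕ} (hR : IsRPP h k R)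
    (hR' : IsRPP h k R') (heq : ∀ i : Fin k, extendedPath h R (k - i) = extendedPath h R' (k - i))
    {i j : ℕ} (hij : i + j < h) : R i j = R' i j := by
  have key : ∀ m, 1 ≤ m → m ≤ k → (R i j < m ↔ R' i j < m) := by
    intro m h1 h2
    have h3 := heq ⟨k - m, by omega⟩
    rw [show k - (k - m) = m by omega] at h3
    have h4 := hR.lt_height_extendedPath (m := m) (u := h - i) (j := j) (by omega) (by omega)
    have h5 := hR'.lt_height_extendedPath (m := m) (u := h - i) (j := j) (by omega) (by omega)
    rw [h3, h5, show h - (h - i) = i by omega] at h4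
    omega
  have h1 := hR.le i j hij
  have h2 := hR'.le i j hij
  rcases lt_trichotomy (R i j) (R' i j) with h | h | h
  · have := key (R' i j) (by omega) h2; omega
  · exact h
  · have := key (R i j) (by omega) h1; omega

/-- The reverse plane partition of a fan: the entry of a box is the number of paths of the fan that
leave the box on their south-east side. -/
def rppOfFan {k : ℕ} (h : ℕ) (p : Fin k → List DyckStep) (r j : ℕ) : ℕ :=
  (Finset.univ.filter fun i : Fin k => h - r < height (p i) (h - r + j + 1)).card

theorem rppOfFan_isRPP {h k : ℕ} (p : Fin k → List DyckStep) : IsRPP h k (rppOfFan h p) := by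
  refine ⟨fun i j _ => ?_, fun i j _ => ?_, fun i j hij => ?_⟩
  · simpa [rppOfFan] using Finset.card_filter_le (Finset.univ : Finset (Fin k)) fun s =>
      h - i < height (p s) (h - i + j + 1)
  · refine Finset.card_le_card (Finset.monotone_filter_right _ fun s _ hs => hs.trans_le ?_)
    exact height_mono _ (by omega)
  · refine Finset.card_le_card (Finset.monotone_filter_right _ fun s _ hs => ?_)
    have h1 := (height_succ_le (p s) (h - (i + 1) + j + 1)).2
    rw [show h - (i + 1) + j + 1 + 1 = h - i + j + 1 by omega] at h1
    have h2 : h - i < height (p s) (h - i + j + 1) := hs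
    change h - (i + 1) < height (p s) (h - (i + 1) + j + 1)
    omega

theorem rppOfFan_lt_iff {h k : ℕ} {p : Fin k → List DyckStep} (hp : p ∈ kFans k (h + 1)) (i : Fin k)
    (r j : ℕ) : rppOfFan h p r j < k - i ↔ ¬ h - r < height (p i) (h - r + j + 1) := by
  rw [mem_kFans_iff] at hp
  unfold rppOfFan
  constructor
  · intro hlt hi
    have : Finset.Ici i ⊆ Finset.univ.filter fun i : Fin k => h - r < height (p i) (h - r + j + 1) := by
      intro i' hi'
      rw [Finset.mem_Ici] at hi'
      rw [Finset.mem_filter]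
      exact ⟨Finset.mem_univ _, hi.trans_le (hp.2 i i' hi' _)⟩
    have := Finset.card_le_card this
    rw [Fin.card_Ici] at this
    omega
  · intro hi
    have : (Finset.univ.filter fun i : Fin k => h - r < height (p i) (h - r + j + 1)) ⊆
        Finset.Ioi i := by
      intro i' hi'
      rw [Finset.mem_filter] at hi'
      rw [Finset.mem_Ioi]
      by_contra hlt
      exact hi (hi'.2.trans_le (hp.2 i' i (not_lt.1 hlt) _))
    have := Finset.card_le_card this
    rw [Fin.card_Ioi] at this
    have := i.is_lt
    omega

theorem extendedPath_rppOfFan {h k : ℕ} {p : Fin k → List DyckStep} (hp : p ∈ kFans k (h + 1))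
    (i : Fin k) : extendedPath h (rppOfFan h p) (k - i) = p i := by
  have hR := rppOfFan_isRPP (h := h) p
  have hp' := mem_kFans_iff.1 hp
  apply path_ext (by rw [hR.length_extendedPath, (hp'.1 i).1])
  intro t ht
  rw [hR.length_extendedPath] at ht
  rcases Nat.eq_zero_or_pos t with rfl | htpos
  · simp
  have hdyck := (hp'.1 i).2.2 t ht
  apply eq_of_forall_lt_iff
  intro u
  have e1 := hR.height_extendedPath_le (k - i) t
  have e2 := height_le_of_mem_kFans hp i t
  have e3 := height_le (extendedPath h (rppOfFan h p) (k - i)) t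
  have e4 := height_le (p i) t
  rcases Nat.eq_zero_or_pos u with rfl | hu
  · obtain ⟨t, rfl⟩ := Nat.exists_eq_add_of_le' htpos
    rw [height_extendedPath_succ]
    omega
  by_cases hu' : u ≤ h
  · by_cases hut : u < t
    · have h1 := hR.lt_height_extendedPath (m := k - i) (j := t - 1 - u) hu hu'
      have h2 := rppOfFan_lt_iff hp i (h - u) (t - 1 - u)
      rw [show h - (h - u) = u by omega] at h2
      rw [show u + (t - 1 - u) + 1 = t by omega] at h1 h2
      rw [h1, h2]
      omega
    · omega
  · omega

/-! ### Insertion into a column -/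

/-- Insertion of `x` into the increasing column `c` with result `c'` that passes `y` on to the next
column: either `x` bumps `y`, or `y = x + 1` and both letters are present. -/
inductive ColStep : List ℕ → ℕ → ℕ → List ℕ → Prop
  | bump (A B : List ℕ) (x y : ℕ) (hA : ∀ a ∈ A, a < x) (hxy : x < y) (hB : ∀ b ∈ B, y < b) :
      ColStep (A ++ y :: B) x y (A ++ x :: B)
  | stay (A B : List ℕ) (x : ℕ) (hA : ∀ a ∈ A, a < x) (hB : ∀ b ∈ B, x + 1 < b) :
      ColStep (A ++ x :: (x + 1) :: B) x (x + 1) (A ++ x :: (x + 1) :: B)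

theorem ColStep.insertColumn_eq {c c' : List ℕ} {x y : ℕ} (h : ColStep c x y c') :
    insertColumn x c = (c', some y) := by
  cases h with
  | bump A B x y hA hxy hB =>
    have h1 : (A ++ y :: B).find? (fun z => decide (x < z)) = some y := by
      rw [List.find?_eq_some_iff_append]
      exact ⟨by simpa using hxy, A, B, rfl, fun a ha => by have := hA a ha; simp; omega⟩
    have h2 : x ∉ A ++ y :: B := by
      intro hx
      rcases List.mem_append.1 hx with hx | hx
      · exact lt_irrefl _ (hA x hx)
      · rcases List.mem_cons.1 hx with hx | hx
        · omega
        · have := hB x hx; omega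
    unfold insertColumn
    rw [h1]
    simp only [h2, and_false, if_false, List.map_append, List.map_cons, if_true]
    have h3 : A.map (fun z => if z = y then x else z) = A := by
      conv_rhs => rw [← List.map_id A]
      refine List.map_congr_left fun a ha => ?_
      have := hA a ha
      rw [if_neg (by omega)]; rfl
    have h4 : B.map (fun z => if z = y then x else z) = B := by
      conv_rhs => rw [← List.map_id B]
      refine List.map_congr_left fun a ha => ?_
      have := hB a ha
      rw [if_neg (by omega)]; rfl
    rw [h3, h4]
  | stay A B x hA hB =>
    have h1 : (A ++ x :: (x + 1) :: B).find? (fun z => decide (x < z)) = some (x + 1) := by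
      rw [List.find?_eq_some_iff_append]
      refine ⟨by simp, A ++ [x], B, by simp, fun a ha => ?_⟩
      rcases List.mem_append.1 ha with ha | ha
      · have := hA a ha; simp; omega
      · simp at ha; simp [ha]
    unfold insertColumn
    rw [h1]
    simp

theorem insertColumn_of_forall_lt {c : List ℕ} {x : ℕ} (h : ∀ z ∈ c, z < x) :
    insertColumn x c = (c ++ [x], none) := by
  have h1 : c.find? (fun z => decide (x < z)) = none := by
    rw [List.find?_eq_none]
    intro z hz
    have := h z hz
    simp; omega
  unfold insertColumn
  rw [h1]

theorem ColStep.wordEquiv {c c' : List ℕ} {x y : ℕ} (h : ColStep c x y c') :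
    WordEquiv (c ++ [x]) (y :: c') := by
  cases h with
  | bump A B x y hA hxy hB =>
    have h1 := (wordEquiv_comm_of_lt x B fun b hb => by have := hB b hb; omega).context (A ++ [y]) []
    have h2 := (wordEquiv_comm_of_gt y A fun a ha => by have := hA a ha; omega).context [] (x :: B)
    simp only [List.append_assoc, List.cons_append, List.nil_append, List.append_nil] at h1 h2 ⊢
    exact h1.trans h2
  | stay A B x hA hB =>
    have h1 := (wordEquiv_comm_of_lt x B fun b hb => by have := hB b hb; omega).context
      (A ++ [x, x + 1]) []
    have h2 := (wordEquiv_braid x).context A B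
    have h3 := (wordEquiv_comm_of_gt (x + 1) A fun a ha => by have := hA a ha; omega).context []
      (x :: (x + 1) :: B)
    simp only [List.append_assoc, List.cons_append, List.nil_append, List.append_nil] at h1 h2 h3 ⊢
    exact (h1.trans h2).trans h3

theorem ColStep.length_eq {c c' : List ℕ} {x y : ℕ} (h : ColStep c x y c') :
    c'.length = c.length := by
  cases h <;> simp

theorem ColStep.lt {c c' : List ℕ} {x y : ℕ} (h : ColStep c x y c') : x < y := by
  cases h with
  | bump A B x y hA hxy hB => exact hxy
  | stay => omega

theorem ColStep.mem_left {c c' : List ℕ} {x y : ℕ} (h : ColStep c x y c') : y ∈ c := by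
  cases h <;> simp

theorem ColStep.mem_right {c c' : List ℕ} {x y : ℕ} (h : ColStep c x y c') : x ∈ c' := by
  cases h <;> simp

theorem ColStep.mem_of_mem {c c' : List ℕ} {x y v : ℕ} (h : ColStep c x y c') (hv : v ∈ c')
    (hvx : v ≠ x) : v ∈ c := by
  cases h with
  | bump A B x y hA hxy hB => simp at hv ⊢; tauto
  | stay => exact hv

theorem ColStep.mem_or_eq {c c' : List ℕ} {x y v : ℕ} (h : ColStep c x y c') (hv : v ∈ c) :
    v ∈ c' ∨ v = y := by
  cases h with
  | bump A B x y hA hxy hB => simp at hv ⊢; tauto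
  | stay => exact Or.inl hv

/-- The letter that is passed on is the smallest one that exceeds the inserted letter. -/
theorem ColStep.le_of_lt {c c' : List ℕ} {x y v : ℕ} (h : ColStep c x y c') (hv : v ∈ c)
    (hvx : x < v) : y ≤ v := by
  cases h with
  | bump A B x y hA hxy hB =>
    simp only [List.mem_append, List.mem_cons] at hv
    rcases hv with hv | rfl | hv
    · have := hA v hv; omega
    · exact le_rfl
    · exact (hB v hv).le
  | stay A B x hA hB => omega

theorem ColStep.lt_of_lt {c c' : List ℕ} {x y v : ℕ} (h : ColStep c x y c') (hv : v ∈ c')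
    (hvx : x + 1 < v) : y < v := by
  cases h with
  | bump A B x y hA hxy hB =>
    simp only [List.mem_append, List.mem_cons] at hv
    rcases hv with hv | rfl | hv
    · have := hA v hv; omega
    · omega
    · exact hB v hv
  | stay A B x hA hB => omega

theorem pairwise_append_cons {A B : List ℕ} {x : ℕ} :
    (A ++ x :: B).Pairwise (· < ·) ↔ A.Pairwise (· < ·) ∧ B.Pairwise (· < ·) ∧
      (∀ a ∈ A, a < x) ∧ (∀ b ∈ B, x < b) ∧ ∀ a ∈ A, ∀ b ∈ B, a < b := by
  rw [List.pairwise_append, List.pairwise_cons]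
  simp only [List.mem_cons, forall_eq_or_imp]
  constructor
  · rintro ⟨h1, ⟨h2, h3⟩, h4⟩
    exact ⟨h1, h3, fun a ha => (h4 a ha).1, h2, fun a ha => (h4 a ha).2⟩
  · rintro ⟨h1, h2, h3, h4, h5⟩
    exact ⟨h1, ⟨h4, h2⟩, fun a ha => ⟨h3 a ha, h5 a ha⟩⟩

theorem ColStep.pairwise_iff {c c' : List ℕ} {x y : ℕ} (h : ColStep c x y c') :
    c.Pairwise (· < ·) ↔ c'.Pairwise (· < ·) := by
  cases h with
  | bump A B x y hA hxy hB =>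
    rw [pairwise_append_cons, pairwise_append_cons]
    have h1 : ∀ a ∈ A, a < y := fun a ha => (hA a ha).trans hxy
    have h2 : ∀ b ∈ B, x < b := fun b hb => hxy.trans (hB b hb)
    tauto
  | stay => rfl

theorem exists_colStep {c : List ℕ} {x : ℕ} (hc : c.Pairwise (· < ·))
    (hr : IsReducedWord (c ++ [x])) : (∀ z ∈ c, z < x) ∨ ∃ y c', ColStep c x y c' := by
  cases hf : c.find? (fun z => decide (x < z)) with
  | none =>
    left
    rw [List.find?_eq_none] at hf
    intro z hz
    have h1 := hf z hz
    rcases eq_or_ne z x with rfl | hne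
    · exfalso
      obtain ⟨A, B, rfl⟩ := List.append_of_mem hz
      rw [pairwise_append_cons] at hc
      refine not_reduced_of_lt (fun w hw => ?_) hr
      have h2 := hc.2.2.2.1 w hw
      have h3 := hf w (by simp [hw])
      simp at h3; omega
    · simp at h1; omega
  | some y =>
    right
    rw [List.find?_eq_some_iff_append] at hf
    obtain ⟨hxy, A, B, rfl, hA⟩ := hf
    have hxy : x < y := by simpa using hxy
    have hA : ∀ a ∈ A, a ≤ x := fun a ha => by simpa using hA a ha
    have hc' := pairwise_append_cons.1 hc
    by_cases hx : x ∈ A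
    · obtain ⟨A, A', rfl⟩ := List.append_of_mem hx
      have h1 := pairwise_append_cons.1 hc'.1
      obtain rfl : A' = [] := by
        rw [List.eq_nil_iff_forall_not_mem]
        intro a ha
        have h2 := h1.2.2.2.1 a ha
        have h3 := hA a (by simp [ha])
        omega
      by_cases hy : y = x + 1
      · subst hy
        exact ⟨x + 1, A ++ x :: (x + 1) :: B,
          by simpa using ColStep.stay A B x h1.2.2.1 hc'.2.2.2.1⟩
      · exfalso
        refine not_reduced_of_lt (x := x) (A := A) (B := y :: B) ?_ (by simpa using hr)
        intro z hz
        rcases List.mem_cons.1 hz with rfl | hz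
        · omega
        · have := hc'.2.2.2.1 z hz; omega
    · refine ⟨y, _, ColStep.bump A B x y (fun a ha => ?_) hxy hc'.2.2.2.1⟩
      rcases (hA a ha).eq_or_lt with rfl | h
      · exact absurd ha hx
      · exact h

theorem exists_split {l : List ℕ} (hl : l.Pairwise (· < ·)) (y : ℕ) :
    ∃ F G, l = F ++ G ∧ (∀ a ∈ F, a < y) ∧ ∀ b ∈ G, y ≤ b := by
  induction l with
  | nil => exact ⟨[], [], by simp⟩
  | cons x l ih =>
    rw [List.pairwise_cons] at hl
    by_cases hx : x < y
    · obtain ⟨F, G, rfl, h1, h2⟩ := ih hl.2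
      exact ⟨x :: F, G, rfl, by simpa [hx] using h1, h2⟩
    · refine ⟨[], x :: l, rfl, by simp, fun b hb => ?_⟩
      rcases List.mem_cons.1 hb with rfl | hb
      · omega
      · have := hl.1 b hb; omega

/-- Reverse insertion into a column. -/
theorem exists_colStep_reverse {c' : List ℕ} {y : ℕ} (hc : c'.Pairwise (· < ·))
    (hr : IsReducedWord (y :: c')) (hy : ∃ z ∈ c', z < y) : ∃ c x, ColStep c x y c' := by
  obtain ⟨F, G, rfl, hF, hG⟩ := exists_split hc y
  rcases List.eq_nil_or_concat F with rfl | ⟨A, x, rfl⟩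
  · obtain ⟨z, hz, hzy⟩ := hy
    have := hG z (by simpa using hz)
    omega
  rw [List.concat_eq_append] at *
  have hc' := hc
  rw [List.append_assoc, List.singleton_append, pairwise_append_cons] at hc'
  have hxy := hF x (by simp)
  by_cases hyG : y ∈ G
  · obtain ⟨G', B, rfl⟩ := List.append_of_mem hyG
    have h1 := pairwise_append_cons.1 hc'.2.1
    obtain rfl : G' = [] := by
      rw [List.eq_nil_iff_forall_not_mem]
      intro a ha
      have h2 := h1.2.2.1 a ha
      have h3 := hG a (by simp [ha])
      omega
    by_cases hx : y = x + 1
    · subst hx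
      exact ⟨A ++ x :: (x + 1) :: B, x, by simpa using ColStep.stay A B x hc'.2.2.1 h1.2.2.2.1⟩
    · exfalso
      refine not_reduced_of_gt (y := y) (A := A ++ [x]) (B := B) (fun z hz => ?_) hr
      rcases List.mem_append.1 hz with hz | hz
      · have := hc'.2.2.1 z hz; omega
      · simp at hz; omega
  · refine ⟨A ++ y :: G, x, ?_⟩
    rw [List.append_assoc]
    refine ColStep.bump A G x y hc'.2.2.1 hxy fun b hb => ?_
    rcases (hG b hb).eq_or_lt with rfl | h
    · exact absurd hb hyG
    · exact h

theorem ColStep.unique {c₁ c₂ c' : List ℕ} {x₁ x₂ y : ℕ} (h₁ : ColStep c₁ x₁ y c')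
    (h₂ : ColStep c₂ x₂ y c') : c₁ = c₂ ∧ x₁ = x₂ := by
  have key : ∀ (A B A' B' : List ℕ) (x x' y : ℕ), (∀ a ∈ A, a < x) → x < y → (∀ b ∈ B, y < b) →
      (∀ a ∈ A', a < x') → x' < y → (∀ b ∈ B', y < b) → A ++ x :: B = A' ++ x' :: B' →
      A = A' ∧ x = x' ∧ B = B' := by
    intro A B A' B' x x' y hA hx hB hA' hx' hB' heq
    have hfil : ∀ (A B : List ℕ) (x : ℕ), (∀ a ∈ A, a < x) → x < y → (∀ b ∈ B, y < b) →
        (A ++ x :: B).filter (fun z => decide (z < y)) = A ++ [x] ∧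
        (A ++ x :: B).filter (fun z => decide (y < z)) = B := by
      intro A B x hA hx hB
      constructor
      · rw [List.filter_append, List.filter_eq_self.2, List.filter_cons_of_pos (by simpa using hx),
          List.filter_eq_nil_iff.2]
        · intro b hb; have := hB b hb; simp; omega
        · intro a ha; have := hA a ha; simp; omega
      · rw [List.filter_append, List.filter_eq_nil_iff.2, List.filter_cons_of_neg (by simp; omega),
          List.filter_eq_self.2, List.nil_append]
        · intro b hb; have := hB b hb; simp; omega
        · intro a ha; have := hA a ha; simp; omega
    have h1 := hfil A B x hA hx hB
    have h2 := hfil A' B' x' hA' hx' hB'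
    rw [heq] at h1
    have h3 := h1.1.symm.trans h2.1
    have h4 := List.append_inj' h3 rfl
    exact ⟨h4.1, by simpa using h4.2, h1.2.symm.trans h2.2⟩
  have hmem : ∀ (A B : List ℕ) (x y : ℕ), (∀ a ∈ A, a < x) → x < y → (∀ b ∈ B, y < b) →
      y ∉ A ++ x :: B := by
    intro A B x y hA hx hB hy
    simp only [List.mem_append, List.mem_cons] at hy
    rcases hy with hy | rfl | hy
    · have := hA y hy; omega
    · omega
    · exact lt_irrefl _ (hB y hy)
  generalize hc' : c' = d at h₂
  generalize hy' : y = z at h₂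
  cases h₁ with
  | bump A B x y hA hxy hB =>
    cases h₂ with
    | bump A' B' x' _ hA' hxy' hB' =>
      subst hy'
      obtain ⟨rfl, rfl, rfl⟩ := key A B A' B' x₁ x₂ y hA hxy hB hA' hxy' hB' hc'
      exact ⟨rfl, rfl⟩
    | stay A' B' x' hA' hB' =>
      exfalso
      refine hmem A B x₁ y hA hxy hB ?_
      rw [hc', hy']
      simp
  | stay A B x hA hB =>
    cases h₂ with
    | bump A' B' x' _ hA' hxy' hB' =>
      exfalso
      refine hmem A' B' x₂ z hA' hxy' hB' ?_
      rw [← hc', ← hy']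
      simp
    | stay A' B' x' hA' hB' => exact ⟨hc', by omega⟩

/-! ### Comparison of neighbouring columns -/

/-- The number of entries of a column that are at most `v`. -/
def countLe (c : List ℕ) (v : ℕ) : ℕ := c.countP fun z => decide (z ≤ v)

/-- The number of entries of a column that are smaller than `v`. -/
def countLt (c : List ℕ) (v : ℕ) : ℕ := c.countP fun z => decide (z < v)

/-- Two increasing columns `c` and `d` are in this relation if they can be neighbours in a tableau
with strictly increasing rows: every entry of `d` exceeds the entry of `c` in the same row. The
condition is expressed by counting entries. -/
def ColDom (c d : List ℕ) : Prop := ∀ v, countLe d v ≤ countLt c v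

theorem countLe_mono (c : List ℕ) : Monotone (countLe c) := fun v w h =>
  List.countP_mono_left fun z _ hz => by simp at hz ⊢; omega

theorem countLt_mono (c : List ℕ) : Monotone (countLt c) := fun v w h =>
  List.countP_mono_left fun z _ hz => by simp at hz ⊢; omega

theorem countLe_eq_countLt (c : List ℕ) (v : ℕ) : countLe c v = countLt c (v + 1) := by
  unfold countLe countLt
  congr 1
  ext z
  simp

theorem countLt_succ_of_mem {c : List ℕ} {v : ℕ} (h : v ∈ c) : countLt c v < countLt c (v + 1) := by
  obtain ⟨A, B, rfl⟩ := List.append_of_mem h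
  simp only [countLt, List.countP_append, List.countP_cons]
  have h1 := countLt_mono A (Nat.le_succ v)
  have h2 := countLt_mono B (Nat.le_succ v)
  unfold countLt at h1 h2
  simp only [lt_self_iff_false, decide_false, Bool.false_eq_true, if_false, Nat.succ_eq_add_one,
    lt_add_iff_pos_right, zero_lt_one, decide_true, if_true] at *
  omega

theorem countLt_succ_of_notMem {c : List ℕ} {v : ℕ} (h : v ∉ c) :
    countLt c (v + 1) = countLt c v := by
  unfold countLt
  refine List.countP_congr fun z hz => ?_
  have : z ≠ v := fun hzv => h (hzv ▸ hz)
  simp; omega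

theorem countLe_le_length (c : List ℕ) (v : ℕ) : countLe c v ≤ c.length := List.countP_le_length

theorem countLt_eq_length {c : List ℕ} {v : ℕ} (h : ∀ z ∈ c, z < v) : countLt c v = c.length := by
  rw [countLt, List.countP_eq_length]
  simpa using h

/-- The effect of an insertion on the column that receives the letter `y`: the letter is appended
or there is a step that passes on another letter. -/
def ColEvent (d : List ℕ) (y : ℕ) (d' : List ℕ) : Prop :=
  (∀ z ∈ d, z < y) ∧ d' = d ++ [y] ∨ ∃ z, ColStep d y z d'

theorem countLt_bump {A B : List ℕ} {x y : ℕ} (hA : ∀ a ∈ A, a < x) (hxy : x < y)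
    (hB : ∀ b ∈ B, y < b) (v : ℕ) : countLt (A ++ x :: B) v = countLt (A ++ y :: B) v ∨
      x < v ∧ v ≤ y ∧ countLt (A ++ x :: B) v = A.length + 1 ∧
        countLt (A ++ y :: B) v = A.length := by
  by_cases h : x < v ∧ v ≤ y
  · right
    have h1 : A.countP (fun z => decide (z < v)) = A.length := by
      rw [List.countP_eq_length]
      intro a ha; have := hA a ha; simp; omega
    have h2 : B.countP (fun z => decide (z < v)) = 0 := by
      rw [List.countP_eq_zero]
      intro b hb; have := hB b hb; simp; omega
    simp only [countLt, List.countP_append, List.countP_cons, h1, h2]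
    simp [h.1, h.2]
  · left
    simp only [countLt, List.countP_append, List.countP_cons]
    congr 2
    by_cases h1 : x < v
    · have h2 : y < v := by omega
      simp [h1, h2]
    · have h2 : ¬ y < v := by omega
      simp [h1, h2]

theorem notMem_bump {A B : List ℕ} {x y : ℕ} (hA : ∀ a ∈ A, a < x) (hxy : x < y)
    (hB : ∀ b ∈ B, y < b) : y ∉ A ++ x :: B ∧ x ∉ A ++ y :: B := by
  simp only [List.mem_append, List.mem_cons, not_or]
  refine ⟨⟨fun h => ?_, by omega, fun h => lt_irrefl _ (hB y h)⟩,
    ⟨fun h => lt_irrefl _ (hA x h), by omega, fun h => ?_⟩⟩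
  · have := hA y h; omega
  · have := hB x h; omega

/-- The counts of the column that emits the letter `y`: they increase by one on an interval that
ends with `y`, or else the column does not change. -/
theorem ColStep.counts_left {c c' : List ℕ} {x y : ℕ} (h : ColStep c x y c') :
    (y ∉ c' ∧ countLt c' y = countLt c y + 1 ∧ ∀ v, countLt c' v = countLt c v ∨
      v ≤ y ∧ countLt c' v = countLt c v + 1 ∧ countLt c' v = countLt c' y) ∨
    (c' = c ∧ x ∈ c ∧ y = x + 1) := by
  cases h with
  | bump A B x y hA hxy hB =>
    have h1 := countLt_bump hA hxy hB y
    have h2 : countLt (A ++ y :: B) y = A.length ∧ countLt (A ++ x :: B) y = A.length + 1 := by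
      rcases h1 with h1 | h1
      · exfalso
        have e1 := countLt_succ_of_notMem (notMem_bump hA hxy hB).1
        have e2 := countLt_succ_of_mem (show y ∈ A ++ y :: B by simp)
        rcases countLt_bump hA hxy hB (y + 1) with h3 | h3 <;> omega
      · omega
    left
    refine ⟨(notMem_bump hA hxy hB).1, by omega, fun v => ?_⟩
    rcases countLt_bump hA hxy hB v with h3 | h3
    · exact Or.inl h3
    · exact Or.inr (by omega)
  | stay A B x hA hB => exact Or.inr ⟨rfl, by simp, rfl⟩

/-- The counts of the column that receives the letter `y`: they increase by one on an interval that
starts with `y`, or else the column does not change. -/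
theorem ColEvent.counts_right {d d' : List ℕ} {y : ℕ} (h : ColEvent d y d') :
    (y ∉ d ∧ countLe d' y = countLe d y + 1 ∧ ∀ v, countLe d' v = countLe d v ∨
      y ≤ v ∧ countLe d' v = countLe d v + 1 ∧ countLe d v = countLe d y) ∨
    (d' = d ∧ y + 1 ∈ d) := by
  rcases h with ⟨h, rfl⟩ | ⟨z, h⟩
  · left
    have h1 : ∀ v, countLe (d ++ [y]) v = countLe d v + if y ≤ v then 1 else 0 := by
      intro v; simp [countLe, List.countP_append]
    refine ⟨fun hy => lt_irrefl _ (h y hy), by rw [h1, if_pos le_rfl], fun v => ?_⟩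
    by_cases hv : y ≤ v
    · right
      refine ⟨hv, by rw [h1, if_pos hv], ?_⟩
      rw [countLe_eq_countLt, countLe_eq_countLt, countLt_eq_length, countLt_eq_length]
      · intro z hz; have := h z hz; omega
      · intro z hz; have := h z hz; omega
    · left; rw [h1, if_neg hv]; rfl
  · cases h with
    | bump A B x z hA hxy hB =>
      left
      have h2 : ∀ v, countLe (A ++ y :: B) v = countLe (A ++ z :: B) v ∨
          y ≤ v ∧ countLe (A ++ y :: B) v = A.length + 1 ∧ countLe (A ++ z :: B) v = A.length := by
        intro v
        rw [countLe_eq_countLt, countLe_eq_countLt]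
        rcases countLt_bump hA hxy hB (v + 1) with h | h
        · exact Or.inl h
        · exact Or.inr (by omega)
      have h3 : countLe (A ++ y :: B) y = A.length + 1 ∧ countLe (A ++ z :: B) y = A.length := by
        rcases h2 y with h | h
        · exfalso
          rw [countLe_eq_countLt, countLe_eq_countLt] at h
          have e1 := countLt_succ_of_notMem (notMem_bump hA hxy hB).2
          have e2 := countLt_succ_of_mem (show y ∈ A ++ y :: B by simp)
          rcases countLt_bump hA hxy hB y with h3 | h3 <;> omega
        · exact h.2
      refine ⟨(notMem_bump hA hxy hB).2, by omega, fun v => ?_⟩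
      rcases h2 v with h | h
      · exact Or.inl h
      · exact Or.inr (by omega)
    | stay A B x hA hB => exact Or.inr ⟨rfl, by simp⟩

theorem ColEvent.mem {d d' : List ℕ} {y : ℕ} (h : ColEvent d y d') : y ∈ d' := by
  rcases h with ⟨-, rfl⟩ | ⟨z, h⟩
  · simp
  · exact h.mem_right

/-- Insertion preserves and reflects strictly increasing rows. -/
theorem ColStep.colDom_iff {c c' d d' : List ℕ} {x y : ℕ} (h : ColStep c x y c')
    (h' : ColEvent d y d') : ColDom c d ↔ ColDom c' d' := by
  have hc := h.counts_left
  have hd := h'.counts_right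
  have hy := h.mem_left
  have hy' := h'.mem
  constructor
  · intro hdom v
    have e1 := hdom v
    have e2 : countLt c v ≤ countLt c' v := by
      rcases hc with ⟨-, -, hc⟩ | ⟨rfl, -⟩
      · rcases hc v with hc | hc <;> omega
      · rfl
    rcases hd with ⟨hyd, hd1, hd⟩ | ⟨rfl, -⟩
    · rcases hd v with hd | ⟨hyv, hd2, hd3⟩
      · omega
      · have e3 := hdom y
        rcases hyv.eq_or_lt with rfl | hyv
        · rcases hc with ⟨-, hc, -⟩ | ⟨rfl, hx, rfl⟩
          · omega
          · have e4 := hdom x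
            have e5 := countLt_succ_of_mem hx
            have e6 := countLt_succ_of_notMem hyd
            rw [countLe_eq_countLt] at *
            rw [countLe_eq_countLt] at *
            omega
        · have e4 := countLt_succ_of_mem hy
          have e5 := countLt_mono c (show y + 1 ≤ v from hyv)
          omega
    · omega
  · intro hdom v
    have e1 := hdom v
    have e2 : countLe d v ≤ countLe d' v := by
      rcases hd with ⟨-, -, hd⟩ | ⟨rfl, -⟩
      · rcases hd v with hd | hd <;> omega
      · rfl
    rcases hc with ⟨hyc, hc1, hc⟩ | ⟨rfl, -⟩
    · rcases hc v with hc | ⟨hyv, hc2, hc3⟩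
      · omega
      · have e3 := hdom y
        rcases hyv.eq_or_lt with rfl | hyv
        · rcases hd with ⟨-, hd, -⟩ | ⟨rfl, hy1⟩
          · omega
          · have e4 := hdom (v + 1)
            have e5 := countLt_succ_of_mem hy1
            have e6 := countLt_succ_of_notMem hyc
            rw [← countLe_eq_countLt, ← countLe_eq_countLt] at e5
            omega
        · have e4 := countLt_succ_of_mem hy'
          have e5 := countLe_mono d' (show v ≤ y - 1 by omega)
          rw [countLe_eq_countLt d' y] at e3
          rw [countLe_eq_countLt d' (y - 1), Nat.sub_add_cancel (by omega)] at e5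
          omega
    · omega

theorem ColStep.countLt_eq_countLe {c c' : List ℕ} {x y : ℕ} (h : ColStep c x y c') :
    countLt c' y = countLe c' x := by
  rw [countLe_eq_countLt]
  cases h with
  | bump A B x y hA hxy hB =>
    have hpos : ∀ v, x < v → v ≤ y → countLt (A ++ x :: B) v = A.length + 1 := by
      intro v h1 h2
      have e1 : A.countP (fun z => decide (z < v)) = A.length := by
        rw [List.countP_eq_length]
        intro a ha; have := hA a ha; simp; omega
      have e2 : B.countP (fun z => decide (z < v)) = 0 := by
        rw [List.countP_eq_zero]
        intro b hb; have := hB b hb; simp; omega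
      simp [countLt, List.countP_append, e1, e2, h1]
    rw [hpos y hxy le_rfl, hpos (x + 1) (by omega) hxy]
  | stay => rfl

/-! ### Insertion into a tableau -/

/-- Tableaux with strictly increasing rows and columns, given as lists of nonempty columns. -/
def IsTab : List (List ℕ) → Prop
  | [] => True
  | c :: cs => c ≠ [] ∧ c.Pairwise (· < ·) ∧ ColDom c (cs.headD []) ∧ IsTab cs

/-- The column reading word of a tableau: the columns are read from right to left, and each of them
from top to bottom. -/
def readCols : List (List ℕ) → List ℕ
  | [] => []
  | c :: cs => readCols cs ++ c

theorem colDom_nil (c : List ℕ) : ColDom c [] := fun v => by simp [countLe]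

theorem ColDom.length_le {c d : List ℕ} (h : ColDom c d) : d.length ≤ c.length := by
  have h1 : countLe d d.sum = d.length := by
    rw [countLe, List.countP_eq_length]
    intro z hz
    simpa using List.single_le_sum (by simp) z hz
  have h2 : countLt c d.sum ≤ c.length := List.countP_le_length
  have := h d.sum
  omega

theorem insertTableau_cons_none {x : ℕ} {c c' : List ℕ} {cs : List (List ℕ)}
    (h : insertColumn x c = (c', none)) : insertTableau x (c :: cs) = (c' :: cs, 0) := by
  rw [insertTableau, h]

theorem insertTableau_cons_some {x y : ℕ} {c c' : List ℕ} {cs : List (List ℕ)}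
    (h : insertColumn x c = (c', some y)) : insertTableau x (c :: cs) =
      (c' :: (insertTableau y cs).1, (insertTableau y cs).2 + 1) := by
  rw [insertTableau, h]

theorem reduced_insert_iff {P : List (List ℕ)} {c c' : List ℕ} {x y : ℕ} (h : ColStep c x y c')
    (u : List ℕ) (hr : IsReducedWord (readCols (c :: P) ++ x :: u)) :
    IsReducedWord (readCols P ++ y :: (c' ++ u)) := by
  have h1 := h.wordEquiv.context (readCols P) u
  simp only [readCols, List.append_assoc, List.cons_append, List.nil_append] at h1 hr ⊢
  refine h1.reduced ?_ hr
  simp [h.length_eq]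
  omega

/-- The effect of the insertion of a letter that keeps the reading word reduced: the result is a
tableau whose reading word is equivalent to the old one followed by the letter, with one more box in
the column that is returned. The new box is in a row whose index (starting with `1`) is at most the
number of entries of the first column that do not exceed `x`. -/
theorem insertTableau_spec {P : List (List ℕ)} {x : ℕ} (hP : IsTab P)
    (hr : IsReducedWord (readCols P ++ [x])) :
    IsTab (insertTableau x P).1 ∧
    WordEquiv (readCols P ++ [x]) (readCols (insertTableau x P).1) ∧
    ColEvent (P.headD []) x ((insertTableau x P).1.headD []) ∧
    (∀ i, ((insertTableau x P).1.getD i []).length =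
      (P.getD i []).length + if i = (insertTableau x P).2 then 1 else 0) ∧
    ((insertTableau x P).1.getD (insertTableau x P).2 []).length ≤
      countLe ((insertTableau x P).1.headD []) x := by
  induction P generalizing x with
  | nil =>
    refine ⟨⟨by simp, by simp, colDom_nil _, trivial⟩, WordEquiv.refl _, Or.inl ⟨by simp, rfl⟩,
      fun i => ?_, by simp [insertTableau, countLe]⟩
    rcases i with _ | i <;> simp [insertTableau]
  | cons c cs ih =>
    obtain ⟨hne, hsort, hdom, htab⟩ := hP
    have hrc : IsReducedWord (c ++ [x]) := by
      rw [readCols, List.append_assoc] at hr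
      exact hr.of_append_right
    rcases exists_colStep hsort hrc with h | ⟨y, c', h⟩
    · rw [insertTableau_cons_none (insertColumn_of_forall_lt h)]
      refine ⟨⟨by simp, ?_, fun v => ?_, htab⟩, ?_, Or.inl ⟨h, rfl⟩, fun i => ?_, ?_⟩
      · rw [pairwise_append_cons]
        exact ⟨hsort, by simp, h, by simp, by simp⟩
      · refine (hdom v).trans ?_
        simp [countLt, List.countP_append]
      · rw [readCols, readCols, List.append_assoc]
        exact WordEquiv.refl _
      · rcases i with _ | i <;> simp
      · have h1 : countLe (c ++ [x]) x = (c ++ [x]).length := by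
          rw [countLe, List.countP_eq_length]
          intro z hz
          rcases List.mem_append.1 hz with hz | hz
          · simpa using (h z hz).le
          · simp at hz; simp [hz]
        simp [h1]
    · rw [insertTableau_cons_some h.insertColumn_eq]
      have hr' := reduced_insert_iff h [] hr
      have hr'' : IsReducedWord (readCols cs ++ [y]) := by
        rw [show readCols cs ++ y :: (c' ++ []) = readCols cs ++ [y] ++ c' by simp] at hr'
        exact hr'.of_append_left
      obtain ⟨h1, h2, h3, h4, h5⟩ := ih htab hr''
      have hdom' := (h.colDom_iff h3).1 hdom
      refine ⟨⟨?_, h.pairwise_iff.1 hsort, hdom', h1⟩, ?_, Or.inr ⟨y, h⟩, fun i => ?_, ?_⟩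
      · exact List.ne_nil_of_mem h.mem_right
      · have e1 := h.wordEquiv.context (readCols cs) []
        have e2 := h2.append (WordEquiv.refl c')
        simp only [readCols, List.append_assoc, List.cons_append, List.nil_append,
          List.append_nil] at e1 e2 ⊢
        exact e1.trans e2
      · rcases i with _ | i
        · simp [h.length_eq]
        · have := h4 i
          simp only [List.getD_cons_succ, add_left_inj]
          exact this
      · simp only [List.getD_cons_succ, List.headD_cons]
        have := hdom' y
        rw [h.countLt_eq_countLe] at this
        exact h5.trans this

theorem insertTableau_reduced {P : List (List ℕ)} {x : ℕ} (hP : IsTab P)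
    (hr : IsReducedWord (readCols P ++ [x])) :
    IsReducedWord (readCols (insertTableau x P).1) ∧
      (readCols (insertTableau x P).1).length = (readCols P).length + 1 := by
  have hlen : (readCols (insertTableau x P).1).length = (readCols P).length + 1 := by
    clear hP hr
    induction P generalizing x with
    | nil => rfl
    | cons c cs ih =>
      cases hc : insertColumn x c with
      | mk c' o =>
        unfold insertColumn at hc
        cases hf : c.find? (fun y => decide (x < y)) with
        | none =>
          rw [hf] at hc
          simp only [Prod.mk.injEq] at hc
          have : insertColumn x c = (c ++ [x], none) := by unfold insertColumn; rw [hf]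
          rw [insertTableau_cons_none this]
          simp [readCols]
          omega
        | some y =>
          have : ∃ c', insertColumn x c = (c', some y) ∧ c'.length = c.length := by
            unfold insertColumn
            rw [hf]
            dsimp only
            split_ifs
            · exact ⟨_, rfl, rfl⟩
            · exact ⟨_, rfl, by simp⟩
          obtain ⟨c', h1, h2⟩ := this
          rw [insertTableau_cons_some h1]
          simp only [readCols, List.length_append, ih, h2]
          omega
  refine ⟨(insertTableau_spec hP hr).2.1.reduced ?_ hr, hlen⟩
  rw [hlen, List.length_append, List.length_singleton]

/-- Letters that are inserted in decreasing order add boxes from west to east, and letters that are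
inserted in increasing order do not. -/
theorem insertTableau_compare {P : List (List ℕ)} {x x' : ℕ} (hP : IsTab P)
    (hr : IsReducedWord (readCols P ++ [x, x'])) :
    (x' < x → (insertTableau x P).2 < (insertTableau x' (insertTableau x P).1).2) ∧
    (x < x' → (insertTableau x' (insertTableau x P).1).2 ≤ (insertTableau x P).2) := by
  induction P generalizing x x' with
  | nil =>
    constructor
    · intro h
      have h1 : insertTableau x [] = ([[x]], 0) := rfl
      have h2 : insertColumn x' [x] = ([x'], some x) :=
        (ColStep.bump [] [] x' x (by simp) h (by simp)).insertColumn_eq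
      rw [h1, insertTableau_cons_some h2]
      simp
    · intro h
      have h1 : insertTableau x [] = ([[x]], 0) := rfl
      rw [h1, insertTableau_cons_none (insertColumn_of_forall_lt (by simpa using h))]
  | cons c cs ih =>
    obtain ⟨hne, hsort, hdom, htab⟩ := hP
    have hrc : IsReducedWord (c ++ [x]) := by
      rw [readCols, show readCols cs ++ c ++ [x, x'] = readCols cs ++ (c ++ [x]) ++ [x'] by simp] at hr
      exact hr.of_infix
    rcases exists_colStep hsort hrc with h | ⟨y, c', h⟩
    · have hc' : (c ++ [x]).Pairwise (· < ·) := by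
        rw [pairwise_append_cons]
        exact ⟨hsort, by simp, h, by simp, by simp⟩
      have hrc' : IsReducedWord ((c ++ [x]) ++ [x']) := by
        rw [readCols, show readCols cs ++ c ++ [x, x'] = readCols cs ++ ((c ++ [x]) ++ [x'])
          by simp] at hr
        exact hr.of_append_right
      rw [insertTableau_cons_none (insertColumn_of_forall_lt h)]
      constructor
      · intro hx
        rcases exists_colStep hc' hrc' with h' | ⟨y', c'', h'⟩
        · have := h' x (by simp); omega
        · rw [insertTableau_cons_some h'.insertColumn_eq]
          simp
      · intro hx
        rw [insertTableau_cons_none (insertColumn_of_forall_lt fun z hz => ?_)]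
        rcases List.mem_append.1 hz with hz | hz
        · exact (h z hz).trans hx
        · simp at hz; omega
    · have hc' := h.pairwise_iff.1 hsort
      have hr' := reduced_insert_iff h [x'] hr
      have hrc' : IsReducedWord (c' ++ [x']) := by
        rw [show readCols cs ++ y :: (c' ++ [x']) = (readCols cs ++ [y]) ++ (c' ++ [x']) by simp] at hr'
        exact hr'.of_append_right
      rw [insertTableau_cons_some h.insertColumn_eq]
      rcases exists_colStep hc' hrc' with h' | ⟨y', c'', h'⟩
      · rw [insertTableau_cons_none (insertColumn_of_forall_lt h')]
        refine ⟨fun hx => ?_, fun _ => Nat.zero_le _⟩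
        have := h' x h.mem_right
        omega
      · rw [insertTableau_cons_some h'.insertColumn_eq]
        have hr'' : IsReducedWord (readCols cs ++ [y, y']) := by
          have e1 := h'.wordEquiv.context (readCols cs ++ [y]) []
          have e2 := e1.reduced (by simp [h'.length_eq]) (by simpa using hr')
          rw [show readCols cs ++ [y] ++ (y' :: c'') ++ [] = (readCols cs ++ [y, y']) ++ c'' by simp]
            at e2
          exact e2.of_append_left
        have := ih htab hr''
        constructor
        · intro hx
          have h1 := h'.le_of_lt h.mem_right hx
          have h2 := this.1 (h1.trans_lt h.lt)
          dsimp only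
          omega
        · intro hx
          have h1 := h.lt_of_lt h'.mem_left (by have := h'.lt; omega)
          have h2 := this.2 h1
          dsimp only
          omega

/-- The entries of column `i` that are new after the insertion of `x` are at least `x + i`. -/
theorem mem_of_mem_insertTableau {P : List (List ℕ)} {x : ℕ} (hP : IsTab P)
    (hr : IsReducedWord (readCols P ++ [x])) {i v : ℕ} (hv : v < x + i)
    (h : v ∈ (insertTableau x P).1.getD i []) : v ∈ P.getD i [] := by
  induction P generalizing x i with
  | nil =>
    rcases i with _ | i
    · simp [insertTableau] at h; omega
    · simp [insertTableau] at h
  | cons c cs ih =>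
    obtain ⟨hne, hsort, hdom, htab⟩ := hP
    have hrc : IsReducedWord (c ++ [x]) := by
      rw [readCols, List.append_assoc] at hr
      exact hr.of_append_right
    rcases exists_colStep hsort hrc with h' | ⟨y, c', h'⟩
    · rw [insertTableau_cons_none (insertColumn_of_forall_lt h')] at h
      rcases i with _ | i
      · simp at h
        rcases h with h | h
        · simpa using h
        · omega
      · simpa using h
    · rw [insertTableau_cons_some h'.insertColumn_eq] at h
      rcases i with _ | i
      · simp at h
        simpa using h'.mem_of_mem h (by omega)
      · have hr' := reduced_insert_iff h' [] hr
        rw [show readCols cs ++ y :: (c' ++ []) = readCols cs ++ [y] ++ c' by simp] at hr'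
        have hxy := h'.lt
        simpa using ih htab hr'.of_append_left (i := i) (by omega) (by simpa using h)

/-- Insertion does not change the set of letters. -/
theorem mem_readCols_insertTableau {P : List (List ℕ)} {x : ℕ} (hP : IsTab P)
    (hr : IsReducedWord (readCols P ++ [x])) {v : ℕ} :
    v ∈ readCols (insertTableau x P).1 ↔ v ∈ readCols P ∨ v = x := by
  induction P generalizing x with
  | nil => simp [insertTableau, readCols]
  | cons c cs ih =>
    obtain ⟨hne, hsort, hdom, htab⟩ := hP
    have hrc : IsReducedWord (c ++ [x]) := by
      rw [readCols, List.append_assoc] at hr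
      exact hr.of_append_right
    rcases exists_colStep hsort hrc with h' | ⟨y, c', h'⟩
    · rw [insertTableau_cons_none (insertColumn_of_forall_lt h')]
      simp [readCols, or_assoc]
    · rw [insertTableau_cons_some h'.insertColumn_eq]
      have hr' := reduced_insert_iff h' [] hr
      rw [show readCols cs ++ y :: (c' ++ []) = readCols cs ++ [y] ++ c' by simp] at hr'
      simp only [readCols, List.mem_append, ih htab hr'.of_append_left]
      have h1 := h'.mem_left
      have h2 := h'.mem_right
      have h3 : v ∈ c' → v ∈ c ∨ v = x := fun hv => by
        by_cases hx : v = x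
        · exact Or.inr hx
        · exact Or.inl (h'.mem_of_mem hv hx)
      have h4 : v ∈ c → v ∈ c' ∨ v = y := h'.mem_or_eq
      constructor
      · rintro ((h | rfl) | h)
        · exact Or.inl (Or.inl h)
        · exact Or.inl (Or.inr h1)
        · rcases h3 h with h | rfl
          · exact Or.inl (Or.inr h)
          · exact Or.inr rfl
      · rintro ((h | h) | rfl)
        · exact Or.inl (Or.inl h)
        · rcases h4 h with h | rfl
          · exact Or.inr h
          · exact Or.inl (Or.inr rfl)
        · exact Or.inr h2

/-- Reverse insertion: a corner of a tableau with reduced reading word can be removed. -/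
theorem exists_insertTableau {P' : List (List ℕ)} {j : ℕ} (hP : IsTab P')
    (hr : IsReducedWord (readCols P'))
    (hj : (P'.getD (j + 1) []).length < (P'.getD j []).length) :
    ∃ P x, IsTab P ∧ insertTableau x P = (P', j) ∧ WordEquiv (readCols P ++ [x]) (readCols P') ∧
      (readCols P').length = (readCols P).length + 1 ∧
      ColEvent (P.headD []) x (P'.headD []) := by
  induction P' generalizing j with
  | nil => simp at hj
  | cons c' cs' ih =>
    obtain ⟨hne, hsort, hdom, htab⟩ := hP
    rcases j with _ | j
    · obtain ⟨c, x, rfl⟩ : ∃ c x, c' = c ++ [x] :=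
        ⟨c'.dropLast, c'.getLast hne, (List.dropLast_append_getLast hne).symm⟩
      have hsort' := pairwise_append_cons.1 hsort
      have hhead : (cs'.headD []).length ≤ c.length := by
        have : cs'.headD [] = cs'.getD 0 [] := by cases cs' <;> rfl
        rw [this]
        simpa [Nat.lt_succ_iff] using hj
      rcases List.eq_nil_or_concat c with rfl | ⟨c₁, c₂, hc⟩
      · have hcs : cs' = [] := by
          rcases cs' with _ | ⟨d, cs'⟩
          · rfl
          · exact absurd (List.length_eq_zero_iff.1 (by simpa using hhead)) htab.1
        subst hcs
        exact ⟨[], x, trivial, rfl, WordEquiv.refl _, rfl, Or.inl ⟨by simp, rfl⟩⟩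
      · refine ⟨c :: cs', x, ⟨by rw [hc]; simp, hsort'.1, fun v => ?_, htab⟩,
          insertTableau_cons_none (insertColumn_of_forall_lt hsort'.2.2.1), ?_, ?_,
          Or.inl ⟨hsort'.2.2.1, rfl⟩⟩
        · by_cases hv : v ≤ x
          · have := hdom v
            have h1 : countLt (c ++ [x]) v = countLt c v := by
              simp [countLt, List.countP_append, hv]
            omega
          · rw [countLt_eq_length fun z hz => by have := hsort'.2.2.1 z hz; omega]
            exact (countLe_le_length _ _).trans hhead
        · rw [readCols, readCols, List.append_assoc]
          exact WordEquiv.refl _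
        · simp [readCols]; omega
    · obtain ⟨cs, y, h1, h2, h3, h4, h5⟩ := ih htab hr.of_append_left (j := j) (by simpa using hj)
      have hr' : IsReducedWord (readCols cs ++ (y :: c')) := by
        have := h3.symm.append (WordEquiv.refl c')
        rw [show readCols cs ++ (y :: c') = readCols cs ++ [y] ++ c' by simp]
        exact this.reduced (by simp [h4]; omega) hr
      obtain ⟨c, x, hstep⟩ := exists_colStep_reverse hsort hr'.of_append_right (by
        have e1 := hdom y
        have e2 : 0 < countLe (cs'.headD []) y := by
          rw [countLe, List.countP_pos_iff]
          exact ⟨y, h5.mem, by simp⟩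
        have e3 : 0 < countLt c' y := by omega
        rw [countLt, List.countP_pos_iff] at e3
        simpa using e3)
      refine ⟨c :: cs, x, ⟨List.ne_nil_of_mem hstep.mem_left, hstep.pairwise_iff.2 hsort,
        (hstep.colDom_iff h5).2 hdom, h1⟩, ?_, ?_, ?_, Or.inr ⟨y, hstep⟩⟩
      · rw [insertTableau_cons_some hstep.insertColumn_eq, h2]
      · have e1 := hstep.wordEquiv.context (readCols cs) []
        have e2 := h3.append (WordEquiv.refl c')
        simp only [readCols, List.append_assoc, List.cons_append, List.nil_append,
          List.append_nil] at e1 e2 ⊢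
        exact e1.trans e2
      · simp only [readCols, List.length_append, h4, hstep.length_eq]
        omega

/-- Insertion can be reversed in at most one way. -/
theorem insertTableau_injective {P Q : List (List ℕ)} {x y : ℕ} (hP : IsTab P) (hQ : IsTab Q)
    (hPr : IsReducedWord (readCols P ++ [x])) (hQr : IsReducedWord (readCols Q ++ [y]))
    (h : insertTableau x P = insertTableau y Q) : P = Q ∧ x = y := by
  have aux : ∀ (c : List ℕ) (cs : List (List ℕ)) (x y : ℕ), IsTab (c :: cs) →
      IsReducedWord (readCols (c :: cs) ++ [x]) → insertTableau x (c :: cs) ≠ ([[y]], 0) := by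
    intro c cs x y ⟨hne, hsort, _, _⟩ hr heq
    have hrc : IsReducedWord (c ++ [x]) := by
      rw [readCols, List.append_assoc] at hr
      exact hr.of_append_right
    rcases exists_colStep hsort hrc with h' | ⟨y, c', h'⟩
    · rw [insertTableau_cons_none (insertColumn_of_forall_lt h')] at heq
      simp only [Prod.mk.injEq, List.cons.injEq, and_true] at heq
      have := congrArg List.length heq.1
      simp at this
      exact hne this
    · rw [insertTableau_cons_some h'.insertColumn_eq] at heq
      simp at heq
  induction P generalizing Q x y with
  | nil =>
    rcases Q with _ | ⟨d, ds⟩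
    · simpa [insertTableau] using h
    · exact absurd h.symm (aux d ds y x hQ hQr)
  | cons c cs ih =>
    rcases Q with _ | ⟨d, ds⟩
    · exact absurd h (aux c cs x y hP hPr)
    obtain ⟨hne, hsort, hdom, htab⟩ := hP
    obtain ⟨hne', hsort', hdom', htab'⟩ := hQ
    have hrc : IsReducedWord (c ++ [x]) := by
      have hr := hPr
      rw [readCols, List.append_assoc] at hr
      exact hr.of_append_right
    have hrd : IsReducedWord (d ++ [y]) := by
      have hr := hQr
      rw [readCols, List.append_assoc] at hr
      exact hr.of_append_right
    rcases exists_colStep hsort hrc with h₁ | ⟨z, c', h₁⟩ <;>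
      rcases exists_colStep hsort' hrd with h₂ | ⟨w, d', h₂⟩
    · rw [insertTableau_cons_none (insertColumn_of_forall_lt h₁),
        insertTableau_cons_none (insertColumn_of_forall_lt h₂)] at h
      simp only [Prod.mk.injEq, List.cons.injEq, and_true] at h
      have h3 := List.append_inj' h.1 rfl
      exact ⟨by rw [h3.1, h.2], by simpa using h3.2⟩
    · rw [insertTableau_cons_none (insertColumn_of_forall_lt h₁),
        insertTableau_cons_some h₂.insertColumn_eq] at h
      simp at h
    · rw [insertTableau_cons_none (insertColumn_of_forall_lt h₂),
        insertTableau_cons_some h₁.insertColumn_eq] at h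
      simp at h
    · rw [insertTableau_cons_some h₁.insertColumn_eq,
        insertTableau_cons_some h₂.insertColumn_eq] at h
      simp only [Prod.mk.injEq, List.cons.injEq, add_left_inj] at h
      have hr₁ := reduced_insert_iff h₁ [] hPr
      have hr₂ := reduced_insert_iff h₂ [] hQr
      rw [show readCols cs ++ z :: (c' ++ []) = readCols cs ++ [z] ++ c' by simp] at hr₁
      rw [show readCols ds ++ w :: (d' ++ []) = readCols ds ++ [w] ++ d' by simp] at hr₂
      obtain ⟨rfl, rfl⟩ := ih htab htab' hr₁.of_append_left hr₂.of_append_left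
        (Prod.ext h.1.2 h.2)
      rw [h.1.1] at h₁
      obtain ⟨rfl, rfl⟩ := h₁.unique h₂
      exact ⟨rfl, rfl⟩

/-! ### Insertion of biwords -/

/-- The insertion of the bottom letters of a biword into a tableau. -/
def insertWord (P : List (List ℕ)) (t : List (ℕ × ℕ)) : List (List ℕ) :=
  t.foldl (fun P ab => (insertTableau ab.2 P).1) P

/-- The top letters of a biword, paired with the columns of the boxes that are added by the
insertion of its bottom letters. -/
def recordSeq : List (List ℕ) → List (ℕ × ℕ) → List (ℕ × ℕ)
  | _, [] => []
  | P, ab :: t => (ab.1, (insertTableau ab.2 P).2) :: recordSeq (insertTableau ab.2 P).1 t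

@[simp] theorem insertWord_nil (P : List (List ℕ)) : insertWord P [] = P := rfl

@[simp] theorem insertWord_cons (P : List (List ℕ)) (ab : ℕ × ℕ) (t : List (ℕ × ℕ)) :
    insertWord P (ab :: t) = insertWord (insertTableau ab.2 P).1 t := rfl

theorem insertWord_append (P : List (List ℕ)) (t t' : List (ℕ × ℕ)) :
    insertWord P (t ++ t') = insertWord (insertWord P t) t' := by
  simp [insertWord, List.foldl_append]

theorem recordSeq_append (P : List (List ℕ)) (t t' : List (ℕ × ℕ)) :
    recordSeq P (t ++ t') = recordSeq P t ++ recordSeq (insertWord P t) t' := by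
  induction t generalizing P with
  | nil => rfl
  | cons ab t ih => simp [recordSeq, ih]

theorem map_fst_recordSeq (P : List (List ℕ)) (t : List (ℕ × ℕ)) :
    (recordSeq P t).map Prod.fst = t.map Prod.fst := by
  induction t generalizing P with
  | nil => rfl
  | cons ab t ih => simp [recordSeq, ih]

theorem length_recordSeq (P : List (List ℕ)) (t : List (ℕ × ℕ)) :
    (recordSeq P t).length = t.length := by
  simpa using congrArg List.length (map_fst_recordSeq P t)

theorem edelmanGreene_eq (t : List (ℕ × ℕ)) : edelmanGreene t = (insertWord [] t,
    (recordSeq [] t).foldl (fun Q aj => recordAt aj.1 aj.2 Q) []) := by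
  have key : ∀ (t : List (ℕ × ℕ)) (P Q : List (List ℕ)), t.foldl (fun PQ ab =>
      ((insertTableau ab.2 PQ.1).1, recordAt ab.1 (insertTableau ab.2 PQ.1).2 PQ.2)) (P, Q) =
      (insertWord P t, (recordSeq P t).foldl (fun Q aj => recordAt aj.1 aj.2 Q) Q) := by
    intro t
    induction t with
    | nil => intro P Q; rfl
    | cons ab t ih => intro P Q; simp [recordSeq, ih]
  exact key t [] []

/-- The insertion tableau of a reduced word has an equivalent reading word with the same letters, and
its shape is the one recorded. -/
theorem insertWord_spec {t : List (ℕ × ℕ)} (hr : IsReducedWord (t.map Prod.snd)) :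
    IsTab (insertWord [] t) ∧ WordEquiv (t.map Prod.snd) (readCols (insertWord [] t)) ∧
    (readCols (insertWord [] t)).length = t.length ∧
    (∀ v, v ∈ readCols (insertWord [] t) ↔ v ∈ t.map Prod.snd) ∧
    ∀ i, ((insertWord [] t).getD i []).length = ((recordSeq [] t).map Prod.snd).count i := by
  induction t using List.reverseRecOn with
  | nil => exact ⟨trivial, WordEquiv.refl _, rfl, by simp [readCols], by simp [recordSeq]⟩
  | append_singleton t ab ih =>
    rw [List.map_append] at hr
    obtain ⟨h1, h2, h3, h4, h5⟩ := ih hr.of_append_left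
    have h6 := h2.append (WordEquiv.refl [ab.2])
    have h7 : IsReducedWord (readCols (insertWord [] t) ++ [ab.2]) :=
      h6.reduced (by simp [h3]) hr
    obtain ⟨g1, g2, -, g4, -⟩ := insertTableau_spec h1 h7
    obtain ⟨g6, g7⟩ := insertTableau_reduced h1 h7
    rw [insertWord_append, insertWord_cons, insertWord_nil]
    refine ⟨g1, ?_, by simp [g7, h3], fun v => ?_, fun i => ?_⟩
    · rw [List.map_append]
      exact h6.trans g2
    · rw [mem_readCols_insertTableau h1 h7, h4]
      simp
    · rw [g4, h5, recordSeq_append, List.map_append, List.count_append]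
      simp only [recordSeq, List.map_cons, List.map_nil, List.count_singleton, beq_iff_eq]
      congr 1
      exact if_congr eq_comm rfl rfl

theorem reduced_readCols_insertWord {t t' : List (ℕ × ℕ)}
    (hr : IsReducedWord ((t ++ t').map Prod.snd)) :
    IsReducedWord (readCols (insertWord [] t) ++ t'.map Prod.snd) := by
  rw [List.map_append] at hr
  obtain ⟨-, h2, h3, -⟩ := insertWord_spec hr.of_append_left
  exact (h2.append (WordEquiv.refl _)).reduced (by simp [h3]) hr

theorem IsTab.getD_length_le {P : List (List ℕ)} (hP : IsTab P) (j : ℕ) :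
    (P.getD (j + 1) []).length ≤ (P.getD j []).length := by
  induction P generalizing j with
  | nil => simp
  | cons c cs ih =>
    obtain ⟨-, -, hdom, htab⟩ := hP
    rcases j with _ | j
    · have : cs.headD [] = cs.getD 0 [] := by cases cs <;> rfl
      rw [this] at hdom
      simpa using hdom.length_le
    · simpa using ih htab j

theorem IsTab.pairwise_getD {P : List (List ℕ)} (hP : IsTab P) (j : ℕ) :
    (P.getD j []).Pairwise (· < ·) := by
  induction P generalizing j with
  | nil => simp
  | cons c cs ih =>
    obtain ⟨-, hsort, -, htab⟩ := hP
    rcases j with _ | j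
    · simpa using hsort
    · simpa using ih htab j

/-- Every ballot sequence of columns that ends in the shape of a tableau with reduced reading word
is the sequence of columns of the insertion of a word. -/
theorem exists_insertWord (L : List (ℕ × ℕ)) {P : List (List ℕ)} (hP : IsTab P)
    (hr : IsReducedWord (readCols P))
    (hlen : ∀ i, (P.getD i []).length = (L.map Prod.snd).count i)
    (hL : ∀ L₁ L₂, L = L₁ ++ L₂ → ∀ j, (L₁.map Prod.snd).count (j + 1) ≤ (L₁.map Prod.snd).count j) :
    ∃ t, insertWord [] t = P ∧ recordSeq [] t = L ∧ WordEquiv (t.map Prod.snd) (readCols P) ∧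
      (readCols P).length = t.length := by
  induction L using List.reverseRecOn generalizing P with
  | nil =>
    have : P = [] := by
      rcases P with _ | ⟨c, cs⟩
      · rfl
      · have := hlen 0
        simp at this
        exact absurd this hP.1
    subst this
    exact ⟨[], rfl, rfl, WordEquiv.refl _, rfl⟩
  | append_singleton L aj ih =>
    obtain ⟨a, j⟩ := aj
    have hj : (P.getD (j + 1) []).length < (P.getD j []).length := by
      have := hL L [(a, j)] rfl j
      rw [hlen, hlen]
      simp
      omega
    obtain ⟨P₀, x, h1, h2, h3, h4, -⟩ := exists_insertTableau hP hr hj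
    have h5 : IsReducedWord (readCols P₀ ++ [x]) := h3.symm.reduced (by simp [h4]) hr
    have h6 := (insertTableau_spec h1 h5).2.2.2.1
    rw [h2] at h6
    obtain ⟨t, g1, g2, g3, g4⟩ := ih h1 h5.of_append_left (fun i => by
      have e1 := h6 i
      have e2 := hlen i
      simp only [List.map_append, List.count_append, List.map_cons, List.map_nil,
        List.count_singleton, beq_iff_eq] at e2
      dsimp only at e1
      split_ifs at e1 e2 <;> omega) (fun L₁ L₂ hL' => hL L₁ (L₂ ++ [(a, j)]) (by simp [hL']))
    refine ⟨t ++ [(a, x)], ?_, ?_, ?_, ?_⟩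
    · rw [insertWord_append, g1]; simp [h2]
    · rw [recordSeq_append, g1, g2]; simp [recordSeq, h2]
    · rw [List.map_append]
      exact (g3.append (WordEquiv.refl _)).trans h3
    · simp [h4, g4]

/-- A biword with reduced bottom word is determined by its insertion tableau and its recording
sequence. -/
theorem insertWord_injective {t t' : List (ℕ × ℕ)} (hr : IsReducedWord (t.map Prod.snd))
    (hr' : IsReducedWord (t'.map Prod.snd)) (h : insertWord [] t = insertWord [] t')
    (hrec : recordSeq [] t = recordSeq [] t') : t = t' := by
  induction t using List.reverseRecOn generalizing t' with
  | nil =>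
    have := congrArg List.length hrec
    rw [length_recordSeq, length_recordSeq] at this
    exact (List.length_eq_zero_iff.1 this.symm).symm
  | append_singleton t ab ih =>
    rcases List.eq_nil_or_concat t' with rfl | ⟨t', ab', rfl⟩
    · have := congrArg List.length hrec
      rw [length_recordSeq, length_recordSeq] at this
      simp at this
    rw [List.concat_eq_append] at *
    have h1 := reduced_readCols_insertWord hr
    have h2 := reduced_readCols_insertWord hr'
    rw [recordSeq_append, recordSeq_append] at hrec
    rw [insertWord_append, insertWord_append] at h
    rw [List.map_append] at hr hr'
    have h3 := List.append_inj' hrec rfl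
    have h4 := h3.2
    simp only [recordSeq, List.cons.injEq, Prod.mk.injEq, and_true] at h4
    obtain ⟨h5, h6⟩ := insertTableau_injective (insertWord_spec hr.of_append_left).1
      (insertWord_spec hr'.of_append_left).1 h1 h2 (Prod.ext (by simpa using h) h4.2)
    rw [ih hr.of_append_left hr'.of_append_left h5 h3.1, Prod.ext h4.1 h6]

/-- The order of the columns of a reading biword. -/
def BiwordLT (x y : ℕ × ℕ) : Prop := x.1 < y.1 ∨ x.1 = y.1 ∧ y.2 < x.2

/-- The order of the pairs in a recording sequence. -/
def RecordLT (x y : ℕ × ℕ) : Prop := x.1 < y.1 ∨ x.1 = y.1 ∧ x.2 < y.2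

/-- The top letters are weakly increasing in both orders; equal top letters come with decreasing
bottom letters if and only if their boxes are added from west to east. -/
theorem isChain_recordSeq_iff {P : List (List ℕ)} {t : List (ℕ × ℕ)} (hP : IsTab P)
    (hr : IsReducedWord (readCols P ++ t.map Prod.snd)) :
    (recordSeq P t).IsChain RecordLT ↔ t.IsChain BiwordLT := by
  induction t generalizing P with
  | nil => simp [recordSeq]
  | cons ab t ih =>
    have h1 : IsReducedWord (readCols P ++ [ab.2]) := by
      rw [List.map_cons, List.append_cons] at hr
      exact hr.of_append_left
    obtain ⟨g1, g2, -⟩ := insertTableau_spec hP h1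
    have h2 : IsReducedWord (readCols (insertTableau ab.2 P).1 ++ t.map Prod.snd) := by
      refine (g2.append (WordEquiv.refl (t.map Prod.snd))).reduced ?_ (by simpa using hr)
      simp [(insertTableau_reduced hP h1).2]
      omega
    have h3 := ih g1 h2
    rcases t with _ | ⟨ab', t⟩
    · simp [recordSeq]
    · have h4 : IsReducedWord (readCols P ++ [ab.2, ab'.2]) := by
        have := hr
        rw [List.map_cons, List.map_cons, show readCols P ++ ab.2 :: ab'.2 :: t.map Prod.snd =
          (readCols P ++ [ab.2, ab'.2]) ++ t.map Prod.snd by simp] at this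
        exact this.of_append_left
      have h5 := insertTableau_compare hP h4
      have h6 : ab.2 ≠ ab'.2 := by
        intro heq
        rw [heq] at h4
        exact not_reduced_of_lt (x := ab'.2) (A := readCols P) (B := []) (by simp) (by simpa using h4)
      rw [recordSeq] at h3
      rw [recordSeq, recordSeq]
      rw [List.isChain_cons_cons, h3, List.isChain_cons_cons]
      refine and_congr_left fun _ => ?_
      simp only [RecordLT, BiwordLT]
      refine or_congr_right (and_congr_right fun _ => ?_)
      rcases Nat.lt_or_gt_of_ne h6 with h | h
      · have := h5.2 h
        omega
      · have := h5.1 h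
        omega

/-- Entries of column `j` of the final tableau that are too small to be inserted later on. -/
theorem mem_of_mem_insertWord {P : List (List ℕ)} {t : List (ℕ × ℕ)} (hP : IsTab P)
    (hr : IsReducedWord (readCols P ++ t.map Prod.snd)) {a j v : ℕ} (ha : ∀ ab ∈ t, a ≤ ab.2)
    (hv : v < a + j) (h : v ∈ (insertWord P t).getD j []) : v ∈ P.getD j [] := by
  induction t generalizing P with
  | nil => exact h
  | cons ab t ih =>
    have h1 : IsReducedWord (readCols P ++ [ab.2]) := by
      rw [List.map_cons, List.append_cons] at hr
      exact hr.of_append_left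
    obtain ⟨g1, g2, -⟩ := insertTableau_spec hP h1
    have h2 : IsReducedWord (readCols (insertTableau ab.2 P).1 ++ t.map Prod.snd) := by
      refine (g2.append (WordEquiv.refl (t.map Prod.snd))).reduced ?_ (by simpa using hr)
      simp [(insertTableau_reduced hP h1).2]
      omega
    have h3 := ih g1 h2 (fun x hx => ha x (List.mem_cons_of_mem _ hx)) h
    have h4 := ha ab List.mem_cons_self
    exact mem_of_mem_insertTableau hP h1 (by omega) h3

theorem length_le_of_pairwise {c : List ℕ} (hc : c.Pairwise (· < ·)) {s m : ℕ}
    (h : ∀ v ∈ c, s ≤ v ∧ v < s + m) : c.length ≤ m := by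
  have h1 : c.Nodup := hc.imp fun h => h.ne
  have h2 : c ⊆ List.range' s m := fun v hv => List.mem_range'_1.2 (h v hv)
  simpa using (List.subperm_of_subset h1 h2).length_le

/-- The tableau of staircase shape `(m, …, 2, 1)` with entry `s + i + j` in row `i` and column `j`. -/
def stairTableau : ℕ → ℕ → List (List ℕ)
  | _, 0 => []
  | s, m + 1 => List.range' s (m + 1) :: stairTableau (s + 1) m

theorem getD_stairTableau (s m j : ℕ) :
    (stairTableau s m).getD j [] = List.range' (s + j) (m - j) := by
  induction m generalizing s j with
  | zero => simp [stairTableau]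
  | succ m ih =>
    rcases j with _ | j
    · simp [stairTableau]
    · simp only [stairTableau, List.getD_cons_succ, ih]
      congr 1 <;> omega

theorem IsTab.succ_le {c : List ℕ} {cs : List (List ℕ)} (hP : IsTab (c :: cs)) {s : ℕ}
    (h : ∀ v ∈ c, s ≤ v) : ∀ v ∈ readCols cs, s + 1 ≤ v := by
  induction cs generalizing c s with
  | nil => simp [readCols]
  | cons d cs ih =>
    obtain ⟨-, -, hdom, htab⟩ := hP
    have h1 : ∀ v ∈ d, s + 1 ≤ v := by
      intro v hv
      have e1 := hdom v
      have e2 : 0 < countLe d v := by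
        rw [countLe, List.countP_pos_iff]
        exact ⟨v, hv, by simp⟩
      have e3 : 0 < countLt c v := lt_of_lt_of_le e2 e1
      rw [countLt, List.countP_pos_iff] at e3
      obtain ⟨z, hz, hzv⟩ := e3
      have := h z hz
      simp at hzv
      omega
    intro v hv
    rw [readCols, List.mem_append] at hv
    rcases hv with hv | hv
    · have := ih htab h1 v hv; omega
    · exact h1 v hv

/-- A tableau with entries in `[s, s + m)` has at most `m * (m + 1) / 2` boxes, and there is only one
tableau with this number of boxes. -/
theorem IsTab.eq_stairTableau {P : List (List ℕ)} (hP : IsTab P) {s m : ℕ}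
    (h : ∀ v ∈ readCols P, s ≤ v ∧ v < s + m) : (readCols P).length ≤ m * (m + 1) / 2 ∧
      ((readCols P).length = m * (m + 1) / 2 → P = stairTableau s m) := by
  induction m generalizing s P with
  | zero =>
    have h0 : readCols P = [] := by
      rw [List.eq_nil_iff_forall_not_mem]
      intro v hv
      have := h v hv
      omega
    rcases P with _ | ⟨c, cs⟩
    · simp [readCols, stairTableau]
    · rw [readCols, List.append_eq_nil_iff] at h0
      exact absurd h0.2 hP.1
  | succ m ih =>
    have htri : (m + 1) * (m + 1 + 1) / 2 = m * (m + 1) / 2 + (m + 1) := by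
      rw [show (m + 1) * (m + 1 + 1) = m * (m + 1) + (m + 1) * 2 by ring,
        Nat.add_mul_div_right _ _ (by norm_num)]
    rw [htri]
    rcases P with _ | ⟨c, cs⟩
    · simp [readCols]
    have hc : ∀ v ∈ c, s ≤ v ∧ v < s + (m + 1) := fun v hv => h v (by simp [readCols, hv])
    have h1 := hP.succ_le fun v hv => (hc v hv).1
    obtain ⟨hne, hsort, hdom, htab⟩ := hP
    have h2 := length_le_of_pairwise hsort hc
    obtain ⟨h3, h4⟩ := ih htab (s := s + 1) fun v hv => by
      have := h1 v hv
      have := h v (by simp [readCols, hv])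
      omega
    rw [readCols, List.length_append]
    refine ⟨by omega, fun heq => ?_⟩
    rw [stairTableau, h4 (by omega)]
    congr 1
    have h5 : c.Nodup := hsort.imp fun h => h.ne
    have h6 : c ⊆ List.range' s (m + 1) := fun v hv => List.mem_range'_1.2 (hc v hv)
    have h7 := (List.subperm_of_subset h5 h6).perm_of_length_le (by simp; omega)
    exact h7.eq_of_pairwise (fun a b _ _ hab hba => absurd (hab.trans hba) (lt_irrefl _)) hsort
      List.pairwise_lt_range'

/-! ### Recording sequences and flagged tableaux -/

/-- The entries of column `j` of the recording tableau. -/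
def recCol (L : List (ℕ × ℕ)) (j : ℕ) : List ℕ :=
  (L.filter fun x => decide (x.2 = j)).map Prod.fst

theorem recCol_append (L L' : List (ℕ × ℕ)) (j : ℕ) :
    recCol (L ++ L') j = recCol L j ++ recCol L' j := by
  simp [recCol]

theorem recCol_cons (x : ℕ × ℕ) (L : List (ℕ × ℕ)) (j : ℕ) :
    recCol (x :: L) j = if x.2 = j then x.1 :: recCol L j else recCol L j := by
  simp only [recCol, List.filter_cons, decide_eq_true_eq]
  split_ifs <;> simp

theorem length_recCol (L : List (ℕ × ℕ)) (j : ℕ) :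
    (recCol L j).length = (L.map Prod.snd).count j := by
  induction L with
  | nil => rfl
  | cons x L ih =>
    rw [recCol_cons, List.map_cons, List.count_cons]
    split_ifs with h1 h2 h2 <;> simp_all

theorem mem_recCol {L : List (ℕ × ℕ)} {a j : ℕ} : a ∈ recCol L j ↔ (a, j) ∈ L := by
  simp [recCol]

theorem getD_recordAt (a j : ℕ) (Q : List (List ℕ)) (i : ℕ) :
    (recordAt a j Q).getD i [] = Q.getD i [] ++ if i = j then [a] else [] := by
  induction j generalizing Q i with
  | zero =>
    rcases Q with _ | ⟨c, cs⟩ <;> rcases i with _ | i <;> simp [recordAt]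
  | succ j ih =>
    rcases Q with _ | ⟨c, cs⟩ <;> rcases i with _ | i <;>
      simp only [recordAt, List.getD_cons_zero, List.getD_cons_succ, List.getD_nil, ih] <;> simp

theorem getD_flaggedTableau (lam : YoungDiagram) (S : Finset (ℕ × ℕ)) (j : ℕ) :
    (flaggedTableau lam S).getD j [] =
      recCol (recordSeq [] (readingBiword lam (pipeDream lam S))) j := by
  rw [flaggedTableau, edelmanGreene_eq]
  have key : ∀ (L : List (ℕ × ℕ)) (Q : List (List ℕ)),
      (L.foldl (fun Q aj => recordAt aj.1 aj.2 Q) Q).getD j [] = Q.getD j [] ++ recCol L j := by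
    intro L
    induction L with
    | nil => simp [recCol]
    | cons x L ih =>
      intro Q
      rw [List.foldl_cons, ih, getD_recordAt, recCol_cons, List.append_assoc]
      congr 1
      by_cases hx : x.2 = j
      · rw [if_pos hx, if_pos hx.symm]
        rfl
      · rw [if_neg hx, if_neg (Ne.symm hx)]
        rfl
  rw [key]
  simp

theorem exists_split_of_recCol {L : List (ℕ × ℕ)} {i j a : ℕ} (h : (recCol L j)[i]? = some a) :
    ∃ L₁ L₂, L = L₁ ++ (a, j) :: L₂ ∧ (L₁.map Prod.snd).count j = i := by
  induction L generalizing i with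
  | nil => simp [recCol] at h
  | cons x L ih =>
    rw [recCol_cons] at h
    split_ifs at h with hx
    · rcases i with _ | i
      · simp at h
        exact ⟨[], L, by rw [← h, ← hx]; rfl, rfl⟩
      · obtain ⟨L₁, L₂, rfl, h2⟩ := ih (by simpa using h)
        exact ⟨x :: L₁, L₂, rfl, by simp [hx, h2]⟩
    · obtain ⟨L₁, L₂, rfl, h2⟩ := ih h
      exact ⟨x :: L₁, L₂, rfl, by simp [hx, h2]⟩

/-- The recording sequences of `k`-flagged tableaux of staircase shape `(h, …, 2, 1)`. -/
structure IsRecording (h k : ℕ) (L : List (ℕ × ℕ)) : Prop where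
  sorted : L.Pairwise RecordLT
  pos : ∀ x ∈ L, 1 ≤ x.1
  count : ∀ j, (L.map Prod.snd).count j = h - j
  ballot : ∀ L₁ L₂, L = L₁ ++ L₂ → ∀ j,
    (L₁.map Prod.snd).count (j + 1) ≤ (L₁.map Prod.snd).count j
  flag : ∀ L₁ a j L₂, L = L₁ ++ (a, j) :: L₂ → a ≤ k + 1 + (L₁.map Prod.snd).count j

/-- The `k`-flagged tableaux of staircase shape `(h, …, 2, 1)`: with row indices `i` that start with
`1`, the entries of row `i` lie between `i` and `i + k`. -/
structure IsFlagged (h k : ℕ) (E : ℕ → ℕ → ℕ) : Prop where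
  lower : ∀ i j, i + j < h → i + 1 ≤ E i j
  upper : ∀ i j, i + j < h → E i j ≤ k + 1 + i
  row : ∀ i j, i + (j + 1) < h → E i j ≤ E i (j + 1)
  col : ∀ i j, (i + 1) + j < h → E i j < E (i + 1) j

theorem pairwise_recCol {L : List (ℕ × ℕ)} (h : L.Pairwise RecordLT) (j : ℕ) :
    (recCol L j).Pairwise (· < ·) := by
  rw [recCol, List.pairwise_map]
  refine (h.filter _).imp_of_mem fun {x y} hx hy hxy => ?_
  rw [List.mem_filter] at hx hy
  have h1 : x.2 = j := by simpa using hx.2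
  have h2 : y.2 = j := by simpa using hy.2
  rcases hxy with hxy | hxy <;> omega

theorem getElem?_eq_getD {l : List ℕ} {i : ℕ} (h : i < l.length) : l[i]? = some (l.getD i 0) := by
  rw [List.getD_eq_getElem?_getD, List.getElem?_eq_getElem h]
  rfl

theorem IsRecording.length_recCol {h k : ℕ} {L : List (ℕ × ℕ)} (hL : IsRecording h k L) (j : ℕ) :
    (recCol L j).length = h - j := by
  rw [MaximalFillings.length_recCol, hL.count]

theorem IsRecording.isFlagged {h k : ℕ} {L : List (ℕ × ℕ)} (hL : IsRecording h k L) :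
    IsFlagged h k fun i j => (recCol L j).getD i 0 := by
  have hget : ∀ i j, i + j < h → (recCol L j)[i]? = some ((recCol L j).getD i 0) := fun i j hij =>
    getElem?_eq_getD (by rw [hL.length_recCol]; omega)
  have hcol : ∀ i j, (i + 1) + j < h → (recCol L j).getD i 0 < (recCol L j).getD (i + 1) 0 := by
    intro i j hij
    have h1 := List.pairwise_iff_getElem.1 (pairwise_recCol hL.sorted j) i (i + 1)
      (by rw [hL.length_recCol]; omega) (by rw [hL.length_recCol]; omega) (Nat.lt_succ_self i)
    rwa [List.getD_eq_getElem, List.getD_eq_getElem]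
  refine ⟨fun i j hij => ?_, fun i j hij => ?_, fun i j hij => ?_, hcol⟩
  · induction i with
    | zero => exact hL.pos _ (mem_recCol.1 (List.mem_of_getElem? (hget 0 j hij)))
    | succ i ih =>
      have h1 := ih (by omega)
      have h2 := hcol i j hij
      omega
  · obtain ⟨L₁, L₂, h1, h2⟩ := exists_split_of_recCol (hget i j hij)
    have := hL.flag _ _ _ _ h1
    omega
  · obtain ⟨L₁, L₂, h1, h2⟩ := exists_split_of_recCol (hget i (j + 1) hij)
    have h3 := hL.ballot (L₁ ++ [((recCol L (j + 1)).getD i 0, j + 1)]) L₂ (h1.trans (by simp)) j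
    simp only [List.map_append, List.map_cons, List.map_nil, List.count_append, h2,
      List.count_singleton, beq_self_eq_true, if_true, beq_iff_eq] at h3
    rw [if_neg (by omega), add_zero] at h3
    have h4 : i < (recCol L₁ j).length := by rw [MaximalFillings.length_recCol]; omega
    have h5 : (recCol L j)[i]? = (recCol L₁ j)[i]? := by
      rw [h1, recCol_append, List.getElem?_append_left h4]
    rw [hget i j (by omega)] at h5
    have h6 := mem_recCol.1 (List.mem_of_getElem? h5.symm)
    have h7 := hL.sorted
    rw [h1, List.pairwise_append] at h7
    have h8 := h7.2.2 _ h6 _ List.mem_cons_self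
    simp only [RecordLT] at h8
    omega

theorem IsRecording.mem_iff {h k : ℕ} {L : List (ℕ × ℕ)} (hL : IsRecording h k L) {a j : ℕ} :
    (a, j) ∈ L ↔ ∃ i, i + j < h ∧ (recCol L j).getD i 0 = a := by
  rw [← mem_recCol, List.mem_iff_getElem]
  constructor
  · rintro ⟨i, hi, rfl⟩
    refine ⟨i, ?_, List.getD_eq_getElem _ _ hi⟩
    rw [hL.length_recCol] at hi
    omega
  · rintro ⟨i, hi, rfl⟩
    have hi' : i < (recCol L j).length := by rw [hL.length_recCol]; omega
    exact ⟨i, hi', (List.getD_eq_getElem _ _ hi').symm⟩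

instance : Std.Irrefl RecordLT := ⟨fun x h => by simp [RecordLT] at h⟩

instance : Std.Antisymm RecordLT := ⟨fun x y h h' => by
  unfold RecordLT at h h'
  omega⟩

instance : Trans RecordLT RecordLT RecordLT := ⟨fun {x y z} h h' => by
  unfold RecordLT at *
  omega⟩

instance : Trans BiwordLT BiwordLT BiwordLT := ⟨fun {x y z} h h' => by
  unfold BiwordLT at *
  omega⟩

instance : Std.Irrefl ReadBefore := ⟨fun x h => by simp [ReadBefore] at h⟩

instance : Std.Antisymm ReadBefore := ⟨fun x y h h' => by
  unfold ReadBefore at h h'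
  omega⟩

theorem IsRecording.eq_of_entries {h k : ℕ} {L L' : List (ℕ × ℕ)} (hL : IsRecording h k L)
    (hL' : IsRecording h k L')
    (heq : ∀ i j, i + j < h → (recCol L j).getD i 0 = (recCol L' j).getD i 0) : L = L' := by
  refine hL.sorted.eq_of_mem_iff hL'.sorted ?_
  rintro ⟨a, j⟩
  rw [hL.mem_iff, hL'.mem_iff]
  exact exists_congr fun i => and_congr_right fun hij => by rw [heq i j hij]

theorem IsFlagged.col_strict {h k : ℕ} {E : ℕ → ℕ → ℕ} (hE : IsFlagged h k E) {i i' j : ℕ}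
    (hi : i < i') (hij : i' + j < h) : E i j < E i' j := by
  induction i', hi using Nat.le_induction with
  | base => exact hE.col i j hij
  | succ i' _ ih => exact (ih (by omega)).trans (hE.col i' j hij)

/-- Every flagged tableau has a recording sequence: its boxes sorted by entries and columns. -/
theorem IsFlagged.exists_recording {h k : ℕ} {E : ℕ → ℕ → ℕ} (hE : IsFlagged h k E) :
    ∃ L, IsRecording h k L ∧ ∀ i j, i + j < h → (recCol L j).getD i 0 = E i j := by
  classical
  set L := (List.range (h + k + 1)).flatMap fun a => ((List.range h).filter fun j =>
    decide (∃ i, i + j < h ∧ E i j = a)).map fun j => (a, j) with hLdef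
  have hmem : ∀ a j, (a, j) ∈ L ↔ ∃ i, i + j < h ∧ E i j = a := by
    intro a j
    simp only [hLdef, List.mem_flatMap, List.mem_range, List.mem_map, List.mem_filter,
      decide_eq_true_eq, Prod.mk.injEq]
    constructor
    · rintro ⟨_, -, _, ⟨-, h1⟩, rfl, rfl⟩
      exact h1
    · rintro ⟨i, h1, rfl⟩
      have := hE.upper i j h1
      exact ⟨E i j, by omega, j, ⟨by omega, i, h1, rfl⟩, rfl, rfl⟩
  have hsorted : L.Pairwise RecordLT := by
    rw [hLdef, List.pairwise_flatMap]
    constructor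
    · intro a _
      rw [List.pairwise_map]
      exact (List.pairwise_lt_range.filter _).imp fun hlt => Or.inr ⟨rfl, hlt⟩
    · refine List.pairwise_lt_range.imp fun {a a'} hlt x hx y hy => ?_
      simp only [List.mem_map] at hx hy
      obtain ⟨_, _, rfl⟩ := hx
      obtain ⟨_, _, rfl⟩ := hy
      exact Or.inl hlt
  have hcol : ∀ j, recCol L j = (List.range (h - j)).map fun i => E i j := by
    intro j
    refine List.Pairwise.eq_of_mem_iff (r := (· < ·)) (pairwise_recCol hsorted j) ?_ ?_
    · rw [List.pairwise_map]
      refine List.pairwise_lt_range.imp_of_mem fun {i i'} _ hi' hlt => ?_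
      rw [List.mem_range] at hi'
      exact hE.col_strict hlt (by omega)
    · intro a
      rw [mem_recCol, hmem, List.mem_map]
      refine exists_congr fun i => and_congr_left fun _ => ?_
      rw [List.mem_range]
      omega
  have hget : ∀ i j a, (recCol L j)[i]? = some a → i + j < h ∧ a = E i j := by
    intro i j a hi
    rw [hcol, List.getElem?_map, Option.map_eq_some_iff] at hi
    obtain ⟨i', h1, rfl⟩ := hi
    rw [List.getElem?_eq_some_iff] at h1
    obtain ⟨h2, h3⟩ := h1
    rw [List.length_range] at h2
    rw [List.getElem_range] at h3
    subst h3
    exact ⟨by omega, rfl⟩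
  refine ⟨L, ⟨hsorted, ?_, ?_, ?_, ?_⟩, fun i j hij => ?_⟩
  · rintro ⟨a, j⟩ hx
    obtain ⟨i, h1, rfl⟩ := (hmem a j).1 hx
    have := hE.lower i j h1
    dsimp only
    omega
  · intro j
    rw [← length_recCol, hcol]
    simp
  · intro L₁ L₂ hL j
    rw [← length_recCol, ← length_recCol]
    by_contra hlt
    rw [not_le] at hlt
    -- the box of column `j + 1` in the first row that column `j` has not reached yet
    obtain ⟨a', ha'⟩ : ∃ a', (recCol L₁ (j + 1))[(recCol L₁ j).length]? = some a' :=
      ⟨_, List.getElem?_eq_getElem hlt⟩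
    have h1 : (recCol L (j + 1))[(recCol L₁ j).length]? = some a' := by
      rw [hL, recCol_append, List.getElem?_append_left hlt, ha']
    obtain ⟨h2, rfl⟩ := hget _ _ _ h1
    have h3 := hE.row _ j h2
    have h4 : (E (recCol L₁ j).length j, j) ∈ L := (hmem _ _).2 ⟨_, by omega, rfl⟩
    rw [hL, List.mem_append] at h4
    rcases h4 with h4 | h4
    · obtain ⟨i', h5, h6⟩ := List.mem_iff_getElem.1 (mem_recCol.2 h4)
      have h7 : (recCol L j)[i']? = some (E (recCol L₁ j).length j) := by
        rw [hL, recCol_append, List.getElem?_append_left h5, List.getElem?_eq_getElem h5, h6]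
      have h8 := (hget _ _ _ h7).2
      have h9 := hE.col_strict h5 (show (recCol L₁ j).length + j < h by omega)
      omega
    · rw [hL, List.pairwise_append] at hsorted
      have h5 := hsorted.2.2 _ (mem_recCol.1 (List.mem_of_getElem? ha')) _ h4
      simp only [RecordLT] at h5
      omega
  · intro L₁ a j L₂ hL
    have h1 : (recCol L j)[(recCol L₁ j).length]? = some a := by
      rw [hL, recCol_append, recCol_cons, if_pos rfl]
      simp
    obtain ⟨h2, rfl⟩ := hget _ _ _ h1
    rw [← length_recCol]
    exact hE.upper _ _ h2
  · rw [hcol, List.getD_eq_getElem _ _ (by simp; omega)]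
    simp

theorem IsFlagged.isRPP {h k : ℕ} {E : ℕ → ℕ → ℕ} (hE : IsFlagged h k E) :
    IsRPP h k fun i j => E i j - (i + 1) := by
  refine ⟨fun i j hij => ?_, fun i j hij => ?_, fun i j hij => ?_⟩
  · have := hE.upper i j hij; omega
  · have := hE.row i j hij; omega
  · have := hE.col i j hij; omega

theorem IsRPP.isFlagged {h k : ℕ} {R : ℕ → ℕ → ℕ} (hR : IsRPP h k R) :
    IsFlagged h k fun i j => R i j + (i + 1) := by
  refine ⟨fun i j _ => by omega, fun i j hij => ?_, fun i j hij => ?_,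
    fun i j hij => ?_⟩
  · have := hR.le i j hij; omega
  · have := hR.row i j hij; omega
  · have := hR.col i j hij; omega

/-! ### Fillings of the staircase and flagged tableaux -/

/-- The reading biword of the pipe dream of a filling of the staircase. -/
def fillingBiword (n : ℕ) (S : Finset (ℕ × ℕ)) : List (ℕ × ℕ) :=
  readingBiword (staircase n) (pipeDream (staircase n) S)

theorem fillingBiword_spec {n k : ℕ} (hkn : 2 * k < n) {S : Finset (ℕ × ℕ)}
    (hS : S ∈ neFillings (staircase n) k) :
    heckeAct ((fillingBiword n S).map Prod.snd) id = reversal n k ∧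
      (fillingBiword n S).length = (n - 2 * k) * (n - 2 * k - 1) / 2 ∧
      ∀ b ∈ (fillingBiword n S).map Prod.snd, k < b ∧ b + k < n := by
  have h1 := maximal_of_mem_neFillings hS
  have h2 := reversal_of_maximal hkn h1
  rw [fillingBiword, map_snd_readingBiword]
  refine ⟨h2.1, ?_, letters_of_maximal h1⟩
  rw [← h2.2, ← length_boxWord (pipeDream_subset _ _), ← map_snd_readingBiword, List.length_map]

theorem pairwise_fillingBiword (n : ℕ) (S : Finset (ℕ × ℕ)) :
    (fillingBiword n S).Pairwise BiwordLT := by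
  rw [fillingBiword, readingBiword_eq, List.pairwise_map]
  refine (pairwise_boxList n _).imp fun {x y} h => ?_
  unfold ReadBefore at h
  unfold BiwordLT
  dsimp only
  omega

theorem top_le_bottom_fillingBiword {n : ℕ} {S : Finset (ℕ × ℕ)} {ab : ℕ × ℕ}
    (h : ab ∈ fillingBiword n S) : 1 ≤ ab.1 ∧ ab.1 ≤ ab.2 := by
  rw [fillingBiword, readingBiword_eq, List.mem_map] at h
  obtain ⟨x, -, rfl⟩ := h
  dsimp only
  omega

/-- All the maximal fillings of the staircase have the same insertion tableau. -/
theorem insertWord_fillingBiword {n k : ℕ} (hkn : 2 * k < n) {S : Finset (ℕ × ℕ)}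
    (hS : S ∈ neFillings (staircase n) k) :
    IsReducedWord ((fillingBiword n S).map Prod.snd) ∧
      insertWord [] (fillingBiword n S) = stairTableau (k + 1) (n - 2 * k - 1) := by
  obtain ⟨h1, h2, h3⟩ := fillingBiword_spec hkn hS
  have hr := reduced_of_heckeAct hkn h1 (by rw [List.length_map, h2])
  obtain ⟨h4, -, h5, h6, -⟩ := insertWord_spec hr
  refine ⟨hr, (h4.eq_stairTableau fun v hv => ?_).2 ?_⟩
  · have := h3 v ((h6 v).1 hv)
    omega
  · rw [h5, h2, mul_comm]
    congr 2
    omega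

theorem exists_split_of_recordSeq {t L₁ L₂ : List (ℕ × ℕ)} (h : recordSeq [] t = L₁ ++ L₂) :
    ∃ t₁ t₂, t = t₁ ++ t₂ ∧ recordSeq [] t₁ = L₁ ∧ recordSeq (insertWord [] t₁) t₂ = L₂ := by
  refine ⟨t.take L₁.length, t.drop L₁.length, (List.take_append_drop _ _).symm, ?_⟩
  have h1 := recordSeq_append [] (t.take L₁.length) (t.drop L₁.length)
  rw [List.take_append_drop, h] at h1
  have h2 := congrArg List.length h
  rw [length_recordSeq, List.length_append] at h2
  obtain ⟨h3, h4⟩ := List.append_inj h1 (by rw [length_recordSeq, List.length_take]; omega)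
  exact ⟨h3.symm, h4.symm⟩

/-- The recording tableau of a maximal filling is flagged. If an entry `a` in row `r` violated the
flag condition, then the letters inserted from this point on would be at least `a`, which is too
large to affect the upper part of the column of this entry. -/
theorem isRecording_fillingBiword {n k : ℕ} (hkn : 2 * k < n) {S : Finset (ℕ × ℕ)}
    (hS : S ∈ neFillings (staircase n) k) :
    IsRecording (n - 2 * k - 1) k (recordSeq [] (fillingBiword n S)) := by
  obtain ⟨hr, hP⟩ := insertWord_fillingBiword hkn hS
  have hpair := pairwise_fillingBiword n S
  have hcount : ∀ j, ((recordSeq [] (fillingBiword n S)).map Prod.snd).count j =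
      n - 2 * k - 1 - j := by
    intro j
    rw [← (insertWord_spec hr).2.2.2.2 j, hP, getD_stairTableau, List.length_range']
  refine ⟨((isChain_recordSeq_iff (P := []) trivial hr).2 hpair.isChain).pairwise, ?_, hcount,
    ?_, ?_⟩
  · intro x hx
    have h1 := List.mem_map_of_mem (f := Prod.fst) hx
    rw [map_fst_recordSeq, List.mem_map] at h1
    obtain ⟨ab, h2, h3⟩ := h1
    exact h3 ▸ (top_le_bottom_fillingBiword h2).1
  · intro L₁ L₂ hL j
    obtain ⟨t₁, t₂, ht, rfl, -⟩ := exists_split_of_recordSeq hL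
    rw [ht, List.map_append] at hr
    have h1 := insertWord_spec hr.of_append_left
    rw [← h1.2.2.2.2, ← h1.2.2.2.2]
    exact h1.1.getD_length_le j
  · intro L₁ a j L₂ hL
    obtain ⟨t₁, t₂, ht, rfl, h2⟩ := exists_split_of_recordSeq hL
    by_contra hlt
    rw [not_le] at hlt
    have hr₁ := hr
    rw [ht, List.map_append] at hr₁
    obtain ⟨htab, -, -, -, hlen⟩ := insertWord_spec hr₁.of_append_left
    have hlow : ∀ ab ∈ t₂, a ≤ ab.2 := by
      have h3 := congrArg (List.map Prod.fst) h2
      rw [map_fst_recordSeq] at h3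
      obtain _ | ⟨ab', t₃⟩ := t₂
      · simp at h3
      simp only [List.map_cons, List.cons.injEq] at h3
      rw [ht, List.pairwise_append] at hpair
      intro ab hab
      have h4 : a ≤ ab.1 := by
        rw [← h3.1]
        rcases List.mem_cons.1 hab with rfl | hab
        · rfl
        · have := List.rel_of_pairwise_cons hpair.2.1 hab
          unfold BiwordLT at this
          omega
      exact h4.trans (top_le_bottom_fillingBiword (ht ▸ List.mem_append_right _ hab)).2
    have hpos : ((recordSeq [] t₁).map Prod.snd).count j < n - 2 * k - 1 - j := by
      rw [← hcount j, hL]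
      simp
    have hsub : List.range' (k + 1 + j) (((recordSeq [] t₁).map Prod.snd).count j + 1) ⊆
        (insertWord [] t₁).getD j [] := by
      intro v hv
      rw [List.mem_range'_1] at hv
      refine mem_of_mem_insertWord htab (reduced_readCols_insertWord (ht ▸ hr)) hlow (by omega) ?_
      rw [← insertWord_append, ← ht, hP, getD_stairTableau, List.mem_range'_1]
      omega
    have h3 := (List.subperm_of_subset List.nodup_range' hsub).length_le
    rw [List.length_range', hlen] at h3
    omega

theorem eq_of_recordSeq_eq {n k : ℕ} (hkn : 2 * k < n) {S S' : Finset (ℕ × ℕ)}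
    (hS : S ∈ neFillings (staircase n) k) (hS' : S' ∈ neFillings (staircase n) k)
    (h : recordSeq [] (fillingBiword n S) = recordSeq [] (fillingBiword n S')) : S = S' := by
  obtain ⟨hr, hP⟩ := insertWord_fillingBiword hkn hS
  obtain ⟨hr', hP'⟩ := insertWord_fillingBiword hkn hS'
  have h1 := insertWord_injective hr hr' (hP.trans hP'.symm) h
  rw [fillingBiword, fillingBiword, readingBiword_eq, readingBiword_eq] at h1
  have h2 : boxList n (pipeDream (staircase n) S) = boxList n (pipeDream (staircase n) S') := by
    refine List.map_injective_iff.2 (fun x y hxy => ?_) h1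
    rw [Prod.mk.injEq] at hxy
    exact Prod.ext (by omega) (by omega)
  have h3 : pipeDream (staircase n) S = pipeDream (staircase n) S' := by
    ext x
    rw [← mem_boxList (pipeDream_subset _ _), h2, mem_boxList (pipeDream_subset _ _)]
  rw [← Finset.sdiff_sdiff_eq_self hS.1.1, ← Finset.sdiff_sdiff_eq_self hS'.1.1]
  exact congrArg ((staircase n).cells \ ·) h3

/-- A biword that satisfies the order conditions of a reading biword is the reading biword of a
set of boxes. -/
theorem exists_boxes_of_biword {n : ℕ} {t : List (ℕ × ℕ)} (hp : t.Pairwise BiwordLT)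
    (h : ∀ ab ∈ t, 1 ≤ ab.1 ∧ ab.1 ≤ ab.2 ∧ ab.2 < n) :
    ∃ D ⊆ (staircase n).cells, readingBiword (staircase n) D = t := by
  set l := t.map fun ab => (ab.1 - 1, ab.2 - ab.1) with hl
  have hD : l.toFinset ⊆ (staircase n).cells := by
    intro x hx
    rw [List.mem_toFinset, hl, List.mem_map] at hx
    obtain ⟨ab, h1, rfl⟩ := hx
    have := h ab h1
    rw [YoungDiagram.mem_cells, mem_staircase]
    dsimp only
    omega
  refine ⟨l.toFinset, hD, ?_⟩
  have hlp : l.Pairwise ReadBefore := by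
    rw [hl, List.pairwise_map]
    refine hp.imp_of_mem fun {x y} hx hy hxy => ?_
    have h1 := h x hx
    have h2 := h y hy
    unfold BiwordLT at hxy
    unfold ReadBefore
    dsimp only
    omega
  have hbox : boxList n l.toFinset = l :=
    (pairwise_boxList n _).eq_of_mem_iff hlp fun x => by rw [mem_boxList hD, List.mem_toFinset]
  rw [readingBiword_eq, hbox, hl, List.map_map]
  refine (List.map_congr_left fun ab hab => ?_).trans (List.map_id t)
  have := h ab hab
  exact Prod.ext (by simp; omega) (by simp; omega)

/-- Every flagged tableau is the recording tableau of a maximal filling. -/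
theorem exists_filling_of_isRecording {n k : ℕ} (hkn : 2 * k < n) {L : List (ℕ × ℕ)}
    (hL : IsRecording (n - 2 * k - 1) k L) :
    ∃ S ∈ neFillings (staircase n) k, recordSeq [] (fillingBiword n S) = L := by
  obtain ⟨S₀, hS₀⟩ := neFillings_nonempty hkn
  obtain ⟨hr₀, hP₀⟩ := insertWord_fillingBiword hkn hS₀
  obtain ⟨hact₀, hlen₀, hlet₀⟩ := fillingBiword_spec hkn hS₀
  obtain ⟨htab, hequiv₀, hl₀, hmem₀, -⟩ := insertWord_spec hr₀
  rw [hP₀] at htab hequiv₀ hl₀ hmem₀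
  obtain ⟨t, hP, rfl, hequiv, hl⟩ := exists_insertWord L htab
    (hequiv₀.reduced (by rw [hl₀, List.length_map]) hr₀)
    (fun j => by rw [getD_stairTableau, List.length_range', hL.count]) hL.ballot
  have hact : heckeAct (t.map Prod.snd) id = reversal n k := by
    rw [hequiv id, ← hequiv₀ id, hact₀]
  have hlen : t.length = (n - 2 * k) * (n - 2 * k - 1) / 2 := by rw [← hl, hl₀, hlen₀]
  have hr := reduced_of_heckeAct hkn hact (by rw [List.length_map, hlen])
  have hlet : ∀ b ∈ t.map Prod.snd, k < b ∧ b + k < n := by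
    intro b hb
    rw [← (insertWord_spec hr).2.2.2.1, hP] at hb
    exact hlet₀ b ((hmem₀ b).1 hb)
  have htop : ∀ ab ∈ t, 1 ≤ ab.1 ∧ ab.1 ≤ ab.2 ∧ ab.2 < n := by
    rintro ⟨a, x⟩ hax
    have hx := hlet x (List.mem_map_of_mem (f := Prod.snd) hax)
    refine ⟨?_, ?_, by dsimp only; omega⟩
    · have h1 := List.mem_map_of_mem (f := Prod.fst) hax
      rw [← map_fst_recordSeq [], List.mem_map] at h1
      obtain ⟨y, h2, h3⟩ := h1
      exact h3 ▸ hL.pos y h2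
    · -- the new box is in row `r` of its column, and the first column contains `r` entries that
      -- are at least `k + 1` and at most `x`
      obtain ⟨t₁, t₂, rfl⟩ := List.append_of_mem hax
      have hr₁ : IsReducedWord ((t₁ ++ [(a, x)]).map Prod.snd) := by
        rw [List.append_cons, List.map_append] at hr
        exact hr.of_append_left
      have hr₂ := hr₁
      rw [List.map_append] at hr₂
      obtain ⟨htab₁, -, -, -, hlen₁⟩ := insertWord_spec hr₂.of_append_left
      obtain ⟨htab₂, -, -, hmem₂, -⟩ := insertWord_spec hr₁
      obtain ⟨-, -, -, h1, h2⟩ := insertTableau_spec htab₁ (reduced_readCols_insertWord hr₁)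
      rw [show ((insertTableau x (insertWord [] t₁)).1) = insertWord [] (t₁ ++ [(a, x)]) by
        rw [insertWord_append]; rfl] at h1 h2
      rw [h1, if_pos rfl, hlen₁] at h2
      have h3 := hL.flag (recordSeq [] t₁) a _ _ (by rw [recordSeq_append]; rfl)
      have h4 : countLe ((insertWord [] (t₁ ++ [(a, x)])).headD []) x ≤ x - k := by
        rw [countLe, List.countP_eq_length_filter]
        have h5 : (insertWord [] (t₁ ++ [(a, x)])).headD [] =
            (insertWord [] (t₁ ++ [(a, x)])).getD 0 [] := by
          cases insertWord [] (t₁ ++ [(a, x)]) <;> rfl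
        refine length_le_of_pairwise (s := k + 1) (List.Pairwise.filter _ ?_) fun v hv => ?_
        · rw [h5]
          exact htab₂.pairwise_getD 0
        · rw [List.mem_filter, decide_eq_true_eq] at hv
          have h6 : v ∈ readCols (insertWord [] (t₁ ++ [(a, x)])) := by
            generalize insertWord [] (t₁ ++ [(a, x)]) = P at hv
            cases P with
            | nil => simp at hv
            | cons c cs => exact List.mem_append_right _ hv.1
          rw [hmem₂] at h6
          have h7 := hlet v (by
            rw [List.append_cons, List.map_append]
            exact List.mem_append_left _ h6)
          omega
      dsimp only at hx h2 h3 h4 ⊢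
      omega
  have hchain := ((isChain_recordSeq_iff (P := []) trivial hr).1 hL.sorted.isChain).pairwise
  obtain ⟨D, hD, rfl⟩ := exists_boxes_of_biword hchain htop
  have hpipe : pipeDream (staircase n) ((staircase n).cells \ D) = D :=
    Finset.sdiff_sdiff_eq_self hD
  refine ⟨(staircase n).cells \ D, mem_neFillings_of_reversal hkn Finset.sdiff_subset ?_ ?_, ?_⟩
  · rw [hpipe, ← map_snd_readingBiword, hact]
  · rw [hpipe, ← length_boxWord hD, ← map_snd_readingBiword, List.length_map, hlen]
  · rw [fillingBiword, hpipe]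

/-! ### The bijection from triangulations to fans -/

theorem reversePlanePartition_eq (n : ℕ) (S : Finset (ℕ × ℕ)) :
    reversePlanePartition (staircase n) S = fun i j =>
      (recCol (recordSeq [] (fillingBiword n S)) j).getD i 0 - (i + 1) := by
  funext i j
  rw [reversePlanePartition, getD_flaggedTableau, fillingBiword]

theorem isRPP_reversePlanePartition {n k : ℕ} (hkn : 2 * k < n) {S : Finset (ℕ × ℕ)}
    (hS : S ∈ neFillings (staircase n) k) :
    IsRPP (n - 2 * k - 1) k (reversePlanePartition (staircase n) S) := by
  rw [reversePlanePartition_eq]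
  exact (isRecording_fillingBiword hkn hS).isFlagged.isRPP

theorem pathFan_eq (n k : ℕ) (S : Finset (ℕ × ℕ)) (i : Fin k) :
    pathFan (staircase n) k S i = boundaryPath (n - 2 * k - 1) (n - 2 * k - 1)
      (countLT (n - 2 * k - 1) (reversePlanePartition (staircase n) S) (k - i)) := by
  rw [pathFan, rowLen_innerShape, colLen_innerShape, Nat.sub_zero]
  congr 1
  funext r
  rw [rowCount, rowLen_innerShape, countLT]

theorem triangulationToFan_eq (n k : ℕ) (T : Finset (Fin n × Fin n)) :
    triangulationToFan n k T = fun i : Fin k => extendedPath (n - 2 * k - 1)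
      (reversePlanePartition (staircase n) (diagonalsToFilling n T)) (k - i) := by
  funext i
  rw [triangulationToFan, pathFan_eq, extendedPath]

theorem extendedPath_congr {h : ℕ} {R R' : ℕ → ℕ → ℕ} (m : ℕ)
    (heq : ∀ i j, i + j < h → R i j = R' i j) : extendedPath h R m = extendedPath h R' m := by
  have : countLT h R m = countLT h R' m := by
    funext i
    unfold countLT
    congr 1
    refine Finset.filter_congr fun j hj => ?_
    rw [heq i j (by rw [Finset.mem_range] at hj; omega)]
  rw [extendedPath, extendedPath, this]

theorem eq_of_reversePlanePartition_eq {n k : ℕ} (hkn : 2 * k < n) {S S' : Finset (ℕ × ℕ)}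
    (hS : S ∈ neFillings (staircase n) k) (hS' : S' ∈ neFillings (staircase n) k)
    (h : ∀ i j, i + j < n - 2 * k - 1 →
      reversePlanePartition (staircase n) S i j = reversePlanePartition (staircase n) S' i j) :
    S = S' := by
  have h1 := isRecording_fillingBiword hkn hS
  have h2 := isRecording_fillingBiword hkn hS'
  refine eq_of_recordSeq_eq hkn hS hS' (h1.eq_of_entries h2 fun i j hij => ?_)
  have h3 := h i j hij
  rw [reversePlanePartition_eq, reversePlanePartition_eq] at h3
  have h4 := h1.isFlagged.lower i j hij
  have h5 := h2.isFlagged.lower i j hij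
  dsimp only at h3 h4 h5
  omega

/-- The flag condition is the only restriction: all the reverse plane partitions with entries at most
`k` arise from maximal fillings. -/
theorem exists_reversePlanePartition_eq {n k : ℕ} (hkn : 2 * k < n) {R : ℕ → ℕ → ℕ}
    (hR : IsRPP (n - 2 * k - 1) k R) :
    ∃ S ∈ neFillings (staircase n) k, ∀ i j, i + j < n - 2 * k - 1 →
      reversePlanePartition (staircase n) S i j = R i j := by
  obtain ⟨L, hL, h1⟩ := hR.isFlagged.exists_recording
  obtain ⟨S, hS, rfl⟩ := exists_filling_of_isRecording hkn hL
  refine ⟨S, hS, fun i j hij => ?_⟩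
  rw [reversePlanePartition_eq]
  dsimp only
  rw [h1 i j hij]
  omega

theorem bijOn_triangulationToFan {n k : ℕ} (hkn : 2 * k < n) :
    Set.BijOn (triangulationToFan n k) (kTriangulations n k) (kFans k (n - 2 * k)) := by
  have hl : n - 2 * k = n - 2 * k - 1 + 1 := by omega
  refine ⟨fun T hT => ?_, fun T hT T' hT' h => ?_, fun p hp => ?_⟩
  · have h1 := (isRPP_reversePlanePartition hkn ((mem_kTriangulations_iff hkn).1 hT)).mem_kFans
    rw [triangulationToFan_eq, hl]
    exact h1
  · rw [mem_kTriangulations_iff hkn] at hT hT'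
    rw [triangulationToFan_eq, triangulationToFan_eq] at h
    refine diagonalsToFilling_injective n (eq_of_reversePlanePartition_eq hkn hT hT' fun i j hij => ?_)
    exact (isRPP_reversePlanePartition hkn hT).eq_of_extendedPath_eq
      (isRPP_reversePlanePartition hkn hT') (fun i => congrFun h i) hij
  · rw [hl] at hp
    obtain ⟨S, hS, h1⟩ := exists_reversePlanePartition_eq hkn (rppOfFan_isRPP p)
    obtain ⟨T, hT, rfl⟩ := (bijOn_diagonalsToFilling hkn).surjOn hS
    refine ⟨T, hT, ?_⟩
    rw [triangulationToFan_eq]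
    funext i
    rw [extendedPath_congr _ h1, extendedPath_rppOfFan hp]

/-! ### Compatibility with the map on fillings -/

/-- The first and the last vertex of an extended path are lifted to passive boxes, or to positions
outside the staircase; the other vertices are those of the original path. -/
theorem onLiftedPath_extend {n k i : ℕ} (hkn : 2 * k < n) {p : List DyckStep}
    (hp : p.length = 2 * (n - 2 * k - 1)) (hU : p.count U = n - 2 * k - 1) {b : ℕ × ℕ}
    (hb : b ∈ staircase n) (hpass : ¬ IsPassive (staircase n) k b) :
    OnLiftedPath k (n - 2 * k) i (U :: (p ++ [D])) b ↔ OnLiftedPath k (n - 2 * k - 1) i p b := by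
  rw [onLiftedPath_iff, onLiftedPath_iff]
  rw [isPassive_iff hkn] at hpass
  have hlen : (U :: (p ++ [D])).length = 2 * (n - 2 * k - 1) + 2 := by simp [hp]
  have hh : ∀ m, height (U :: (p ++ [D])) (m + 1) = height p m + 1 := fun m => by
    rw [height_cons_succ, height_append_D, if_pos rfl]
  rw [hlen]
  constructor
  · rintro ⟨m, h1, h2, h3⟩
    rcases m with _ | m
    · have h4 : height (U :: (p ++ [D])) 0 = 0 := rfl
      exact absurd ⟨hb, by omega⟩ hpass
    · rw [hh] at h2 h3
      by_cases hm : m ≤ p.length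
      · exact ⟨m, hm, by omega, by omega⟩
      · rw [height_of_length_le (by omega), hU] at h2 h3
        exact absurd ⟨hb, by omega⟩ hpass
  · rintro ⟨m, h1, h2, h3⟩
    exact ⟨m + 1, by omega, by rw [hh]; omega, by rw [hh]; omega⟩

theorem fanToFilling_triangulationToFan {n k : ℕ} (hkn : 2 * k < n) {T : Finset (Fin n × Fin n)}
    (hT : T ∈ kTriangulations n k) : fanToFilling n k (triangulationToFan n k T) =
      neToSe (staircase n) k (diagonalsToFilling n T) := by
  have hR := isRPP_reversePlanePartition hkn ((mem_kTriangulations_iff hkn).1 hT)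
  rw [fanToFilling, neToSe, liftFan, liftFan]
  classical
  refine Finset.filter_congr fun b hb => ?_
  rw [YoungDiagram.mem_cells] at hb
  refine or_congr_right' fun hpass => exists_congr fun i => ?_
  have h1 := hR.height_boundaryPath (k - i)
  rw [triangulationToFan, pathFan_eq, colLen_innerShape, Nat.sub_zero]
  exact onLiftedPath_extend hkn (by rw [h1.1]; omega) h1.2.1 hb hpass

theorem bijOn_neToSe {n k : ℕ} (hkn : 2 * k < n) :
    Set.BijOn (neToSe (staircase n) k) (neFillings (staircase n) k) (seFillings (staircase n) k) := by
  have h1 : Set.BijOn (neToSe (staircase n) k ∘ diagonalsToFilling n) (kTriangulations n k)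
      (seFillings (staircase n) k) :=
    ((bijOn_fanToFilling hkn).comp (bijOn_triangulationToFan hkn)).congr fun T hT =>
      fanToFilling_triangulationToFan hkn hT
  have h2 := bijOn_diagonalsToFilling hkn
  refine ⟨fun S hS => ?_, fun S hS S' hS' h => ?_, fun S hS => ?_⟩
  · obtain ⟨T, hT, rfl⟩ := h2.surjOn hS
    exact h1.mapsTo hT
  · obtain ⟨T, hT, rfl⟩ := h2.surjOn hS
    obtain ⟨T', hT', rfl⟩ := h2.surjOn hS'
    rw [h1.injOn hT hT' h]
  · obtain ⟨T, hT, rfl⟩ := h1.surjOn hS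
    exact ⟨_, h2.mapsTo hT, rfl⟩

end MaximalFillings

theorem theorem1 (n k : ℕ) (hk : 0 < k) (hkn : 2 * k < n) :
    -- the explicit map is a bijection from `k`-triangulations to `k`-fans
    Set.BijOn (MaximalFillings.triangulationToFan n k)
      (MaximalFillings.kTriangulations n k) (MaximalFillings.kFans k (n - 2 * k)) ∧
    -- it is the staircase case of the map from north-east to south-east fillings
    Set.BijOn (MaximalFillings.neToSe (MaximalFillings.staircase n) k)
      (MaximalFillings.neFillings (MaximalFillings.staircase n) k)
      (MaximalFillings.seFillings (MaximalFillings.staircase n) k) ∧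
    Set.BijOn (MaximalFillings.diagonalsToFilling n)
      (MaximalFillings.kTriangulations n k)
      (MaximalFillings.neFillings (MaximalFillings.staircase n) k) ∧
    Set.BijOn (MaximalFillings.fanToFilling n k)
      (MaximalFillings.kFans k (n - 2 * k))
      (MaximalFillings.seFillings (MaximalFillings.staircase n) k) ∧
    ∀ T ∈ MaximalFillings.kTriangulations n k,
      MaximalFillings.fanToFilling n k (MaximalFillings.triangulationToFan n k T) =
        MaximalFillings.neToSe (MaximalFillings.staircase n) k
          (MaximalFillings.diagonalsToFilling n T) :=
  ⟨MaximalFillings.bijOn_triangulationToFan hkn, MaximalFillings.bijOn_neToSe hkn,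
    MaximalFillings.bijOn_diagonalsToFilling hkn, MaximalFillings.bijOn_fanToFilling hkn,
    fun _ hT => MaximalFillings.fanToFilling_triangulationToFan hkn hT⟩
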